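/- Let $\overline{\mathbb Q}\subset\mathbb C$ be the field of algebraic numbers, $q=e^{\pi i/8}$ and $[n]_q=\frac{q^n-q^{-n}}{q-q^{-1}}$. Let $\mathcal C(\mathfrak{sl}_2,q)$ be the Verlinde category over $\overline{\mathbb Q}$: the category of tilting modules of the quantum group $SL_q(2)$ (direct summands of direct sums of tensor powers of the two-dimensional representation $V_1$) modulo negligible morphisms. Its simple objects are, up to isomorphism, the pairwise non-isomorphic objects $V_0=\mathbf 1,V_1,\dots,V_6$ with $V_{i+1}\otimes V_1\cong V_i\oplus V_{i+2}$ for $0\le i\le 4$, and each of its objects is a direct sum of these. Let $\mathcal D$ be the full tensor subcategory generated by $V_0,V_2,V_4,V_6$ (equivalently, the objects generated from $V_1\otimes V_1$ by tensor products, direct sums and direct summands; these are the direct sums of copies of $V_0,V_2,V_4,V_6$). For a prime $p$, let $\overline{\mathbb Z}_p$ be the ring of integers of $\overline{\mathbb Q}_p$ and $\mathfrak m$ its maximal ideal. A prime $p$ is *good* for a semisimple rigid tensor category $\mathcal A$ over $\overline{\mathbb Q}$ if for some embedding $\overline{\mathbb Q}\to\overline{\mathbb Q}_p$ there are a semisimple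 rigid tensor category $\mathcal A_p$ over $\overline{\mathbb Z}_p/\mathfrak m=\overline{\mathbb F}_p$ and a semisimple rigid tensor category $\widetilde{\mathcal A}_p$ over $\overline{\mathbb Z}_p$ whose reduction modulo $\mathfrak m$ is $\mathcal A_p$, with $\widetilde{\mathcal A}_p\otimes_{\overline{\mathbb Z}_p}\overline{\mathbb Q}_p\cong\mathcal A\otimes_{\overline{\mathbb Q}}\overline{\mathbb Q}_p$ as tensor categories; otherwise $p$ is *bad*. Write $|V|^2$ for Müger's squared norm of a simple object $V$; a prime $p$ is relatively prime to an algebraic integer if it is relatively prime to the norm of that integer. Then the following hold. 1. $\mathcal D$ is a fusion category over $\overline{\mathbb Q}$ that admits a braiding, with simple objects $V_0,V_2,V_4,V_6$. Their quantum dimensions are $\dim V_0=\dim V_6=1$ and $\dim V_2=\dim V_4=1+\sqrt2$. For every simple object $V$ of $\mathcal D$, $|V|^2=(\dim V)^2$, the number $\dim V$ is a unit in the ring of algebraic integers, and every prime is relatively prime to $\dim V$ and to $|V|^2$. 2. Let $X=V_2$. For an isomorphism $b:X\to X^*$ and a morphism $m:X\otimes X\to X$ let $m_*:X\to X\otimes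 X$ be the dual of $m$ (identifying $X^*$ with $X$ by $b$), and put $A(T_2)=\mathrm{Tr}(mm_*)$ and $A(T_4)=\mathrm{Tr}(m(1\otimes m)(m_*\otimes 1)m_*)$. If $m\ne0$ then $A(T_2)\neq 0$; there are $m,b$ with $mm_*=\mathrm{id}_X$; and for all such $m,b$ $$A(T_4)=\frac{[3]_q([3]_q-2)}{[3]_q-1}=\frac1{\sqrt2}.$$ If instead $m,b$ are normalised by $A(T_2)=1$, then $A(T_4)=\frac{1}{\sqrt2\,[3]_q^2}$. 3. $2$ is a bad prime for $\mathcal D$. 4. Consequently, the following statement is false: for every braided fusion category $\mathcal A$ over $\overline{\mathbb Q}$ and every prime $p$, if $p$ is relatively prime to $|V|^2$ for every simple object $V$ of $\mathcal A$, then $p$ is good for $\mathcal A$. -/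

import Mathlib

open CategoryTheory MonoidalCategory Limits
open scoped TensorProduct

noncomputable section

namespace Verlinde

section QuantumGroup

variable {k : Type} [Field k]

/-- The defining relations of the quantum coordinate algebra of `SL_q(2)`, with generators
`a = (0, 0)`, `b = (0, 1)`, `c = (1, 0)`, `d = (1, 1)`:
`ab = q ba`, `ac = q ca`, `bd = q db`, `cd = q dc`, `bc = cb`, `ad - q bc = 1 = da - q⁻¹ bc`. -/
inductive OqRel (q : kˣ) : FreeAlgebra k (Fin 2 × Fin 2) → FreeAlgebra k (Fin 2 × Fin 2) → Prop
  | ab : OqRel q (FreeAlgebra.ι k (0, 0) * FreeAlgebra.ι k (0, 1))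
      ((q : k) • (FreeAlgebra.ι k (0, 1) * FreeAlgebra.ι k (0, 0)))
  | ac : OqRel q (FreeAlgebra.ι k (0, 0) * FreeAlgebra.ι k (1, 0))
      ((q : k) • (FreeAlgebra.ι k (1, 0) * FreeAlgebra.ι k (0, 0)))
  | bd : OqRel q (FreeAlgebra.ι k (0, 1) * FreeAlgebra.ι k (1, 1))
      ((q : k) • (FreeAlgebra.ι k (1, 1) * FreeAlgebra.ι k (0, 1)))
  | cd : OqRel q (FreeAlgebra.ι k (1, 0) * FreeAlgebra.ι k (1, 1))
      ((q : k) • (FreeAlgebra.ι k (1, 1) * FreeAlgebra.ι k (1, 0)))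
  | bc : OqRel q (FreeAlgebra.ι k (0, 1) * FreeAlgebra.ι k (1, 0))
      (FreeAlgebra.ι k (1, 0) * FreeAlgebra.ι k (0, 1))
  | ad : OqRel q (FreeAlgebra.ι k (0, 0) * FreeAlgebra.ι k (1, 1))
      (1 + (q : k) • (FreeAlgebra.ι k (0, 1) * FreeAlgebra.ι k (1, 0)))
  | da : OqRel q (FreeAlgebra.ι k (1, 1) * FreeAlgebra.ι k (0, 0))
      (1 + ((q⁻¹ : kˣ) : k) • (FreeAlgebra.ι k (0, 1) * FreeAlgebra.ι k (1, 0)))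

/-- The quantum coordinate algebra `O_q(SL₂)`. -/
def Oq (q : kˣ) : Type := RingQuot (OqRel q)

instance (q : kˣ) : Ring (Oq q) := inferInstanceAs (Ring (RingQuot (OqRel q)))

instance (q : kˣ) : Algebra k (Oq q) := inferInstanceAs (Algebra k (RingQuot (OqRel q)))

/-- The projection from the free algebra. -/
def mk (q : kˣ) : FreeAlgebra k (Fin 2 × Fin 2) →ₐ[k] Oq q := RingQuot.mkAlgHom k (OqRel q)

theorem mk_rel {q : kˣ} {x y : FreeAlgebra k (Fin 2 × Fin 2)} (h : OqRel q x y) :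
    mk q x = mk q y := RingQuot.mkAlgHom_rel k h

/-- The generators of `O_q(SL₂)`, as the entries of a `2 × 2` matrix. -/
def gen (q : kˣ) (i j : Fin 2) : Oq q :=
  mk q (FreeAlgebra.ι k (i, j))

section Relations
variable (q : kˣ)

theorem gen_ab : gen q 0 0 * gen q 0 1 = (q : k) • (gen q 0 1 * gen q 0 0) := by
  simpa only [gen, map_mul, map_smul] using mk_rel (OqRel.ab (q := q))
theorem gen_ac : gen q 0 0 * gen q 1 0 = (q : k) • (gen q 1 0 * gen q 0 0) := by
  simpa only [gen, map_mul, map_smul] using mk_rel (OqRel.ac (q := q))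
theorem gen_bd : gen q 0 1 * gen q 1 1 = (q : k) • (gen q 1 1 * gen q 0 1) := by
  simpa only [gen, map_mul, map_smul] using mk_rel (OqRel.bd (q := q))
theorem gen_cd : gen q 1 0 * gen q 1 1 = (q : k) • (gen q 1 1 * gen q 1 0) := by
  simpa only [gen, map_mul, map_smul] using mk_rel (OqRel.cd (q := q))
theorem gen_bc : gen q 0 1 * gen q 1 0 = gen q 1 0 * gen q 0 1 := by
  simpa only [gen, map_mul, map_smul] using mk_rel (OqRel.bc (q := q))
theorem gen_ad : gen q 0 0 * gen q 1 1 = 1 + (q : k) • (gen q 0 1 * gen q 1 0) := by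
  simpa only [gen, map_mul, map_smul, map_add, map_one] using
    mk_rel (OqRel.ad (q := q))
theorem gen_da : gen q 1 1 * gen q 0 0 = 1 + ((q⁻¹ : kˣ) : k) • (gen q 0 1 * gen q 1 0) := by
  simpa only [gen, map_mul, map_smul, map_add, map_one] using
    mk_rel (OqRel.da (q := q))
end Relations

/-- Algebra homomorphisms out of `O_q(SL₂)`. -/
def lift {q : kˣ} {A : Type} [Ring A] [Algebra k A] (t : Fin 2 → Fin 2 → A)
    (hab : t 0 0 * t 0 1 = (q : k) • (t 0 1 * t 0 0))
    (hac : t 0 0 * t 1 0 = (q : k) • (t 1 0 * t 0 0))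
    (hbd : t 0 1 * t 1 1 = (q : k) • (t 1 1 * t 0 1))
    (hcd : t 1 0 * t 1 1 = (q : k) • (t 1 1 * t 1 0))
    (hbc : t 0 1 * t 1 0 = t 1 0 * t 0 1)
    (had : t 0 0 * t 1 1 = 1 + (q : k) • (t 0 1 * t 1 0))
    (hda : t 1 1 * t 0 0 = 1 + ((q⁻¹ : kˣ) : k) • (t 0 1 * t 1 0)) : Oq q →ₐ[k] A :=
  RingQuot.liftAlgHom k ⟨FreeAlgebra.lift k fun x => t x.1 x.2, by
    intro x y h
    cases h <;> simpa only [map_mul, map_smul, map_add, map_one, FreeAlgebra.lift_ι_apply]⟩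

theorem lift_gen {q : kˣ} {A : Type} [Ring A] [Algebra k A] (t : Fin 2 → Fin 2 → A)
    (hab hac hbd hcd hbc had hda) (i j : Fin 2) :
    lift (q := q) t hab hac hbd hcd hbc had hda (gen q i j) = t i j :=
  (RingQuot.liftAlgHom_mkAlgHom_apply k _ _ _).trans (FreeAlgebra.lift_ι_apply _ _)

theorem comul_aux (q : kˣ) :
    let t : Fin 2 → Fin 2 → Oq q ⊗[k] Oq q := fun i j => ∑ l, gen q i l ⊗ₜ[k] gen q l j
    t 0 0 * t 0 1 = (q : k) • (t 0 1 * t 0 0) ∧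
    t 0 0 * t 1 0 = (q : k) • (t 1 0 * t 0 0) ∧
    t 0 1 * t 1 1 = (q : k) • (t 1 1 * t 0 1) ∧
    t 1 0 * t 1 1 = (q : k) • (t 1 1 * t 1 0) ∧
    t 0 1 * t 1 0 = t 1 0 * t 0 1 ∧
    t 0 0 * t 1 1 = 1 + (q : k) • (t 0 1 * t 1 0) ∧
    t 1 1 * t 0 0 = 1 + ((q⁻¹ : kˣ) : k) • (t 0 1 * t 1 0) := by
  have hq : (q : k) ≠ 0 := q.ne_zero
  refine ⟨?_, ?_, ?_, ?_, ?_, ?_, ?_⟩ <;>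
  simp only [Fin.sum_univ_two, add_mul, mul_add, Algebra.TensorProduct.tmul_mul_tmul,
    Algebra.TensorProduct.one_def, gen_ab, gen_ac, gen_bd, gen_cd, ← gen_bc, gen_ad, gen_da,
    TensorProduct.tmul_add, TensorProduct.add_tmul, TensorProduct.tmul_smul,
    ← TensorProduct.smul_tmul', smul_add, smul_smul, Units.val_inv_eq_inv_val] <;>
  match_scalars <;> field_simp

/-- The comultiplication `Δ(t_ij) = ∑ t_il ⊗ t_lj`. -/
def comul (q : kˣ) : Oq q →ₐ[k] Oq q ⊗[k] Oq q :=
  lift (fun i j => ∑ l, gen q i l ⊗ₜ[k] gen q l j)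
    (comul_aux q).1 (comul_aux q).2.1 (comul_aux q).2.2.1 (comul_aux q).2.2.2.1
    (comul_aux q).2.2.2.2.1 (comul_aux q).2.2.2.2.2.1 (comul_aux q).2.2.2.2.2.2

/-- The counit `ε(t_ij) = δ_ij`. -/
def counit (q : kˣ) : Oq q →ₐ[k] k :=
  lift (fun i j => if i = j then 1 else 0)
    (by simp) (by simp) (by simp) (by simp) (by simp) (by simp) (by simp)

/-- The character `a ↦ q`, `d ↦ q⁻¹`, `b, c ↦ 0` of `O_q(SL₂)`: the element `K = K_{2ρ}` of the
quantum group. -/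
def torus (q : kˣ) : Oq q →ₐ[k] k :=
  lift (fun i j => if i = j then (if i = 0 then (q : k) else ((q⁻¹ : kˣ) : k)) else 0)
    (by simp) (by simp) (by simp) (by simp) (by simp) (by simp) (by simp)


/-- A finite dimensional representation of the quantum group `SL_q(2)`, i.e. a finite dimensional
comodule over `O_q(SL₂)`, given in a basis indexed by `ι` by its matrix of coefficients: the coaction
is `e_j ↦ ∑ e_i ⊗ M_ij`. -/
structure Corep (q : kˣ) : Type 1 where
  ι : Type
  [fintype : Fintype ι]
  [decEq : DecidableEq ι]
  M : Matrix ι ι (Oq q)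
  comul_M : ∀ i j, comul q (M i j) = ∑ l, M i l ⊗ₜ[k] M l j
  counit_M : ∀ i j, counit q (M i j) = if i = j then 1 else 0

attribute [instance] Corep.fintype Corep.decEq

namespace Corep

variable {q : kˣ}

/-- A scalar matrix, seen as a matrix over `O_q(SL₂)`. -/
abbrev sc {m n : Type} (q : kˣ) (T : Matrix m n k) : Matrix m n (Oq q) := T.map (algebraMap k (Oq q))

/-- Homomorphisms of representations, as matrices. -/
def homs (X Y : Corep q) : Submodule k (Matrix Y.ι X.ι k) where
  carrier := {T | Y.M * sc q T = sc q T * X.M}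
  add_mem' {S T} hS hT := by
    change _ = _
    have h : sc q (S + T) = sc q S + sc q T := Matrix.map_add _ (map_add _) S T
    rw [h, Matrix.mul_add, Matrix.add_mul]
    exact congrArg₂ _ hS hT
  zero_mem' := by simp [sc]
  smul_mem' c T hT := by
    have h : sc q (c • T) = c • sc q T := by
      ext i j; simp [sc, Algebra.smul_def]
    change _ = _
    rw [h, Matrix.mul_smul, Matrix.smul_mul]
    exact congrArg _ hT

theorem sc_mul {l m n : Type} [Fintype m] (S : Matrix l m k) (T : Matrix m n k) :
    sc q (S * T) = sc q S * sc q T := Matrix.map_mul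

theorem sc_one {n : Type} [DecidableEq n] : sc q (1 : Matrix n n k) = 1 := by
  ext i j; rcases eq_or_ne i j with rfl | h <;> simp [sc, *]

instance : Category (Corep q) where
  Hom X Y := homs X Y
  id X := ⟨1, by change _ = _; rw [sc_one, Matrix.mul_one, Matrix.one_mul]⟩
  comp {X Y Z} f g := ⟨g.1 * f.1, by
    change Z.M * sc q (g.1 * f.1) = sc q (g.1 * f.1) * X.M
    rw [sc_mul, ← Matrix.mul_assoc, g.2, Matrix.mul_assoc, f.2, Matrix.mul_assoc]⟩
  id_comp f := Subtype.ext (Matrix.mul_one _)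
  comp_id f := Subtype.ext (Matrix.one_mul _)
  assoc f g h := Subtype.ext (Matrix.mul_assoc _ _ _).symm

/-- The matrix of a homomorphism. -/
def mat {X Y : Corep q} (f : X ⟶ Y) : Matrix Y.ι X.ι k := f.1

/-- The homomorphism with a given matrix. -/
def ofMat {X Y : Corep q} (T : Matrix Y.ι X.ι k) (h : Y.M * sc q T = sc q T * X.M) : X ⟶ Y := ⟨T, h⟩

theorem mat_comm {X Y : Corep q} (f : X ⟶ Y) : Y.M * sc q (mat f) = sc q (mat f) * X.M := f.2

@[simp] theorem mat_ofMat {X Y : Corep q} (T : Matrix Y.ι X.ι k) (h) :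
    mat (ofMat (X := X) (Y := Y) T h) = T := rfl

theorem hom_ext {X Y : Corep q} {f g : X ⟶ Y} (h : mat f = mat g) : f = g := Subtype.ext h

instance : Preadditive (Corep q) where
  homGroup X Y := inferInstanceAs (AddCommGroup (homs X Y))
  add_comp _ _ _ _ _ _ := Subtype.ext (Matrix.mul_add _ _ _)
  comp_add _ _ _ _ _ _ := Subtype.ext (Matrix.add_mul _ _ _)

instance : Linear k (Corep q) where
  homModule X Y := inferInstanceAs (Module k (homs X Y))
  smul_comp _ _ _ _ _ _ := Subtype.ext (Matrix.mul_smul _ _ _)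
  comp_smul _ _ _ _ _ _ := Subtype.ext (Matrix.smul_mul _ _ _)

@[simp] theorem mat_id (X : Corep q) : mat (𝟙 X) = 1 := rfl
@[simp] theorem mat_comp {X Y Z : Corep q} (f : X ⟶ Y) (g : Y ⟶ Z) :
    mat (f ≫ g) = mat g * mat f := rfl
@[simp] theorem mat_add {X Y : Corep q} (f g : X ⟶ Y) : mat (f + g) = mat f + mat g := rfl
@[simp] theorem mat_zero {X Y : Corep q} : mat (0 : X ⟶ Y) = 0 := rfl
@[simp] theorem mat_smul {X Y : Corep q} (c : k) (f : X ⟶ Y) : mat (c • f) = c • mat f := rfl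

open scoped Kronecker

/-- The trivial representation. -/
def unit (q : kˣ) : Corep q where
  ι := Unit
  M := 1
  comul_M _ _ := by simp [Algebra.TensorProduct.one_def]
  counit_M _ _ := by simp

theorem kron_comm {m m' n n' : Type} [Fintype m] [Fintype m'] [Fintype n] [Fintype n']
    {A : Matrix m m (Oq q)} {A' : Matrix m' m' (Oq q)} {B : Matrix n n (Oq q)}
    {B' : Matrix n' n' (Oq q)} {S : Matrix m' m k} {T : Matrix n' n k}
    (hS : A' * sc q S = sc q S * A) (hT : B' * sc q T = sc q T * B) :
    (A' ⊗ₖ B') * sc q (S ⊗ₖ T) = sc q (S ⊗ₖ T) * (A ⊗ₖ B) := by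
  ext i j
  have h1 := congrFun (congrFun hS i.1) j.1
  have h2 := congrFun (congrFun hT i.2) j.2
  simp only [Matrix.mul_apply, sc, Matrix.map_apply] at h1 h2
  calc _ = (∑ a, A' i.1 a * algebraMap k (Oq q) (S a j.1)) *
        ∑ b, B' i.2 b * algebraMap k (Oq q) (T b j.2) := by
        simp only [Matrix.mul_apply, sc, Matrix.map_apply, Matrix.kroneckerMap_apply,
          Finset.sum_mul_sum, map_mul]
        rw [Fintype.sum_prod_type]
        refine Finset.sum_congr rfl fun a _ => Finset.sum_congr rfl fun b _ => ?_
        rw [mul_assoc, mul_assoc, ← mul_assoc (B' _ _), ← Algebra.commutes (S a j.1),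
          mul_assoc, Algebra.commutes (S a j.1)]
    _ = _ := by
        rw [h1, h2]
        simp only [Matrix.mul_apply, sc, Matrix.map_apply, Matrix.kroneckerMap_apply,
          Finset.sum_mul_sum, map_mul]
        rw [Fintype.sum_prod_type]
        refine Finset.sum_congr rfl fun a _ => Finset.sum_congr rfl fun b _ => ?_
        rw [mul_assoc, mul_assoc, ← mul_assoc (A _ _), ← Algebra.commutes (T i.2 b),
          mul_assoc]

/-- The tensor product of representations. -/
def tensor (X Y : Corep q) : Corep q where
  ι := X.ι × Y.ι
  M := X.M ⊗ₖ Y.M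
  comul_M i j := by
    simp only [Matrix.kroneckerMap_apply, map_mul, X.comul_M, Y.comul_M, Finset.sum_mul_sum,
      Fintype.sum_prod_type, Algebra.TensorProduct.tmul_mul_tmul]
  counit_M i j := by
    simp only [Matrix.kroneckerMap_apply, map_mul, X.counit_M, Y.counit_M, Prod.ext_iff]
    split_ifs <;> simp_all

/-- The matrix of a relabelling of basis vectors. -/
def perm {m n : Type} [DecidableEq n] (k : Type) [Field k] (e : m ≃ n) : Matrix n m k :=
  (1 : Matrix n n k).submatrix id e

section Perm

variable {l m n : Type} [DecidableEq n]

theorem perm_mul [Fintype m] [Finite n] (e : m ≃ n) (A : Matrix m l k) :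
    perm k e * A = A.submatrix e.symm id :=
  Matrix.one_submatrix_mul (id : n → n) e A

theorem mul_perm [Fintype n] (e : m ≃ n) (A : Matrix l n k) :
    A * perm k e = A.submatrix id e :=
  Matrix.mul_submatrix_one (Equiv.refl n) e A

theorem perm_mul_perm [Fintype m] [DecidableEq m] (e : l ≃ m) (f : m ≃ n) :
    perm k f * perm k e = perm k (e.trans f) := by
  rw [mul_perm]
  ext i j
  simp [perm, Matrix.one_apply]

theorem one_kron_perm [DecidableEq l] (e : m ≃ n) :
    (1 : Matrix l l k) ⊗ₖ perm k e = perm k (Equiv.prodCongr (Equiv.refl l) e) := by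
  ext i j
  simp [perm, Matrix.one_apply, Prod.ext_iff, ← ite_and, and_comm]

theorem perm_kron_one [DecidableEq l] (e : m ≃ n) :
    perm k e ⊗ₖ (1 : Matrix l l k) = perm k (Equiv.prodCongr e (Equiv.refl l)) := by
  ext i j
  simp [perm, Matrix.one_apply, Prod.ext_iff, ← ite_and, and_comm]

theorem perm_comm {X Y : Corep q} (e : X.ι ≃ Y.ι) (h : ∀ i j, Y.M (e i) (e j) = X.M i j) :
    Y.M * sc q (perm k e) = sc q (perm k e) * X.M := by
  have : sc q (perm k e) = (1 : Matrix Y.ι Y.ι (Oq q)).submatrix id e := by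
    rw [← sc_one]; rfl
  rw [this]
  refine (Matrix.mul_submatrix_one (Equiv.refl Y.ι) e Y.M).trans
    (Eq.trans ?_ (Matrix.one_submatrix_mul (id : Y.ι → Y.ι) e X.M).symm)
  ext i j
  simp [← h]

end Perm

/-- The isomorphism given by a relabelling of basis vectors. -/
def isoOfEquiv {X Y : Corep q} (e : X.ι ≃ Y.ι)
    (h : ∀ i j, Y.M (e i) (e j) = X.M i j) : X ≅ Y where
  hom := ofMat (perm k e) (perm_comm e h)
  inv := ofMat (perm k e.symm) (perm_comm e.symm fun i j => by simp [← h])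
  hom_inv_id := hom_ext (by
    rw [mat_comp, mat_ofMat, mat_ofMat, perm_mul_perm, Equiv.self_trans_symm]; rfl)
  inv_hom_id := hom_ext (by
    rw [mat_comp, mat_ofMat, mat_ofMat, perm_mul_perm, Equiv.symm_trans_self]; rfl)

instance : MonoidalCategoryStruct (Corep q) where
  tensorObj := tensor
  tensorUnit := unit q
  whiskerLeft X _ _ f := ofMat ((1 : Matrix X.ι X.ι k) ⊗ₖ mat f)
    (kron_comm (mat_comm (𝟙 X)) (mat_comm f))
  whiskerRight f Y := ofMat (mat f ⊗ₖ (1 : Matrix Y.ι Y.ι k))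
    (kron_comm (mat_comm f) (mat_comm (𝟙 Y)))
  tensorHom f g := ofMat (mat f ⊗ₖ mat g) (kron_comm (mat_comm f) (mat_comm g))
  associator X Y Z := isoOfEquiv (Equiv.prodAssoc X.ι Y.ι Z.ι)
    (fun _ _ => (mul_assoc _ _ _).symm)
  leftUnitor X := isoOfEquiv (Equiv.punitProd X.ι) (fun i j => by
    change X.M i.2 j.2 = 1 * X.M i.2 j.2
    rw [one_mul])
  rightUnitor X := isoOfEquiv (Equiv.prodPUnit X.ι) (fun i j => by
    change X.M i.1 j.1 = X.M i.1 j.1 * 1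
    rw [mul_one])

theorem mat_whiskerLeft (X : Corep q) {Y Z : Corep q} (f : Y ⟶ Z) :
    mat (X ◁ f) = (1 : Matrix X.ι X.ι k) ⊗ₖ mat f := rfl
theorem mat_whiskerRight {Y Z : Corep q} (f : Y ⟶ Z) (X : Corep q) :
    mat (f ▷ X) = mat f ⊗ₖ (1 : Matrix X.ι X.ι k) := rfl
theorem mat_tensorHom {X Y X' Y' : Corep q} (f : X ⟶ Y) (g : X' ⟶ Y') :
    mat (f ⊗ₘ g) = mat f ⊗ₖ mat g := rfl
theorem mat_associator (X Y Z : Corep q) :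
    mat (α_ X Y Z).hom = perm k (Equiv.prodAssoc X.ι Y.ι Z.ι) := rfl
theorem mat_leftUnitor (X : Corep q) : mat (λ_ X).hom = perm k (Equiv.punitProd X.ι) := rfl
theorem mat_rightUnitor (X : Corep q) : mat (ρ_ X).hom = perm k (Equiv.prodPUnit X.ι) := rfl

instance : MonoidalCategory (Corep q) where
  tensorHom_def f g := hom_ext (by
    refine Eq.trans ?_ (Matrix.mul_kronecker_mul (1 : Matrix _ _ k) (mat f) (mat g) 1)
    rw [Matrix.one_mul, Matrix.mul_one]
    rfl)
  id_tensorHom_id X Y := hom_ext Matrix.one_kronecker_one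
  tensorHom_comp_tensorHom f g f' g' := hom_ext (Matrix.mul_kronecker_mul _ _ _ _).symm
  whiskerLeft_id X Y := hom_ext Matrix.one_kronecker_one
  id_whiskerRight X Y := hom_ext Matrix.one_kronecker_one
  associator_naturality {X₁ X₂ X₃ Y₁ Y₂ Y₃} f g h := hom_ext (by
    change perm k (Equiv.prodAssoc Y₁.ι Y₂.ι Y₃.ι) * ((mat f ⊗ₖ mat g) ⊗ₖ mat h) =
      (mat f ⊗ₖ (mat g ⊗ₖ mat h)) * perm k (Equiv.prodAssoc X₁.ι X₂.ι X₃.ι)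
    rw [perm_mul, mul_perm]
    ext i j
    exact mul_assoc _ _ _)
  leftUnitor_naturality {X Y} f := hom_ext (by
    change perm k (Equiv.punitProd Y.ι) * ((1 : Matrix Unit Unit k) ⊗ₖ mat f) =
      mat f * perm k (Equiv.punitProd X.ι)
    rw [perm_mul, mul_perm]
    ext i j
    exact one_mul _)
  rightUnitor_naturality {X Y} f := hom_ext (by
    change perm k (Equiv.prodPUnit Y.ι) * (mat f ⊗ₖ (1 : Matrix Unit Unit k)) =
      mat f * perm k (Equiv.prodPUnit X.ι)
    rw [perm_mul, mul_perm]
    ext i j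
    exact mul_one _)
  pentagon W X Y Z := hom_ext (by
    change ((1 : Matrix W.ι W.ι k) ⊗ₖ perm k (Equiv.prodAssoc X.ι Y.ι Z.ι)) *
        perm k (Equiv.prodAssoc W.ι (X.ι × Y.ι) Z.ι) *
        (perm k (Equiv.prodAssoc W.ι X.ι Y.ι) ⊗ₖ (1 : Matrix Z.ι Z.ι k)) =
      perm k (Equiv.prodAssoc W.ι X.ι (Y.ι × Z.ι)) *
        perm k (Equiv.prodAssoc (W.ι × X.ι) Y.ι Z.ι)
    rw [one_kron_perm, perm_kron_one, perm_mul_perm, perm_mul_perm, perm_mul_perm]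
    rfl)
  triangle X Y := hom_ext (by
    change ((1 : Matrix X.ι X.ι k) ⊗ₖ perm k (Equiv.punitProd Y.ι)) *
        perm k (Equiv.prodAssoc X.ι Unit Y.ι) =
      perm k (Equiv.prodPUnit X.ι) ⊗ₖ (1 : Matrix Y.ι Y.ι k)
    rw [one_kron_perm, perm_kron_one, perm_mul_perm]
    rfl)

instance : MonoidalPreadditive (Corep q) where
  whiskerLeft_zero := hom_ext (Matrix.kronecker_zero _)
  zero_whiskerRight := hom_ext (Matrix.zero_kronecker _)
  whiskerLeft_add _ _ := hom_ext (Matrix.kronecker_add _ _ _)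
  add_whiskerRight _ _ := hom_ext (Matrix.add_kronecker _ _ _)

instance : MonoidalLinear k (Corep q) where
  whiskerLeft_smul _ _ _ r f := hom_ext (Matrix.kronecker_smul r _ (mat f))
  smul_whiskerRight r _ _ f _ := hom_ext (Matrix.smul_kronecker r (mat f) _)

/-- The two-dimensional fundamental representation `V_1`. -/
def fund (q : kˣ) : Corep q where
  ι := Fin 2
  M := Matrix.of (gen q)
  comul_M i j := lift_gen _ _ _ _ _ _ _ _ i j
  counit_M i j := lift_gen _ _ _ _ _ _ _ _ i j

/-- The quantum dimension: the trace of `K`. -/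
def qdim (X : Corep q) : k := ∑ i, torus q (X.M i i)

end Corep
end QuantumGroup

section Negligible

universe v u

variable (k : Type) [Field k] {T : Type u} [Category.{v} T] [Preadditive T] [Linear k T]
  [MonoidalCategory T] [MonoidalPreadditive T] [MonoidalLinear k T]

/-- The negligible morphisms: those `f` all of whose closures `𝟙 ⟶ W ⊗ X ⊗ Z ⟶ W ⊗ Y ⊗ Z ⟶ 𝟙`
vanish. This is the largest tensor ideal that does not meet `End(𝟙)` if `End(𝟙) = k`; for tilting
modules it consists of the `f` such that all quantum traces `Tr_q(g f)` vanish. -/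
def negligible (X Y : T) : Submodule k (X ⟶ Y) where
  carrier := {f | ∀ (W Z : T) (a : 𝟙_ T ⟶ W ⊗ (X ⊗ Z)) (b : W ⊗ (Y ⊗ Z) ⟶ 𝟙_ T),
    a ≫ W ◁ (f ▷ Z) ≫ b = 0}
  add_mem' {f g} hf hg W Z a b := by
    simp only [MonoidalPreadditive.add_whiskerRight, MonoidalPreadditive.whiskerLeft_add,
      Preadditive.add_comp, Preadditive.comp_add, hf W Z a b, hg W Z a b, add_zero]
  zero_mem' W Z a b := by simp
  smul_mem' c f hf W Z a b := by
    simp only [MonoidalLinear.smul_whiskerRight, MonoidalLinear.whiskerLeft_smul,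
      Linear.smul_comp, Linear.comp_smul, hf W Z a b, smul_zero]

variable {k}

theorem negligible_comp {X Y Z : T} {f : X ⟶ Y} (hf : f ∈ negligible k X Y) (g : Y ⟶ Z) :
    f ≫ g ∈ negligible k X Z := fun V W a b => by
  have := hf V W a (V ◁ (g ▷ W) ≫ b)
  simpa using this

theorem comp_negligible {X Y Z : T} (f : X ⟶ Y) {g : Y ⟶ Z} (hg : g ∈ negligible k Y Z) :
    f ≫ g ∈ negligible k X Z := fun V W a b => by
  have := hg V W (a ≫ V ◁ (f ▷ W)) b
  simpa using this

theorem negligible_whiskerRight {X Y : T} {f : X ⟶ Y} (hf : f ∈ negligible k X Y) (Z : T) :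
    f ▷ Z ∈ negligible k (X ⊗ Z) (Y ⊗ Z) := fun V W a b => by
  have h : V ◁ ((f ▷ Z) ▷ W) =
      V ◁ (α_ _ _ _).hom ≫ V ◁ (f ▷ (Z ⊗ W)) ≫ V ◁ (α_ _ _ _).inv := by
    rw [← MonoidalCategory.whiskerLeft_comp, ← MonoidalCategory.whiskerLeft_comp]
    simp
  rw [h]
  simpa only [Category.assoc] using hf V (Z ⊗ W) (a ≫ V ◁ (α_ _ _ _).hom) (V ◁ (α_ _ _ _).inv ≫ b)

theorem whiskerLeft_negligible (Z : T) {X Y : T} {f : X ⟶ Y} (hf : f ∈ negligible k X Y) :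
    Z ◁ f ∈ negligible k (Z ⊗ X) (Z ⊗ Y) := fun V W a b => by
  have h : V ◁ ((Z ◁ f) ▷ W) = V ◁ (α_ _ _ _).hom ≫ (α_ _ _ _).inv ≫
      (V ⊗ Z) ◁ (f ▷ W) ≫ (α_ _ _ _).hom ≫ V ◁ (α_ _ _ _).inv := by
    simp
  rw [h]
  simpa only [Category.assoc] using hf (V ⊗ Z) W (a ≫ V ◁ (α_ _ _ _).hom ≫ (α_ _ _ _).inv)
    ((α_ _ _ _).hom ≫ V ◁ (α_ _ _ _).inv ≫ b)

variable (k T)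

/-- The quotient of a `k`-linear monoidal category by the ideal of negligible morphisms. -/
structure NegligibleQuotient (k : Type) [Field k] (T : Type u) [Category.{v} T] [Preadditive T]
    [Linear k T] [MonoidalCategory T] [MonoidalPreadditive T] [MonoidalLinear k T] where
  as : T

variable {k T}

namespace NegligibleQuotient

/-- Morphisms modulo negligible morphisms. -/
abbrev H (X Y : NegligibleQuotient k T) : Type v := (X.as ⟶ Y.as) ⧸ negligible k X.as Y.as

/-- Composition modulo negligible morphisms. -/
def comp (X Y Z : NegligibleQuotient k T) : H X Y →ₗ[k] H Y Z →ₗ[k] H X Z :=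
  Submodule.liftQ _
    { toFun := fun f => Submodule.mapQ _ _ (Linear.leftComp k Z.as f)
        (fun _ hg => comp_negligible f hg)
      map_add' := fun f g => by
        ext x
        exact congrArg Submodule.Quotient.mk (Preadditive.add_comp _ _ _ f g x)
      map_smul' := fun c f => by
        ext x
        exact congrArg Submodule.Quotient.mk (Linear.smul_comp _ _ _ c f x) }
    (fun f hf => by
      rw [LinearMap.mem_ker]
      ext g
      exact (Submodule.Quotient.mk_eq_zero _).2 (negligible_comp hf g))

instance : Category (NegligibleQuotient k T) where
  Hom := H
  id X := Submodule.Quotient.mk (𝟙 X.as)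
  comp f g := comp _ _ _ f g
  id_comp := by
    rintro X Y ⟨f⟩
    exact congrArg Submodule.Quotient.mk (Category.id_comp f)
  comp_id := by
    rintro X Y ⟨f⟩
    exact congrArg Submodule.Quotient.mk (Category.comp_id f)
  assoc := by
    rintro W X Y Z ⟨f⟩ ⟨g⟩ ⟨h⟩
    exact congrArg Submodule.Quotient.mk (Category.assoc f g h)

instance : Preadditive (NegligibleQuotient k T) where
  homGroup X Y := inferInstanceAs (AddCommGroup (H X Y))
  add_comp X Y Z f g h := LinearMap.map_add₂ (comp X Y Z) f g h
  comp_add X Y Z f g h := LinearMap.map_add (comp X Y Z f) g h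

instance : Linear k (NegligibleQuotient k T) where
  homModule X Y := inferInstanceAs (Module k (H X Y))
  smul_comp X Y Z c f g := LinearMap.map_smul₂ (comp X Y Z) c f g
  comp_smul X Y Z f c g := LinearMap.map_smul (comp X Y Z f) c g

/-- The class of a morphism. -/
def proj {X Y : T} (f : X ⟶ Y) : (⟨X⟩ : NegligibleQuotient k T) ⟶ ⟨Y⟩ :=
  Submodule.Quotient.mk (p := negligible k X Y) f

theorem proj_surjective {X Y : NegligibleQuotient k T} (f : X ⟶ Y) :
    ∃ g : X.as ⟶ Y.as, proj g = f := Submodule.Quotient.mk_surjective _ f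

theorem proj_id (X : T) : proj (k := k) (𝟙 X) = 𝟙 _ := rfl

theorem proj_comp {X Y Z : T} (f : X ⟶ Y) (g : Y ⟶ Z) :
    proj (k := k) (f ≫ g) = proj f ≫ proj g := rfl

/-- The class of an isomorphism. -/
def projIso {X Y : T} (e : X ≅ Y) : (⟨X⟩ : NegligibleQuotient k T) ≅ ⟨Y⟩ where
  hom := proj e.hom
  inv := proj e.inv
  hom_inv_id := by rw [← proj_comp, e.hom_inv_id, proj_id]
  inv_hom_id := by rw [← proj_comp, e.inv_hom_id, proj_id]

/-- Left whiskering as a linear map. -/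
def whiskerLeftHom (Z X Y : T) : (X ⟶ Y) →ₗ[k] (Z ⊗ X ⟶ Z ⊗ Y) where
  toFun f := Z ◁ f
  map_add' _ _ := MonoidalPreadditive.whiskerLeft_add _ _
  map_smul' _ _ := MonoidalLinear.whiskerLeft_smul _ _ _

/-- Right whiskering as a linear map. -/
def whiskerRightHom (X Y Z : T) : (X ⟶ Y) →ₗ[k] (X ⊗ Z ⟶ Y ⊗ Z) where
  toFun f := f ▷ Z
  map_add' _ _ := MonoidalPreadditive.add_whiskerRight _ _
  map_smul' _ _ := MonoidalLinear.smul_whiskerRight _ _ _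

/-- Left whiskering modulo negligible morphisms. -/
def wL (X : NegligibleQuotient k T) {Y Z : NegligibleQuotient k T} (f : Y ⟶ Z) :
    (⟨X.as ⊗ Y.as⟩ : NegligibleQuotient k T) ⟶ ⟨X.as ⊗ Z.as⟩ :=
  Submodule.mapQ _ (negligible k (X.as ⊗ Y.as) (X.as ⊗ Z.as)) (whiskerLeftHom X.as Y.as Z.as)
    (fun _ hf => whiskerLeft_negligible X.as hf) f

/-- Right whiskering modulo negligible morphisms. -/
def wR {Y Z : NegligibleQuotient k T} (f : Y ⟶ Z) (X : NegligibleQuotient k T) :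
    (⟨Y.as ⊗ X.as⟩ : NegligibleQuotient k T) ⟶ ⟨Z.as ⊗ X.as⟩ :=
  Submodule.mapQ _ (negligible k (Y.as ⊗ X.as) (Z.as ⊗ X.as)) (whiskerRightHom Y.as Z.as X.as)
    (fun _ hf => negligible_whiskerRight hf X.as) f

instance : MonoidalCategoryStruct (NegligibleQuotient k T) where
  tensorObj X Y := ⟨X.as ⊗ Y.as⟩
  tensorUnit := ⟨𝟙_ T⟩
  whiskerLeft X _ _ f := wL X f
  whiskerRight f X := wR f X
  tensorHom {_ Y X' _} f g := wR f X' ≫ wL Y g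
  associator X Y Z := projIso (α_ X.as Y.as Z.as)
  leftUnitor X := projIso (λ_ X.as)
  rightUnitor X := projIso (ρ_ X.as)

theorem whiskerLeft_proj (Z : T) {X Y : T} (f : X ⟶ Y) :
    (⟨Z⟩ : NegligibleQuotient k T) ◁ proj f = proj (Z ◁ f) := rfl

theorem proj_whiskerRight {X Y : T} (f : X ⟶ Y) (Z : T) :
    proj f ▷ (⟨Z⟩ : NegligibleQuotient k T) = proj (f ▷ Z) := rfl

theorem proj_tensorHom {X Y X' Y' : T} (f : X ⟶ Y) (g : X' ⟶ Y') :
    (proj f ⊗ₘ proj g : (⟨X⟩ : NegligibleQuotient k T) ⊗ ⟨X'⟩ ⟶ ⟨Y⟩ ⊗ ⟨Y'⟩) = proj (f ⊗ₘ g) := by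
  rw [MonoidalCategory.tensorHom_def]
  rfl

instance : MonoidalCategory (NegligibleQuotient k T) where
  tensorHom_def _ _ := rfl
  id_tensorHom_id X Y := (proj_tensorHom _ _).trans
    (congrArg proj (MonoidalCategory.id_tensorHom_id X.as Y.as))
  tensorHom_comp_tensorHom := by
    rintro X₁ Y₁ Z₁ X₂ Y₂ Z₂ ⟨f₁⟩ ⟨f₂⟩ ⟨g₁⟩ ⟨g₂⟩
    have := congrArg (proj (k := k)) (MonoidalCategory.tensorHom_comp_tensorHom f₁ f₂ g₁ g₂)
    rw [proj_comp, ← proj_tensorHom, ← proj_tensorHom, ← proj_tensorHom] at this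
    exact this
  whiskerLeft_id X Y := congrArg proj (MonoidalCategory.whiskerLeft_id X.as Y.as)
  id_whiskerRight X Y := congrArg proj (MonoidalCategory.id_whiskerRight X.as Y.as)
  associator_naturality := by
    rintro X₁ X₂ X₃ Y₁ Y₂ Y₃ ⟨f₁⟩ ⟨f₂⟩ ⟨f₃⟩
    have := congrArg (proj (k := k)) (MonoidalCategory.associator_naturality f₁ f₂ f₃)
    rw [proj_comp, proj_comp, ← proj_tensorHom, ← proj_tensorHom, ← proj_tensorHom,
      ← proj_tensorHom] at this
    exact this
  leftUnitor_naturality := by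
    rintro X Y ⟨f⟩
    exact congrArg proj (MonoidalCategory.leftUnitor_naturality f)
  rightUnitor_naturality := by
    rintro X Y ⟨f⟩
    exact congrArg proj (MonoidalCategory.rightUnitor_naturality f)
  pentagon W X Y Z := congrArg proj (MonoidalCategory.pentagon W.as X.as Y.as Z.as)
  triangle X Y := congrArg proj (MonoidalCategory.triangle X.as Y.as)

instance : MonoidalPreadditive (NegligibleQuotient k T) where
  whiskerLeft_zero := LinearMap.map_zero (Submodule.mapQ _ _ _ _)
  zero_whiskerRight := LinearMap.map_zero (Submodule.mapQ _ _ _ _)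
  whiskerLeft_add f g := LinearMap.map_add (Submodule.mapQ _ _ _ _) f g
  add_whiskerRight f g := LinearMap.map_add (Submodule.mapQ _ _ _ _) f g

instance : MonoidalLinear k (NegligibleQuotient k T) where
  whiskerLeft_smul _ _ _ r f := LinearMap.map_smul (Submodule.mapQ _ _ _ _) r f
  smul_whiskerRight r _ _ f _ := LinearMap.map_smul (Submodule.mapQ _ _ _ _) r f

end NegligibleQuotient
end Negligible

section TensorCategories

universe v u v' u'

/-- `Z` is a direct sum of the finite family `X`. -/
def IsDirectSum {C : Type u} [Category.{v} C] [Preadditive C] {n : ℕ} (X : Fin n → C) (Z : C) :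
    Prop :=
  ∃ (i : ∀ a, X a ⟶ Z) (p : ∀ a, Z ⟶ X a),
    (∀ a, i a ≫ p a = 𝟙 (X a)) ∧ (∀ a b, a ≠ b → i a ≫ p b = 0) ∧ ∑ a, p a ≫ i a = 𝟙 Z

/-- The smallest full tensor subcategory that contains the objects in `S` and is closed under
direct sums and direct summands (in particular under isomorphisms). -/
inductive tensorClosure {C : Type u} [Category.{v} C] [Preadditive C] [MonoidalCategory C]
    (S : ObjectProperty C) : ObjectProperty C
  | of (X : C) : S X → tensorClosure S X
  | unit : tensorClosure S (𝟙_ C)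
  | tensor (X Y : C) : tensorClosure S X → tensorClosure S Y → tensorClosure S (X ⊗ Y)
  | summand (X Y Z : C) (i : Z ⟶ X) (p : X ⟶ Z) (j : Z ⟶ Y) (r : Y ⟶ Z) :
      i ≫ p + j ≫ r = 𝟙 Z → tensorClosure S X → tensorClosure S Y → tensorClosure S Z

instance {C : Type u} [Category.{v} C] [Preadditive C] [MonoidalCategory C]
    (S : ObjectProperty C) : (tensorClosure S).IsMonoidal where
  prop_unit := tensorClosure.unit
  prop_tensor := tensorClosure.tensor

/-- `S` is a complete set of simple objects of the (split) semisimple `R`-linear category `C`: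
`Hom(X, X) = R` and `Hom(X, Y) = 0` for distinct `X, Y ∈ S`, and every object is a finite direct
sum of objects of `S`. Over an algebraically closed field this is semisimplicity (with finite
dimensional Hom spaces). -/
structure IsSimpleFamily (R : Type) [CommRing R] {C : Type u} [Category.{v} C] [Preadditive C]
    [Linear R C] (S : Set C) : Prop where
  end_bijective : ∀ X ∈ S, Function.Bijective (fun r : R => r • 𝟙 X)
  hom_eq_zero : ∀ X ∈ S, ∀ Y ∈ S, X ≠ Y → ∀ f : X ⟶ Y, f = 0
  exists_sum : ∀ Y : C, ∃ (n : ℕ) (X : Fin n → C), (∀ a, X a ∈ S) ∧ IsDirectSum X Y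

/-- Semisimple rigid tensor categories over `R` (an algebraically closed field, or a local ring
such as the ring of integers of the algebraic closure of `ℚ_p`). -/
structure IsSemisimpleRigidTensor (R : Type) [CommRing R] (C : Type u) [Category.{v} C]
    [Preadditive C] [Linear R C] [MonoidalCategory C] : Prop where
  preadditive : MonoidalPreadditive C
  linear : MonoidalLinear R C
  biproducts : HasFiniteBiproducts C
  rigid : Nonempty (RigidCategory C)
  unit_simple : Function.Bijective (fun r : R => r • 𝟙 (𝟙_ C))
  semisimple : ∃ S : Set C, IsSimpleFamily R S

/-- Fusion categories: semisimple rigid tensor categories with finitely many simple objects. -/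
structure IsFusion (R : Type) [CommRing R] (C : Type u) [Category.{v} C]
    [Preadditive C] [Linear R C] [MonoidalCategory C] : Prop
    extends IsSemisimpleRigidTensor R C where
  finite : ∃ S : Set C, S.Finite ∧ IsSimpleFamily R S

/-- `F : C ⥤ D` exhibits the `S`-linear category `D` as the extension of scalars `C ⊗_R S` of the
`R`-linear category `C` along `φ : R → S`: it is essentially surjective, and on Hom modules it is
`R`-linear and induces `S ⊗_R Hom(X, Y) ≅ Hom(F X, F Y)`. -/
def IsScalarExtension {R S : Type} [CommRing R] [CommRing S] (φ : R →+* S)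
    {C : Type u} [Category.{v} C] [Preadditive C] [Linear R C]
    {D : Type u'} [Category.{v'} D] [Preadditive D] [Linear S D] (F : C ⥤ D) : Prop :=
  F.EssSurj ∧ ∀ X Y : C,
    letI : Algebra R S := φ.toAlgebra
    letI : Module R (F.obj X ⟶ F.obj Y) := Module.compHom _ φ
    haveI : IsScalarTower R S (F.obj X ⟶ F.obj Y) :=
      ⟨fun r s f => mul_smul (φ r) s f⟩
    ∃ f : (X ⟶ Y) →ₗ[R] (F.obj X ⟶ F.obj Y), (∀ g, f g = F.map g) ∧ IsBaseChange S f

/-- The ring of integers of the algebraic closure of `ℚ_p`. -/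
abbrev ZpBar (p : ℕ) [Fact p.Prime] : ValuationSubring (PadicAlgCl p) :=
  (Valued.v : Valuation (PadicAlgCl p) NNReal).valuationSubring

/-- The field of algebraic numbers inside `ℂ`. -/
abbrev Qbar : Type := algebraicClosure ℚ ℂ

/-- `C` has a good reduction modulo `p`, along the embedding `φ` of the algebraic numbers in the
algebraic closure `K` of `ℚ_p`: there are a semisimple rigid tensor category `Cp` over the residue
field of the ring `O` of integers of `K`, a semisimple rigid tensor category `Ct` over `O` whose
reduction modulo the maximal ideal is `Cp`, and a tensor category `E` over `K` which is an
extension of scalars both of `Ct` and of `C`. -/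
def HasGoodReduction (p : ℕ) [Fact p.Prime] (φ : Qbar →+* PadicAlgCl p)
    (C : Type u') [Category.{v'} C] [Preadditive C] [Linear Qbar C] [MonoidalCategory C] : Prop :=
  ∃ (Cp : Type u) (_ : Category.{v} Cp) (_ : Preadditive Cp)
    (_ : Linear (IsLocalRing.ResidueField (ZpBar p)) Cp) (_ : MonoidalCategory Cp)
    (Ct : Type u) (_ : Category.{v} Ct) (_ : Preadditive Ct)
    (_ : Linear (ZpBar p) Ct) (_ : MonoidalCategory Ct)
    (E : Type u) (_ : Category.{v} E) (_ : Preadditive E)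
    (_ : Linear (PadicAlgCl p) E) (_ : MonoidalCategory E),
    IsSemisimpleRigidTensor (IsLocalRing.ResidueField (ZpBar p)) Cp ∧
    IsSemisimpleRigidTensor (ZpBar p) Ct ∧
    IsSemisimpleRigidTensor (PadicAlgCl p) E ∧
    (∃ F : Ct ⥤ Cp, Nonempty F.Monoidal ∧
      IsScalarExtension (IsLocalRing.residue (ZpBar p)) F) ∧
    (∃ G : Ct ⥤ E, Nonempty G.Monoidal ∧ IsScalarExtension (ZpBar p).subtype G) ∧
    (∃ H : C ⥤ E, Nonempty H.Monoidal ∧ IsScalarExtension φ H)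

/-- `p` is a good prime for `C` if `C` has a good reduction modulo `p` for some embedding of the
algebraic numbers in the algebraic closure of `ℚ_p`. -/
def IsGoodPrime (p : ℕ) [Fact p.Prime]
    (C : Type u') [Category.{v'} C] [Preadditive C] [Linear Qbar C] [MonoidalCategory C] : Prop :=
  ∃ φ : Qbar →+* PadicAlgCl p, HasGoodReduction.{v, u} p φ C

/-- A prime is bad if it is not good. -/
def IsBadPrime (p : ℕ) [Fact p.Prime]
    (C : Type u') [Category.{v'} C] [Preadditive C] [Linear Qbar C] [MonoidalCategory C] : Prop :=
  ¬ IsGoodPrime.{v, u} p C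

/-- `n` is Müger's squared norm of (the simple object) `V`: for an object `W` which is both a left
and a right dual of `V`, it is the product of the two circles
`𝟙 ⟶ V ⊗ W ⟶ 𝟙` and `𝟙 ⟶ W ⊗ V ⟶ 𝟙`. -/
def IsSquaredNorm {C : Type u} [Category.{v} C] [Preadditive C] [Linear Qbar C]
    [MonoidalCategory C] (V : C) (n : Qbar) : Prop :=
  ∃ (W : C) (e : ExactPairing V W) (e' : ExactPairing W V),
    (e.coevaluation' ≫ e'.evaluation') ≫ (e'.coevaluation' ≫ e.evaluation') = n • 𝟙 (𝟙_ C)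

/-- The algebraic number `x` is an algebraic integer, and its norm (up to sign the constant term of
its minimal polynomial over `ℤ`) is relatively prime to `p`. -/
def IsRelPrimeTo (p : ℕ) (x : Qbar) : Prop :=
  IsIntegral ℤ x ∧ IsCoprime (p : ℤ) ((minpoly ℤ x).coeff 0)

section Amplitudes

variable {C : Type u} [Category.{v} C] [MonoidalCategory C] {X : C} [ExactPairing X X]

/-- For a self-dual object `X` (with an identification of `X` and its dual) and `m : X ⊗ X ⟶ X`,
the dual `m_* : X ⟶ X ⊗ X` of `m`. -/
def dualVertex (m : X ⊗ X ⟶ X) : X ⟶ X ⊗ X :=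
  (ρ_ X).inv ≫ X ◁ η_ (X ⊗ X) (X ⊗ X) ≫ X ◁ (m ▷ (X ⊗ X)) ≫ (α_ X X (X ⊗ X)).inv ≫
    ε_ X X ▷ (X ⊗ X) ≫ (λ_ (X ⊗ X)).hom

/-- The trace of an endomorphism of a self-dual object. -/
def selfTrace (f : X ⟶ X) : 𝟙_ C ⟶ 𝟙_ C := η_ X X ≫ f ▷ X ≫ ε_ X X

/-- The amplitude `Tr(m m_*)` of the trivalent graph with two vertices and three edges. -/
def ampT2 (m : X ⊗ X ⟶ X) : 𝟙_ C ⟶ 𝟙_ C := selfTrace (dualVertex m ≫ m)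

/-- The amplitude `Tr(m (1 ⊗ m) (m_* ⊗ 1) m_*)` of the complete graph on four vertices. -/
def ampT4 (m : X ⊗ X ⟶ X) : 𝟙_ C ⟶ 𝟙_ C :=
  selfTrace (dualVertex m ≫ dualVertex m ▷ X ≫ (α_ X X X).hom ≫ X ◁ m ≫ m)

end Amplitudes

end TensorCategories

section Verlinde

variable {k : Type} [Field k]

/-- Tilting modules of the quantum group `SL_q(2)`: the direct summands of direct sums of tensor
powers of the fundamental representation. -/
abbrev Tilting (q : kˣ) : Type 1 :=
  (tensorClosure fun X : Corep q => X = Corep.fund q).FullSubcategory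

/-- The Verlinde category `C(sl₂, q)`: tilting modules modulo negligible morphisms. -/
abbrev VerlindeCat (q : kˣ) : Type 1 := NegligibleQuotient k (Tilting q)

/-- The fundamental representation as an object of the Verlinde category. -/
def VerlindeCat.fund (q : kˣ) : VerlindeCat q :=
  ⟨⟨Corep.fund q, tensorClosure.of _ rfl⟩⟩

/-- The quantum dimension of an object of the Verlinde category. -/
def VerlindeCat.qdim {q : kˣ} (X : VerlindeCat q) : k := Corep.qdim X.as.obj

/-- The even objects of the Verlinde category: the tensor subcategory generated by the tensor square
of the fundamental representation. -/
abbrev VerlindeCat.IsEven (q : kˣ) : ObjectProperty (VerlindeCat q) :=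
  tensorClosure fun X : VerlindeCat q => X = VerlindeCat.fund q ⊗ VerlindeCat.fund q

/-- The even part of the Verlinde category. -/
abbrev EvenVerlinde (q : kˣ) : Type 1 := (VerlindeCat.IsEven q).FullSubcategory

end Verlinde

theorem exp_isAlgebraic : Complex.exp (Real.pi * Complex.I / 8) ∈ algebraicClosure ℚ ℂ := by
  rw [mem_algebraicClosure_iff]
  refine IsIntegral.isAlgebraic (IsIntegral.of_pow (n := 16) (by norm_num) ?_)
  rw [← Complex.exp_nat_mul]
  have : ((16 : ℕ) : ℂ) * (Real.pi * Complex.I / 8) = 2 * Real.pi * Complex.I := by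
    push_cast; ring
  rw [this, Complex.exp_two_pi_mul_I]
  exact isIntegral_one

/-- `q = e^{π i / 8}`. -/
def q8 : Qbarˣ := Units.mk0 ⟨Complex.exp (Real.pi * Complex.I / 8), exp_isAlgebraic⟩
  (fun h => Complex.exp_ne_zero _ (congrArg Subtype.val h))

/-- The quantum integer `[n]_q` for `q = e^{π i / 8}`. -/
def qInt (n : ℕ) : Qbar :=
  ((q8 : Qbar) ^ n - ((q8⁻¹ : Qbarˣ) : Qbar) ^ n) / ((q8 : Qbar) - ((q8⁻¹ : Qbarˣ) : Qbar))

/-- `V 0, …, V 6` are the standard objects `V_0 = 𝟙, V_1, …, V_6` of the Verlinde category, where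
`V_1` is the fundamental representation and `V_{i+1} ⊗ V_1 = V_i ⊕ V_{i+2}` (which determines them
up to isomorphism). -/
structure IsStandard (V : ℕ → VerlindeCat q8) : Prop where
  zero : Nonempty (V 0 ≅ 𝟙_ (VerlindeCat q8))
  one : Nonempty (V 1 ≅ VerlindeCat.fund q8)
  step : ∀ i < 5, IsDirectSum ![V i, V (i + 2)] (V (i + 1) ⊗ V 1)

end Verlinde

end

open Verlinde

universe v u

/-!
Let `q` be a primitive root of unity of order `16` and `s² = q`.

*The Verlinde category.* The Weyl modules `V_n` are constructed inductively as the images of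
explicit idempotents `weylIncl * weylProj` on `V_{n-1} ⊗ V_1`. By the Jones–Wenzl recursion
`weylIncl_mul_weylProj`, such an idempotent is an endomorphism as long as `[1], …, [n]` are not
zero, which holds for `n ≤ 7`, and then `V_{n+1} ⊗ V_1 ≅ V_n ⊕ V_{n+2}` for `n + 2 ≤ 7`. A
homomorphism commutes with the actions of `K` and `F`, which are functionals on `O_q(SL₂)`; as the
weights are distinct, this gives Schur's lemma for the `V_n` (`weylHom_entries`). The quantum
dimension of `V_7` is `[8] = 0`. Since tilting modules are braided, by the universal `r`-form that
extends the skein relation of the Kauffman bracket (`tiltingBraided`), every closed diagram through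
`V_7` is a multiple of its loop, and `V_7` is negligible (`vObj_seven`). Hence tensor products of
`V_0, …, V_6` decompose into these objects, and the quotient category is semisimple
(`isSimpleFamily_simpleObj`). Keeping track of parity gives the objects of the even part
(`isEven_iff`).

*Norms.* Loops of a simple object are unique up to inverse scalars (`loop_comp_loop_unique`), and
the two loops of `V_n` are traces of `K` and `K⁻¹`, both equal to `[n + 1]`. For even `n` this is
`1` or a root of `X² - 2 X - 1`, hence a unit.

*Amplitudes.* The commutation with `K` and `F` also shows that `V_2` occurs exactly once in
`V_2 ⊗ V_2`, with explicit matrices for the trivalent vertices. If `m' ≫ m = 𝟙` for the embedding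
`m'` and the projection `m`, the composite of two copies of `m'` and two copies of `m` is a scalar
`t`, which does not depend on any choice: `t = (1 - q² + q⁴) / (1 + q⁴) = ([3] - 2) / ([3] - 1)`
(`isTrivalent_weylTwo`). The dual of `m` is a multiple of `m'`, and this reduces the amplitudes to
`t` and the loop `[3]` (`amplitudes`).

*The bad prime.* Suppose that the even part has a form over the ring `O` of integers of the
algebraic closure of `ℚ_2`. The simple object of the form which corresponds to `V_2` again occurs
in its tensor square as a direct summand, by an embedding and a projection which are defined over
`O`, so that `t` belongs to `O` (`IsScalarExtension.exists_of_isTrivalent`). But `t (2 + w) = 1`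
for `w = q² + q⁻²`, and `w² = 2`, so that `2 + w` is not a unit at `2` (`invariant_not_mem`). So `2`
is bad, although it is relatively prime to all squared norms.
-/

noncomputable section

namespace Verlinde

/-! ### The quantum coordinate algebra: functionals and antipode -/

section Oq

variable {k : Type} [Field k] {q : kˣ}

theorem Oq.algHom_ext {A : Type*} [Semiring A] [Algebra k A] {f g : Oq q →ₐ[k] A}
    (h : ∀ i j, f (gen q i j) = g (gen q i j)) : f = g :=
  RingQuot.ringQuot_ext' k f g (FreeAlgebra.hom_ext (funext fun x => h x.1 x.2))

/-- A subalgebra that contains the generators is everything: the universal property of `O_q(SL₂)`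
gives a section of its inclusion. -/
theorem Oq.mem_of_gen (S : Subalgebra k (Oq q)) (h : ∀ i j, gen q i j ∈ S) (x : Oq q) : x ∈ S := by
  let t : Fin 2 → Fin 2 → S := fun i j => ⟨gen q i j, h i j⟩
  let f : Oq q →ₐ[k] S := lift t (Subtype.ext (gen_ab q)) (Subtype.ext (gen_ac q))
    (Subtype.ext (gen_bd q)) (Subtype.ext (gen_cd q)) (Subtype.ext (gen_bc q))
    (Subtype.ext (gen_ad q)) (Subtype.ext (gen_da q))
  have hf : S.val.comp f = AlgHom.id k _ := Oq.algHom_ext fun i j => by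
    change (f (gen q i j) : Oq q) = gen q i j
    rw [lift_gen]
  have hx : (f x : Oq q) = x := DFunLike.congr_fun hf x
  exact hx ▸ (f x).2

theorem comul_gen (i j : Fin 2) : comul q (gen q i j) = ∑ l, gen q i l ⊗ₜ[k] gen q l j :=
  lift_gen _ _ _ _ _ _ _ _ i j

theorem counit_gen (i j : Fin 2) : counit q (gen q i j) = if i = j then 1 else 0 :=
  lift_gen _ _ _ _ _ _ _ _ i j

theorem torus_gen (i j : Fin 2) : torus q (gen q i j) =
    if i = j then (if i = 0 then (q : k) else ((q⁻¹ : kˣ) : k)) else 0 :=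
  lift_gen _ _ _ _ _ _ _ _ i j

/-- The representation of `O_q(SL₂)` by lower triangular matrices whose diagonal entries are the
counit and the torus element `K`. -/
def lowerRep (q : kˣ) : Oq q →ₐ[k] Matrix (Fin 2) (Fin 2) k :=
  lift ![![!![1, 0; 0, (q : k)], 0], ![!![0, 0; 1, 0], !![1, 0; 0, ((q⁻¹ : kˣ) : k)]]]
    (by simp) (by ext i j; fin_cases i <;> fin_cases j <;> simp) (by simp)
    (by ext i j; fin_cases i <;> fin_cases j <;> simp) (by simp)
    (by simp [Matrix.one_fin_two]) (by simp [Matrix.one_fin_two])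

theorem lowerRep_diag (x : Oq q) :
    lowerRep q x 0 1 = 0 ∧ lowerRep q x 0 0 = counit q x ∧ lowerRep q x 1 1 = torus q x := by
  let S : Subalgebra k (Oq q) :=
    { carrier := {x | lowerRep q x 0 1 = 0 ∧ lowerRep q x 0 0 = counit q x ∧
        lowerRep q x 1 1 = torus q x}
      mul_mem' := by
        rintro x y ⟨h1, h2, h3⟩ ⟨h4, h5, h6⟩
        refine ⟨?_, ?_, ?_⟩ <;> simp [Matrix.mul_apply, *]
      add_mem' := by
        rintro x y ⟨h1, h2, h3⟩ ⟨h4, h5, h6⟩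
        refine ⟨?_, ?_, ?_⟩ <;> simp [*]
      algebraMap_mem' := fun r => by
        refine ⟨?_, ?_, ?_⟩ <;> simp [AlgHom.commutes, Matrix.algebraMap_matrix_apply] }
  refine Oq.mem_of_gen S (fun i j => ?_) x
  change _ ∧ _ ∧ _
  rw [counit_gen, torus_gen, lowerRep, lift_gen]
  fin_cases i <;> fin_cases j <;> simp

/-- The element `F` of the quantum group, as a functional on `O_q(SL₂)`. -/
def lowering (q : kˣ) : Oq q →ₗ[k] k where
  toFun x := lowerRep q x 1 0
  map_add' x y := by simp
  map_smul' c x := by simp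

theorem lowering_gen (i j : Fin 2) :
    lowering q (gen q i j) = if i = 1 ∧ j = 0 then 1 else 0 := by
  change lowerRep q _ 1 0 = _
  rw [lowerRep, lift_gen]
  fin_cases i <;> fin_cases j <;> simp

theorem lowering_mul (x y : Oq q) :
    lowering q (x * y) = lowering q x * counit q y + torus q x * lowering q y := by
  change lowerRep q _ 1 0 = _
  rw [map_mul, Matrix.mul_apply, Fin.sum_univ_two, (lowerRep_diag y).2.1, (lowerRep_diag x).2.2]
  rfl

theorem lowering_one : lowering q 1 = 0 := by
  change lowerRep q _ 1 0 = _
  simp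

/-- The antipode of `O_q(SL₂)`, as a homomorphism to the opposite algebra. -/
def antipodeOp (q : kˣ) : Oq q →ₐ[k] (Oq q)ᵐᵒᵖ :=
  lift (fun i j => MulOpposite.op
      (![![gen q 1 1, -((q⁻¹ : kˣ) : k) • gen q 0 1], ![-(q : k) • gen q 1 0, gen q 0 0]] i j))
    (by simp [← MulOpposite.op_mul, ← MulOpposite.op_smul, gen_bd, smul_smul])
    (by simp [← MulOpposite.op_mul, ← MulOpposite.op_smul, gen_cd, smul_smul])
    (by simp [← MulOpposite.op_mul, ← MulOpposite.op_smul, gen_ab, smul_smul])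
    (by simp [← MulOpposite.op_mul, ← MulOpposite.op_smul, gen_ac, smul_smul])
    (by simp [← MulOpposite.op_mul, gen_bc, smul_smul])
    (by simp [← MulOpposite.op_mul, ← MulOpposite.op_smul, gen_bc, gen_ad, smul_smul,
      ← MulOpposite.op_add, ← MulOpposite.op_one])
    (by simp [← MulOpposite.op_mul, ← MulOpposite.op_smul, gen_bc, gen_da, smul_smul,
      ← MulOpposite.op_add, ← MulOpposite.op_one])

/-- The antipode of `O_q(SL₂)`. -/
def antipode (q : kˣ) : Oq q →ₗ[k] Oq q :=
  (MulOpposite.opLinearEquiv k).symm.toLinearMap ∘ₗ (antipodeOp q).toLinearMap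

theorem antipode_gen (i j : Fin 2) : antipode q (gen q i j) =
    ![![gen q 1 1, -((q⁻¹ : kˣ) : k) • gen q 0 1], ![-(q : k) • gen q 1 0, gen q 0 0]] i j :=
  congrArg MulOpposite.unop (lift_gen _ _ _ _ _ _ _ _ i j)

theorem antipode_mul (x y : Oq q) : antipode q (x * y) = antipode q y * antipode q x :=
  congrArg MulOpposite.unop (map_mul (antipodeOp q) x y)

theorem antipode_one : antipode q 1 = 1 :=
  congrArg MulOpposite.unop (map_one (antipodeOp q))

theorem antipode_algebraMap (c : k) : antipode q (algebraMap k _ c) = algebraMap k _ c := by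
  rw [Algebra.algebraMap_eq_smul_one, map_smul, antipode_one]

/-- The linear map `x ⊗ y ↦ x S(y)`. -/
def mulAntipode (q : kˣ) : Oq q ⊗[k] Oq q →ₗ[k] Oq q :=
  LinearMap.mul' k (Oq q) ∘ₗ LinearMap.lTensor (Oq q) (antipode q)

/-- The linear map `x ⊗ y ↦ S(x) y`. -/
def antipodeMul (q : kˣ) : Oq q ⊗[k] Oq q →ₗ[k] Oq q :=
  LinearMap.mul' k (Oq q) ∘ₗ LinearMap.rTensor (Oq q) (antipode q)

theorem mulAntipode_tmul (x y : Oq q) : mulAntipode q (x ⊗ₜ y) = x * antipode q y := rfl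
theorem antipodeMul_tmul (x y : Oq q) : antipodeMul q (x ⊗ₜ y) = antipode q x * y := rfl

/-- The antipode axiom `∑ x₁ S(x₂) = ε(x)`. It is stable under products and sums, so that it
suffices to check it on generators. -/
theorem mulAntipode_comul (x : Oq q) :
    mulAntipode q (comul q x) = algebraMap k _ (counit q x) := by
  have key : ∀ y, mulAntipode q (comul q y) = algebraMap k _ (counit q y) → ∀ u,
      mulAntipode q (u * comul q y) = counit q y • mulAntipode q u := by
    intro y hy u
    induction u with
    | zero => simp
    | add u v hu hv => rw [add_mul, map_add, hu, hv, map_add, smul_add]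
    | tmul a b =>
      have h : ∀ v, mulAntipode q (a ⊗ₜ b * v) = a * mulAntipode q v * antipode q b := by
        intro v
        induction v with
        | zero => simp
        | add u v hu hv => rw [mul_add, map_add, hu, hv, map_add, mul_add, add_mul]
        | tmul c d =>
          rw [Algebra.TensorProduct.tmul_mul_tmul, mulAntipode_tmul, mulAntipode_tmul,
            antipode_mul]
          noncomm_ring
      rw [h, hy, mulAntipode_tmul, ← Algebra.commutes, mul_assoc, Algebra.smul_def]
  let S : Subalgebra k (Oq q) :=
    { carrier := {x | mulAntipode q (comul q x) = algebraMap k _ (counit q x)}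
      mul_mem' := by
        intro x y hx hy
        change _ = _ at hx
        change _ = _
        rw [map_mul, key y hy, hx, map_mul, mul_comm, map_mul, Algebra.smul_def]
      add_mem' := by
        intro x y hx hy
        change _ = _ at hx hy
        change _ = _
        rw [map_add, map_add, hx, hy, map_add, map_add]
      algebraMap_mem' := fun r => by
        change _ = _
        rw [AlgHom.commutes, AlgHom.commutes, Algebra.TensorProduct.algebraMap_apply,
          mulAntipode_tmul, antipode_one, mul_one]
        rfl }
  refine Oq.mem_of_gen S (fun i j => ?_) x
  change _ = _
  rw [comul_gen, counit_gen]
  fin_cases i <;> fin_cases j <;>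
    simp [mulAntipode_tmul, antipode_gen, gen_ab, gen_ad, gen_cd, gen_da, smul_smul, gen_bc]

/-- The antipode axiom `∑ S(x₁) x₂ = ε(x)`. -/
theorem antipodeMul_comul (x : Oq q) :
    antipodeMul q (comul q x) = algebraMap k _ (counit q x) := by
  have key : ∀ y, antipodeMul q (comul q y) = algebraMap k _ (counit q y) → ∀ u,
      antipodeMul q (comul q y * u) = counit q y • antipodeMul q u := by
    intro y hy u
    induction u with
    | zero => simp
    | add u v hu hv => rw [mul_add, map_add, hu, hv, map_add, smul_add]
    | tmul a b =>
      have h : ∀ v, antipodeMul q (v * a ⊗ₜ b) = antipode q a * antipodeMul q v * b := by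
        intro v
        induction v with
        | zero => simp
        | add u v hu hv => rw [add_mul, map_add, hu, hv, map_add, mul_add, add_mul]
        | tmul c d =>
          rw [Algebra.TensorProduct.tmul_mul_tmul, antipodeMul_tmul, antipodeMul_tmul,
            antipode_mul]
          noncomm_ring
      rw [h, hy, antipodeMul_tmul, ← Algebra.commutes, mul_assoc, Algebra.smul_def]
  let S : Subalgebra k (Oq q) :=
    { carrier := {x | antipodeMul q (comul q x) = algebraMap k _ (counit q x)}
      mul_mem' := by
        intro x y hx hy
        change _ = _ at hy
        change _ = _
        rw [map_mul, key x hx, hy, map_mul, map_mul, Algebra.smul_def]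
      add_mem' := by
        intro x y hx hy
        change _ = _ at hx hy
        change _ = _
        rw [map_add, map_add, hx, hy, map_add, map_add]
      algebraMap_mem' := fun r => by
        change _ = _
        rw [AlgHom.commutes, AlgHom.commutes, Algebra.TensorProduct.algebraMap_apply,
          antipodeMul_tmul, antipode_algebraMap, mul_one]
        rfl }
  refine Oq.mem_of_gen S (fun i j => ?_) x
  change _ = _
  rw [comul_gen, counit_gen]
  fin_cases i <;> fin_cases j <;>
    simp [antipodeMul_tmul, antipode_gen, gen_ac, gen_ad, gen_bd, gen_da, smul_smul, gen_bc]

/-- The convolution `x ↦ ∑ f(x₁) g(x₂)` of two algebra homomorphisms with commuting images. -/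
def convHom {A : Type*} [Ring A] [Algebra k A] (f g : Oq q →ₐ[k] A)
    (h : ∀ x y, Commute (f x) (g y)) : Oq q →ₐ[k] A :=
  (Algebra.TensorProduct.lift f g h).comp (comul q)

theorem convHom_gen {A : Type*} [Ring A] [Algebra k A] (f g : Oq q →ₐ[k] A)
    (h : ∀ x y, Commute (f x) (g y)) (i j : Fin 2) :
    convHom f g h (gen q i j) = ∑ l, f (gen q i l) * g (gen q l j) := by
  simp [convHom, comul_gen]

theorem convHom_coef {A : Type*} [Ring A] [Algebra k A] (f g : Oq q →ₐ[k] A)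
    (h : ∀ x y, Commute (f x) (g y)) (X : Corep q) (i j : X.ι) :
    convHom f g h (X.M i j) = ∑ l, f (X.M i l) * g (X.M l j) := by
  simp [convHom, X.comul_M]

/-- The character `K⁻¹`. -/
def torusInv (q : kˣ) : Oq q →ₐ[k] k :=
  lift (fun i j => if i = j then (if i = 0 then ((q⁻¹ : kˣ) : k) else (q : k)) else 0)
    (by simp) (by simp) (by simp) (by simp) (by simp) (by simp) (by simp)

theorem torusInv_gen (i j : Fin 2) : torusInv q (gen q i j) =
    if i = j then (if i = 0 then ((q⁻¹ : kˣ) : k) else (q : k)) else 0 :=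
  lift_gen _ _ _ _ _ _ _ _ i j

/-- The square of the antipode is conjugation by `K`. -/
theorem antipode_antipode_coef (X : Corep q) (i j : X.ι) :
    antipode q (antipode q (X.M i j)) =
      ∑ l, torusInv q (X.M i l) • ∑ m, torus q (X.M m j) • X.M l m := by
  -- Both sides are algebra homomorphisms: the right hand side is a convolution with characters.
  let S2 : Oq q →ₐ[k] Oq q :=
    { toFun := fun x => antipode q (antipode q x)
      map_one' := by rw [antipode_one, antipode_one]
      map_mul' := fun x y => by rw [antipode_mul, antipode_mul]
      map_zero' := by rw [map_zero, map_zero]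
      map_add' := fun x y => by rw [map_add, map_add]
      commutes' := fun c => by rw [antipode_algebraMap, antipode_algebraMap] }
  let R : Oq q →ₐ[k] Oq q := convHom (AlgHom.id k _) ((Algebra.ofId k _).comp (torus q))
    (fun x y => (Algebra.commutes (torus q y) x).symm)
  let L : Oq q →ₐ[k] Oq q := convHom ((Algebra.ofId k _).comp (torusInv q)) (AlgHom.id k _)
    (fun x y => Algebra.commutes (torusInv q x) y)
  have hc : ∀ (c : k) (x : Oq q), x * algebraMap k (Oq q) c = c • x := fun c x => by
    rw [← Algebra.commutes, Algebra.smul_def]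
  have h : S2 = L.comp R := Oq.algHom_ext fun i j => by
    change antipode q (antipode q (gen q i j)) = L (R (gen q i j))
    have hR : ∀ i j, R (gen q i j) = ∑ m, torus q (gen q m j) • gen q i m := fun i j => by
      refine (convHom_gen _ _ _ i j).trans (Finset.sum_congr rfl fun m _ => ?_)
      exact (hc (torus q (gen q m j)) (gen q i m))
    have hL : ∀ i j, L (gen q i j) = ∑ m, torusInv q (gen q i m) • gen q m j := fun i j => by
      refine (convHom_gen _ _ _ i j).trans (Finset.sum_congr rfl fun m _ => ?_)
      exact (Algebra.smul_def (torusInv q (gen q i m)) (gen q m j)).symm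
    rw [hR]
    simp only [map_sum, map_smul, hL]
    fin_cases i <;> fin_cases j <;> simp [antipode_gen, torus_gen, torusInv_gen, smul_smul]
  refine (DFunLike.congr_fun h (X.M i j)).trans ?_
  have hR : ∀ i j, R (X.M i j) = ∑ m, torus q (X.M m j) • X.M i m := fun i j => by
    refine (convHom_coef _ _ _ X i j).trans (Finset.sum_congr rfl fun m _ => ?_)
    exact (hc (torus q (X.M m j)) (X.M i m))
  have hL : ∀ i j, L (X.M i j) = ∑ m, torusInv q (X.M i m) • X.M m j := fun i j => by
    refine (convHom_coef _ _ _ X i j).trans (Finset.sum_congr rfl fun m _ => ?_)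
    exact (Algebra.smul_def (torusInv q (X.M i m)) (X.M m j)).symm
  change L (R _) = _
  rw [hR]
  simp only [map_sum, map_smul, hL, Finset.smul_sum, smul_smul]
  rw [Finset.sum_comm]
  simp only [mul_comm]

/-- The comultiplication of `S(x)` is `∑ S(x₂) ⊗ S(x₁)`. -/
theorem comul_antipode (x : Oq q) : comul q (antipode q x) =
    TensorProduct.comm k _ _ (TensorProduct.map (antipode q) (antipode q) (comul q x)) := by
  set σ : Oq q ⊗[k] Oq q →ₗ[k] Oq q ⊗[k] Oq q :=
    (TensorProduct.comm k _ _).toLinearMap ∘ₗ TensorProduct.map (antipode q) (antipode q) with hσ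
  have hmul : ∀ u v, σ (u * v) = σ v * σ u := by
    intro u v
    induction u with
    | zero => simp
    | add u u' hu hv => rw [add_mul, map_add, hu, hv, map_add, mul_add]
    | tmul a b =>
      induction v with
      | zero => simp
      | add u u' hu hv => rw [mul_add, map_add, hu, hv, map_add, add_mul]
      | tmul c d => simp [hσ, antipode_mul]
  let S : Subalgebra k (Oq q) :=
    { carrier := {x | comul q (antipode q x) = σ (comul q x)}
      mul_mem' := by
        intro x y hx hy
        change _ = _ at hx hy
        change _ = _
        rw [antipode_mul, map_mul, map_mul, hmul, hx, hy]
      add_mem' := by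
        intro x y hx hy
        change _ = _ at hx hy
        change _ = _
        rw [map_add, map_add, hx, hy, map_add, map_add]
      algebraMap_mem' := fun r => by
        change _ = _
        rw [antipode_algebraMap, AlgHom.commutes, Algebra.TensorProduct.algebraMap_apply]
        simp [hσ, antipode_one, Algebra.algebraMap_eq_smul_one, ← TensorProduct.smul_tmul'] }
  refine Oq.mem_of_gen S (fun i j => ?_) x
  change _ = _
  rw [comul_gen]
  fin_cases i <;> fin_cases j <;>
    simp [hσ, antipode_gen, comul_gen, TensorProduct.tmul_smul, ← TensorProduct.smul_tmul',
      smul_smul, add_comm, TensorProduct.tmul_neg, TensorProduct.neg_tmul]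

theorem counit_antipode (x : Oq q) : counit q (antipode q x) = counit q x := by
  let S : Subalgebra k (Oq q) :=
    { carrier := {x | counit q (antipode q x) = counit q x}
      mul_mem' := by
        intro x y hx hy
        change _ = _ at hx hy
        change _ = _
        rw [antipode_mul, map_mul, map_mul, hx, hy, mul_comm]
      add_mem' := by
        intro x y hx hy
        change _ = _ at hx hy
        change _ = _
        rw [map_add, map_add, hx, hy, map_add]
      algebraMap_mem' := fun r => by
        change _ = _
        rw [antipode_algebraMap] }
  refine Oq.mem_of_gen S (fun i j => ?_) x
  change _ = _
  fin_cases i <;> fin_cases j <;> simp [antipode_gen, counit_gen]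

end Oq

/-! ### Dual representations and the action of `K` and `F` -/

namespace Corep

open scoped Kronecker

variable {k : Type} [Field k] {q : kˣ}

/-- The matrix of the action of `K`. -/
def Kmat (X : Corep q) : Matrix X.ι X.ι k := X.M.map (torus q)

/-- The matrix of the action of `K⁻¹`. -/
def Kinv (X : Corep q) : Matrix X.ι X.ι k := X.M.map (torusInv q)

/-- The matrix of the action of `F`. -/
def Fmat (X : Corep q) : Matrix X.ι X.ι k := X.M.map (lowering q)

theorem Kmat_mul_Kinv (X : Corep q) : X.Kmat * X.Kinv = 1 := by
  have h : convHom (torus q) (torusInv q) (fun _ _ => Commute.all _ _) = counit q :=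
    Oq.algHom_ext fun i j => by
      rw [convHom_gen, counit_gen]
      fin_cases i <;> fin_cases j <;> simp [torus_gen, torusInv_gen]
  ext i j
  rw [Matrix.one_apply, ← X.counit_M, ← h, convHom_coef]
  rfl

theorem Kinv_mul_Kmat (X : Corep q) : X.Kinv * X.Kmat = 1 :=
  mul_eq_one_comm.1 X.Kmat_mul_Kinv

theorem map_mul_sc {m n : Type} [Fintype n] {l : Type} (f : Oq q →ₗ[k] k) (A : Matrix m n (Oq q))
    (T : Matrix n l k) : (A * sc q T).map f = A.map f * T := by
  ext i j
  simp only [Matrix.map_apply, Matrix.mul_apply, map_sum, sc]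
  refine Finset.sum_congr rfl fun x _ => ?_
  rw [← Algebra.commutes, ← Algebra.smul_def, map_smul, smul_eq_mul, mul_comm]

theorem map_sc_mul {m n : Type} [Fintype n] {l : Type} (f : Oq q →ₗ[k] k) (A : Matrix n l (Oq q))
    (T : Matrix m n k) : (sc q T * A).map f = T * A.map f := by
  ext i j
  simp only [Matrix.map_apply, Matrix.mul_apply, map_sum, sc]
  refine Finset.sum_congr rfl fun x _ => ?_
  rw [← Algebra.smul_def, map_smul, smul_eq_mul]

/-- Homomorphisms commute with the action of all functionals on `O_q(SL₂)`. -/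
theorem map_mul_mat (f : Oq q →ₗ[k] k) {X Y : Corep q} (T : X ⟶ Y) :
    Y.M.map f * mat T = mat T * X.M.map f := by
  rw [← map_mul_sc, mat_comm, map_sc_mul]

theorem Kmat_mul_mat {X Y : Corep q} (T : X ⟶ Y) : Y.Kmat * mat T = mat T * X.Kmat :=
  map_mul_mat (torus q).toLinearMap T

theorem Kinv_mul_mat {X Y : Corep q} (T : X ⟶ Y) : Y.Kinv * mat T = mat T * X.Kinv :=
  map_mul_mat (torusInv q).toLinearMap T

theorem Fmat_mul_mat {X Y : Corep q} (T : X ⟶ Y) : Y.Fmat * mat T = mat T * X.Fmat :=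
  map_mul_mat (lowering q) T

theorem tensorUnit_M : (𝟙_ (Corep q)).M = 1 := rfl

theorem Kmat_tensor (X Y : Corep q) : (X ⊗ Y).Kmat = X.Kmat ⊗ₖ Y.Kmat :=
  Matrix.ext fun i j => map_mul (torus q) (X.M i.1 j.1) (Y.M i.2 j.2)

theorem Kinv_tensor (X Y : Corep q) : (X ⊗ Y).Kinv = X.Kinv ⊗ₖ Y.Kinv :=
  Matrix.ext fun i j => map_mul (torusInv q) (X.M i.1 j.1) (Y.M i.2 j.2)

theorem Fmat_tensor (X Y : Corep q) :
    (X ⊗ Y).Fmat = X.Fmat ⊗ₖ (1 : Matrix Y.ι Y.ι k) + X.Kmat ⊗ₖ Y.Fmat :=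
  Matrix.ext fun i j => by
    refine (lowering_mul (X.M i.1 j.1) (Y.M i.2 j.2)).trans ?_
    rw [Y.counit_M]
    rfl

theorem Kmat_unit : (𝟙_ (Corep q)).Kmat = 1 := Matrix.ext fun _ _ => map_one (torus q)

theorem Fmat_unit : (𝟙_ (Corep q)).Fmat = 0 := Matrix.ext fun _ _ => lowering_one

theorem sum_mul_antipode (X : Corep q) (i j : X.ι) :
    ∑ l, X.M i l * antipode q (X.M l j) = if i = j then 1 else 0 := by
  have := mulAntipode_comul (X.M i j)
  rw [X.comul_M, map_sum, X.counit_M] at this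
  simp only [mulAntipode_tmul] at this
  rw [this]
  split_ifs <;> simp

theorem sum_antipode_mul (X : Corep q) (i j : X.ι) :
    ∑ l, antipode q (X.M i l) * X.M l j = if i = j then 1 else 0 := by
  have := antipodeMul_comul (X.M i j)
  rw [X.comul_M, map_sum, X.counit_M] at this
  simp only [antipodeMul_tmul] at this
  rw [this]
  split_ifs <;> simp

/-- The dual representation, in the dual basis. -/
def dual (X : Corep q) : Corep q where
  ι := X.ι
  M := Matrix.of fun i j => antipode q (X.M j i)
  comul_M i j := by
    simp [comul_antipode, X.comul_M]
  counit_M i j := by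
    simp [counit_antipode, X.counit_M, eq_comm]

/-- An invariant vector is a homomorphism from the unit. -/
theorem unitHom_comm {X : Corep q} (v : X.ι → k)
    (h : ∀ i, ∑ j, X.M i j * algebraMap k _ (v j) = algebraMap k _ (v i)) :
    X.M * sc q (Matrix.of fun i (_ : (𝟙_ (Corep q)).ι) => v i) =
      sc q (Matrix.of fun i (_ : (𝟙_ (Corep q)).ι) => v i) * (𝟙_ (Corep q)).M := by
  rw [tensorUnit_M]
  refine Eq.trans ?_ (Matrix.mul_one _).symm
  ext i u
  simpa [Matrix.mul_apply, sc] using h i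

theorem homUnit_comm {X : Corep q} (v : X.ι → k)
    (h : ∀ j, ∑ i, algebraMap k _ (v i) * X.M i j = algebraMap k _ (v j)) :
    (𝟙_ (Corep q)).M * sc q (Matrix.of fun (_ : (𝟙_ (Corep q)).ι) i => v i) =
      sc q (Matrix.of fun (_ : (𝟙_ (Corep q)).ι) i => v i) * X.M := by
  rw [tensorUnit_M]
  refine (Matrix.one_mul _).trans ?_
  ext i u
  simpa [Matrix.mul_apply, sc] using (h u).symm

/-- The morphism from the unit given by an invariant vector. -/
def ofVec {X : Corep q} (v : X.ι → k)
    (h : ∀ i, ∑ j, X.M i j * algebraMap k _ (v j) = algebraMap k _ (v i)) : 𝟙_ (Corep q) ⟶ X :=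
  ofMat _ (unitHom_comm v h)

/-- The morphism to the unit given by an invariant linear form. -/
def ofCovec {X : Corep q} (v : X.ι → k)
    (h : ∀ j, ∑ i, algebraMap k _ (v i) * X.M i j = algebraMap k _ (v j)) : X ⟶ 𝟙_ (Corep q) :=
  ofMat _ (homUnit_comm v h)

end Corep

namespace Corep

open scoped Kronecker

variable {k : Type} [Field k] {q : kˣ}

section Matrices

variable {m n : Type} [Fintype m] [Fintype n] [DecidableEq n]

/-- A zigzag identity in coordinates: it says that the matrices of `a` and `b` are inverse to each
other. -/
theorem zigzag_left [DecidableEq m] {a : Matrix (m × n) Unit k} {b : Matrix Unit (n × m) k}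
    (h : (Matrix.of fun y x => b () (y, x)) * (Matrix.of fun x y => a (x, y) ()) = 1) :
    (b ⊗ₖ (1 : Matrix n n k)) * (perm k (Equiv.prodAssoc n m n).symm * ((1 : Matrix n n k) ⊗ₖ a)) =
      perm k (Equiv.punitProd n).symm * perm k (Equiv.prodPUnit n) := by
  rw [← Matrix.mul_assoc, mul_perm, perm_mul_perm]
  ext ⟨u, y'⟩ ⟨y, u'⟩
  have := congrFun (congrFun h y) y'
  simpa [Matrix.mul_apply, Fintype.sum_prod_type, Matrix.one_apply, perm, eq_comm] using this

/-- The other zigzag identity in coordinates. -/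
theorem zigzag_right [DecidableEq m] {a : Matrix (m × n) Unit k} {b : Matrix Unit (n × m) k}
    (h : (Matrix.of fun x y => a (x, y) ()) * (Matrix.of fun y x => b () (y, x)) = 1) :
    ((1 : Matrix m m k) ⊗ₖ b) * (perm k (Equiv.prodAssoc m n m) * (a ⊗ₖ (1 : Matrix m m k))) =
      perm k (Equiv.prodPUnit m).symm * perm k (Equiv.punitProd m) := by
  rw [← Matrix.mul_assoc, mul_perm, perm_mul_perm]
  ext ⟨x', u⟩ ⟨u', x⟩
  have := congrFun (congrFun h x') x
  simpa [Matrix.mul_apply, Fintype.sum_prod_type, Matrix.one_apply, perm, eq_comm, mul_comm]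
    using this

/-- A closed loop that carries an endomorphism of the left tensor factor, as a trace. -/
theorem loop_right (a : Matrix (m × n) Unit k) (b : Matrix Unit (m × n) k) (f : Matrix m m k) :
    (b * (f ⊗ₖ (1 : Matrix n n k)) * a) () () =
      (f * (Matrix.of fun x y => a (x, y) ()) * (Matrix.of fun y x => b () (x, y))).trace := by
  rw [Matrix.mul_assoc, Matrix.trace, Matrix.mul_apply, Fintype.sum_prod_type]
  refine Finset.sum_congr rfl fun x _ => ?_
  rw [Matrix.diag_apply, Matrix.mul_apply]
  refine Finset.sum_congr rfl fun y _ => ?_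
  simp [Matrix.mul_apply, Fintype.sum_prod_type, Matrix.one_apply, mul_comm]

/-- A closed loop that carries an endomorphism of the right tensor factor, as a trace. -/
theorem loop_left (a : Matrix (n × m) Unit k) (b : Matrix Unit (n × m) k) (f : Matrix m m k) :
    (b * ((1 : Matrix n n k) ⊗ₖ f) * a) () () =
      (f * (Matrix.of fun x y => a (y, x) ()) * (Matrix.of fun y x => b () (y, x))).trace := by
  rw [Matrix.mul_assoc, Matrix.trace, Matrix.mul_apply, Fintype.sum_prod_type_right]
  refine Finset.sum_congr rfl fun x _ => ?_
  rw [Matrix.diag_apply, Matrix.mul_apply]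
  refine Finset.sum_congr rfl fun y _ => ?_
  simp [Matrix.mul_apply, Fintype.sum_prod_type, Matrix.one_apply, mul_comm]

end Matrices

/-- An invariant vector in `X ⊗ Y` and an invariant form on `Y ⊗ X` whose matrices are inverse to
each other exhibit `Y` as a right dual of `X`. -/
@[reducible]
def pairingOf {X Y : Corep q} (a : 𝟙_ (Corep q) ⟶ X ⊗ Y) (b : Y ⊗ X ⟶ 𝟙_ (Corep q))
    (h : (Matrix.of fun x y => mat a (x, y) ()) * (Matrix.of fun y x => mat b () (y, x)) =
      (1 : Matrix X.ι X.ι k))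
    (h' : (Matrix.of fun y x => mat b () (y, x)) * (Matrix.of fun x y => mat a (x, y) ()) =
      (1 : Matrix Y.ι Y.ι k)) :
    ExactPairing X Y where
  coevaluation' := a
  evaluation' := b
  coevaluation_evaluation' := hom_ext ((Matrix.mul_assoc _ _ _).trans (zigzag_left h'))
  evaluation_coevaluation' := hom_ext ((Matrix.mul_assoc _ _ _).trans (zigzag_right h))

/-- The value of a closed diagram. -/
def val (f : 𝟙_ (Corep q) ⟶ 𝟙_ (Corep q)) : k := mat f () ()

theorem unit_hom_eq (f : 𝟙_ (Corep q) ⟶ 𝟙_ (Corep q)) : f = val f • 𝟙 _ :=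
  hom_ext (by
    ext u v
    change mat f () () = mat f () () * (1 : Matrix Unit Unit k) () ()
    simp)

/-- The coevaluation `𝟙 ⟶ X ⊗ X*`. -/
def dualCoev (X : Corep q) : 𝟙_ (Corep q) ⟶ X ⊗ X.dual :=
  ofVec (fun x : X.ι × X.ι => if x.1 = x.2 then 1 else 0) (fun i => by
    have := X.sum_mul_antipode i.1 i.2
    change ∑ j : X.ι × X.ι, X.M i.1 j.1 * antipode q (X.M j.2 i.2) * _ = _
    simp only [Fintype.sum_prod_type]
    simpa [apply_ite] using this)

/-- The evaluation `X* ⊗ X ⟶ 𝟙`. -/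
def dualEv (X : Corep q) : X.dual ⊗ X ⟶ 𝟙_ (Corep q) :=
  ofCovec (fun x : X.ι × X.ι => if x.1 = x.2 then 1 else 0) (fun i => by
    have := X.sum_antipode_mul i.1 i.2
    change ∑ j : X.ι × X.ι, _ * (antipode q (X.M i.1 j.1) * X.M j.2 i.2) = _
    simp only [Fintype.sum_prod_type]
    simpa [apply_ite] using this)

/-- The double dual of a representation is its conjugate by `K`. -/
theorem map_antipode_antipode (X : Corep q) :
    X.M.map (fun x => antipode q (antipode q x)) = sc q X.Kinv * X.M * sc q X.Kmat := by
  ext i j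
  rw [Matrix.map_apply, antipode_antipode_coef, Matrix.mul_assoc]
  simp only [Matrix.mul_apply, sc, Matrix.map_apply]
  refine Finset.sum_congr rfl fun l _ => ?_
  rw [Algebra.smul_def]
  refine congrArg _ (Finset.sum_congr rfl fun m _ => ?_)
  rw [Algebra.smul_def, Algebra.commutes]
  rfl

/-- `K S²(M) = M K`: the pivotal element is a homomorphism from the double dual. -/
theorem sum_Kmat_smul (X : Corep q) (i j : X.ι) :
    ∑ l, X.Kmat i l • antipode q (antipode q (X.M l j)) = ∑ l, X.Kmat l j • X.M i l := by
  have h : sc q X.Kmat * X.M.map (fun x => antipode q (antipode q x)) = X.M * sc q X.Kmat := by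
    rw [map_antipode_antipode, ← Matrix.mul_assoc, ← Matrix.mul_assoc, ← sc_mul, Kmat_mul_Kinv,
      sc_one, Matrix.one_mul]
  have := congrFun (congrFun h i) j
  simpa only [Matrix.mul_apply, sc, Matrix.map_apply, ← Algebra.commutes, ← Algebra.smul_def]
    using this

/-- `K⁻¹ M = S²(M) K⁻¹`: the inverse of the pivotal element is a homomorphism to the double dual. -/
theorem sum_Kinv_smul (X : Corep q) (i j : X.ι) :
    ∑ l, X.Kinv i l • X.M l j = ∑ l, X.Kinv l j • antipode q (antipode q (X.M i l)) := by
  have h : sc q X.Kinv * X.M = X.M.map (fun x => antipode q (antipode q x)) * sc q X.Kinv := by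
    rw [map_antipode_antipode, Matrix.mul_assoc, ← sc_mul, Kmat_mul_Kinv,
      sc_one, Matrix.mul_one]
  have := congrFun (congrFun h i) j
  simpa only [Matrix.mul_apply, sc, Matrix.map_apply, ← Algebra.commutes, ← Algebra.smul_def]
    using this

/-- The coevaluation `𝟙 ⟶ X* ⊗ X` which is provided by the pivotal element `K`. -/
def dualCoev' (X : Corep q) : 𝟙_ (Corep q) ⟶ X.dual ⊗ X :=
  ofVec (fun x : X.ι × X.ι => X.Kmat x.2 x.1) (fun i => by
    have h1 := fun j => congrArg (antipode q) (X.sum_antipode_mul j i.1)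
    simp only [map_sum, antipode_mul, apply_ite (antipode q), antipode_one, map_zero] at h1
    change ∑ j : X.ι × X.ι, antipode q (X.M j.1 i.1) * X.M i.2 j.2 * algebraMap k _ (X.Kmat j.2 j.1)
      = _
    calc _ = ∑ l, antipode q (X.M l i.1) * ∑ n, X.Kmat n l • X.M i.2 n := by
          rw [Fintype.sum_prod_type]
          refine Finset.sum_congr rfl fun l _ => ?_
          rw [Finset.mul_sum]
          refine Finset.sum_congr rfl fun n _ => ?_
          rw [mul_assoc, ← Algebra.commutes, ← Algebra.smul_def]
      _ = ∑ j, X.Kmat i.2 j • ∑ l, antipode q (X.M l i.1) * antipode q (antipode q (X.M j l)) := by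
          simp only [← sum_Kmat_smul, Finset.mul_sum, Finset.smul_sum, mul_smul_comm]
          exact Finset.sum_comm
      _ = _ := by
          simp only [h1, smul_ite, smul_zero, ← Algebra.algebraMap_eq_smul_one]
          exact Fintype.sum_ite_eq' (ι := X.ι) i.1 fun x => algebraMap k (Oq q) (X.Kmat i.2 x))

/-- The evaluation `X ⊗ X* ⟶ 𝟙` which is provided by the pivotal element `K`. -/
def dualEv' (X : Corep q) : X ⊗ X.dual ⟶ 𝟙_ (Corep q) :=
  ofCovec (fun x : X.ι × X.ι => X.Kinv x.2 x.1) (fun i => by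
    have h1 := fun j => congrArg (antipode q) (X.sum_mul_antipode i.2 j)
    simp only [map_sum, antipode_mul, apply_ite (antipode q), antipode_one, map_zero] at h1
    change ∑ j : X.ι × X.ι,
      algebraMap k _ (X.Kinv j.2 j.1) * (X.M j.1 i.1 * antipode q (X.M i.2 j.2)) = _
    calc _ = ∑ l, (∑ n, X.Kinv l n • X.M n i.1) * antipode q (X.M i.2 l) := by
          rw [Fintype.sum_prod_type, Finset.sum_comm]
          refine Finset.sum_congr rfl fun l _ => ?_
          rw [Finset.sum_mul]
          refine Finset.sum_congr rfl fun n _ => ?_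
          rw [← mul_assoc, ← Algebra.smul_def]
      _ = ∑ j, X.Kinv j i.1 • ∑ l, antipode q (antipode q (X.M l j)) * antipode q (X.M i.2 l) := by
          simp only [sum_Kinv_smul, Finset.sum_mul, Finset.smul_sum, smul_mul_assoc]
          exact Finset.sum_comm
      _ = _ := by
          simp only [h1, smul_ite, smul_zero, ← Algebra.algebraMap_eq_smul_one]
          exact Fintype.sum_ite_eq (ι := X.ι) i.2 fun x => algebraMap k (Oq q) (X.Kinv x i.1))

/-- The dual is a right dual. -/
@[reducible]
def dualPairing (X : Corep q) : ExactPairing X X.dual :=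
  have h : (Matrix.of fun x y => if x = y then 1 else 0 : Matrix X.ι X.ι k) = 1 := by
    ext x y; exact (Matrix.one_apply).symm
  pairingOf X.dualCoev X.dualEv ((congrArg₂ _ h h).trans (Matrix.one_mul (1 : Matrix X.ι X.ι k)))
    ((congrArg₂ _ h h).trans (Matrix.one_mul (1 : Matrix X.ι X.ι k)))

/-- The dual is also a left dual. -/
@[reducible]
def dualPairing' (X : Corep q) : ExactPairing X.dual X :=
  have h : X.Kmat.transpose * X.Kinv.transpose = 1 := by
    rw [← Matrix.transpose_mul, Kinv_mul_Kmat, Matrix.transpose_one]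
  have h' : X.Kinv.transpose * X.Kmat.transpose = 1 := by
    rw [← Matrix.transpose_mul, Kmat_mul_Kinv, Matrix.transpose_one]
  pairingOf X.dualCoev' X.dualEv' h h'

/-- The closed diagram of an endomorphism is its trace, weighted by `K⁻¹`. -/
theorem dualCoev_comp (X : Corep q) (f : X ⟶ X) :
    X.dualCoev ≫ f ▷ X.dual ≫ X.dualEv' = (mat f * X.Kinv).trace • 𝟙 _ := by
  rw [unit_hom_eq (_ ≫ _)]
  congr 1
  refine (loop_right (m := X.ι) (n := X.ι) (mat X.dualCoev) (mat X.dualEv') (mat f)).trans ?_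
  have h : (Matrix.of fun x y => if x = y then 1 else 0 : Matrix X.ι X.ι k) = 1 := by
    ext x y; exact (Matrix.one_apply).symm
  change (mat f * (Matrix.of fun x y => if x = y then 1 else 0 : Matrix X.ι X.ι k) *
    X.Kinv).trace = _
  rw [h, Matrix.mul_one]

/-- The other closed diagram of an endomorphism is its trace, weighted by `K`. -/
theorem dualCoev'_comp (X : Corep q) (f : X ⟶ X) :
    X.dualCoev' ≫ X.dual ◁ f ≫ X.dualEv = (mat f * X.Kmat).trace • 𝟙 _ := by
  rw [unit_hom_eq (_ ≫ _)]
  congr 1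
  refine (loop_left (m := X.ι) (n := X.ι) (mat X.dualCoev') (mat X.dualEv) (mat f)).trans ?_
  have h : (Matrix.of fun x y => if x = y then 1 else 0 : Matrix X.ι X.ι k) = 1 := by
    ext x y; exact (Matrix.one_apply).symm
  change (mat f * X.Kmat *
    (Matrix.of fun x y => if x = y then 1 else 0 : Matrix X.ι X.ι k)).trace = _
  rw [h, Matrix.mul_one]

/-- The invariant vector `e₀ ⊗ e₁ - q e₁ ⊗ e₀`. -/
def cup (q : kˣ) : 𝟙_ (Corep q) ⟶ fund q ⊗ fund q :=
  ofVec (fun x : Fin 2 × Fin 2 => !![0, 1; -(q : k), 0] x.1 x.2) (fun i => by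
    change ∑ j : Fin 2 × Fin 2, gen q i.1 j.1 * gen q i.2 j.2 * _ = _
    obtain ⟨i, j⟩ := i
    simp only [Fintype.sum_prod_type, Fin.sum_univ_two, ← Algebra.commutes, ← Algebra.smul_def]
    fin_cases i <;> fin_cases j <;>
      simp [gen_ab, gen_cd, gen_ad, gen_da, gen_bc, Algebra.algebraMap_eq_smul_one])

/-- The invariant form with `e₀ ⊗ e₁ ↦ -q⁻¹` and `e₁ ⊗ e₀ ↦ 1`. -/
def cap (q : kˣ) : fund q ⊗ fund q ⟶ 𝟙_ (Corep q) :=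
  ofCovec (fun x : Fin 2 × Fin 2 => !![0, -((q⁻¹ : kˣ) : k); 1, 0] x.1 x.2) (fun i => by
    change ∑ j : Fin 2 × Fin 2, _ * (gen q j.1 i.1 * gen q j.2 i.2) = _
    obtain ⟨i, j⟩ := i
    simp only [Fintype.sum_prod_type, Fin.sum_univ_two, ← Algebra.smul_def]
    fin_cases i <;> fin_cases j <;>
      simp [gen_ac, gen_bd, gen_ad, gen_da, gen_bc, Algebra.algebraMap_eq_smul_one])

/-- The fundamental representation is self-dual. -/
@[reducible]
def fundPairing (q : kˣ) : ExactPairing (fund q) (fund q) :=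
  have h : (!![0, 1; -(q : k), 0] : Matrix (Fin 2) (Fin 2) k) *
      !![0, -((q⁻¹ : kˣ) : k); 1, 0] = 1 := by
    simp [Matrix.one_fin_two]
  have h' : (!![0, -((q⁻¹ : kˣ) : k); 1, 0] : Matrix (Fin 2) (Fin 2) k) *
      !![0, 1; -(q : k), 0] = 1 := by
    simp [Matrix.one_fin_two]
  pairingOf (cup q) (cap q) h h'

end Corep

/-! ### Sums of retracts and semisimplicity -/

section Preadditive

variable {C : Type u} [Category.{v} C] [Preadditive C]

/-- The morphisms `X ⟶ Y` that are sums of morphisms which factor through objects in `T`. -/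
def factorThrough (T : ObjectProperty C) (X Y : C) : AddSubgroup (X ⟶ Y) :=
  AddSubgroup.closure {f | ∃ (W : C) (p : X ⟶ W) (i : W ⟶ Y), T W ∧ p ≫ i = f}

theorem comp_mem_factorThrough {T : ObjectProperty C} {W X Y : C} (h : W ⟶ X) {f : X ⟶ Y}
    (hf : f ∈ factorThrough T X Y) : h ≫ f ∈ factorThrough T W Y := by
  induction hf using AddSubgroup.closure_induction with
  | mem f hf =>
    obtain ⟨U, p, i, hU, rfl⟩ := hf
    exact AddSubgroup.subset_closure ⟨U, h ≫ p, i, hU, Category.assoc _ _ _⟩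
  | zero => rw [comp_zero]; exact zero_mem _
  | add f g _ _ hf hg => rw [Preadditive.comp_add]; exact add_mem hf hg
  | neg f _ hf => rw [Preadditive.comp_neg]; exact neg_mem hf

theorem factorThrough_comp_mem {T : ObjectProperty C} {X Y Z : C} {f : X ⟶ Y}
    (hf : f ∈ factorThrough T X Y) (h : Y ⟶ Z) : f ≫ h ∈ factorThrough T X Z := by
  induction hf using AddSubgroup.closure_induction with
  | mem f hf =>
    obtain ⟨U, p, i, hU, rfl⟩ := hf
    exact AddSubgroup.subset_closure ⟨U, p, i ≫ h, hU, (Category.assoc _ _ _).symm⟩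
  | zero => rw [zero_comp]; exact zero_mem _
  | add f g _ _ hf hg => rw [Preadditive.add_comp]; exact add_mem hf hg
  | neg f _ hf => rw [Preadditive.neg_comp]; exact neg_mem hf

theorem comp_mem_factorThrough_of_mem {T : ObjectProperty C} {X W Y : C} (hW : T W) (p : X ⟶ W)
    (i : W ⟶ Y) : p ≫ i ∈ factorThrough T X Y :=
  AddSubgroup.subset_closure ⟨W, p, i, hW, rfl⟩

theorem id_mem_factorThrough {T : ObjectProperty C} {X : C} (hX : T X) :
    𝟙 X ∈ factorThrough T X X := by
  simpa using comp_mem_factorThrough_of_mem hX (𝟙 X) (𝟙 X)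

theorem id_mem_factorThrough_of_iso {T : ObjectProperty C} {X Y : C} (e : X ≅ Y) (hY : T Y) :
    𝟙 X ∈ factorThrough T X X := by
  simpa using comp_mem_factorThrough_of_mem hY e.hom e.inv

theorem factorThrough_le {T T' : ObjectProperty C}
    (h : ∀ W, T W → 𝟙 W ∈ factorThrough T' W W) (X Y : C) :
    factorThrough T X Y ≤ factorThrough T' X Y := by
  refine (AddSubgroup.closure_le _).2 ?_
  rintro _ ⟨U, p, i, hU, rfl⟩
  simpa using comp_mem_factorThrough p (factorThrough_comp_mem (h U hU) i)

theorem exists_sum_of_mem_factorThrough {T : ObjectProperty C} {X Y : C} {f : X ⟶ Y}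
    (hf : f ∈ factorThrough T X Y) : ∃ (n : ℕ) (W : Fin n → C) (p : ∀ a, X ⟶ W a)
      (i : ∀ a, W a ⟶ Y), (∀ a, T (W a)) ∧ ∑ a, p a ≫ i a = f := by
  induction hf using AddSubgroup.closure_induction with
  | mem f hf =>
    obtain ⟨U, p, i, hU, rfl⟩ := hf
    exact ⟨1, fun _ => U, fun _ => p, fun _ => i, fun _ => hU, by simp⟩
  | zero => exact ⟨0, Fin.elim0, fun a => a.elim0, fun a => a.elim0, fun a => a.elim0, by simp⟩
  | add f g _ _ hf hg =>
    obtain ⟨n, W, p, i, hW, rfl⟩ := hf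
    obtain ⟨n', W', p', i', hW', rfl⟩ := hg
    refine ⟨n + n', Fin.append W W',
      Fin.addCases (fun a => p a ≫ eqToHom (Fin.append_left W W' a).symm)
        (fun a => p' a ≫ eqToHom (Fin.append_right W W' a).symm),
      Fin.addCases (fun a => eqToHom (Fin.append_left W W' a) ≫ i a)
        (fun a => eqToHom (Fin.append_right W W' a) ≫ i' a), fun a => ?_, ?_⟩
    · induction a using Fin.addCases with
      | left a => rw [Fin.append_left]; exact hW a
      | right a => rw [Fin.append_right]; exact hW' a
    · rw [Fin.sum_univ_add]
      simp
  | neg f _ hf =>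
    obtain ⟨n, W, p, i, hW, rfl⟩ := hf
    exact ⟨n, W, fun a => -p a, i, hW, by simp⟩

/-- If `Z` is a retract of a finite sum of objects in `S`, and if non-zero morphisms between objects
in `S` are isomorphisms, then `Z` is a direct sum of objects in `S`: in a presentation
`𝟙 Z = ∑ pₐ iₐ` with the least number of terms, the `iₐ` are linearly independent, so that the
`pₐ` are the dual projections. -/
theorem exists_isDirectSum {S : Set C}
    (hS : ∀ X ∈ S, ∀ Y ∈ S, ∀ f : X ⟶ Y, f ≠ 0 → IsIso f) {Z : C}
    (hZ : 𝟙 Z ∈ factorThrough (· ∈ S) Z Z) :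
    ∃ (n : ℕ) (X : Fin n → C), (∀ a, X a ∈ S) ∧ IsDirectSum X Z := by
  obtain ⟨n, X, p, i, hX, h⟩ := exists_sum_of_mem_factorThrough hZ
  induction n with
  | zero => exact ⟨0, X, hX, i, p, fun a => a.elim0, fun a => a.elim0, h⟩
  | succ n ih =>
    -- `f b a` measures the failure of `i b ≫ p a = δ`, and it satisfies `∑ c, f b c ≫ i c = 0`.
    let f : ∀ b a, X b ⟶ X a := fun b => Pi.single b (𝟙 (X b)) - fun a => i b ≫ p a
    by_cases hf : ∀ b a, f b a = 0
    · refine ⟨n + 1, X, hX, i, p, fun a => ?_, fun a b hab => ?_, h⟩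
      · have := hf a a
        simp only [f, Pi.sub_apply, Pi.single_eq_same] at this
        exact (sub_eq_zero.1 this).symm
      · have := hf a b
        simp only [f, Pi.sub_apply, Pi.single_eq_of_ne' hab, zero_sub, neg_eq_zero] at this
        exact this
    · push Not at hf
      obtain ⟨b, a, hab⟩ := hf
      -- As `f b a` is invertible, this relation eliminates `i a` from the presentation.
      have := hS _ (hX b) _ (hX a) _ hab
      have h0 : ∑ c, f b c ≫ i c = 0 := by
        simp only [f, Pi.sub_apply, Preadditive.sub_comp, Finset.sum_sub_distrib]
        rw [Finset.sum_eq_single b (fun c _ hc => by rw [Pi.single_eq_of_ne hc, zero_comp])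
          (fun hb => absurd (Finset.mem_univ b) hb), Pi.single_eq_same, Category.id_comp]
        have : i b ≫ ∑ c, p c ≫ i c = i b := by rw [h, Category.comp_id]
        simp only [Preadditive.comp_sum] at this
        simp [this]
      rw [Fin.sum_univ_succAbove _ a] at h0 h
      have h1 : i a = -∑ c, inv (f b a) ≫ f b (a.succAbove c) ≫ i (a.succAbove c) := by
        rw [← Preadditive.comp_sum, ← cancel_epi (f b a), Preadditive.comp_neg,
          IsIso.hom_inv_id_assoc]
        exact eq_neg_of_add_eq_zero_left h0
      refine ih (fun c => X (a.succAbove c))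
        (fun c => p (a.succAbove c) - p a ≫ inv (f b a) ≫ f b (a.succAbove c))
        (fun c => i (a.succAbove c)) (fun c => hX _) ?_
      rw [← h, h1]
      simp only [Preadditive.sub_comp, Finset.sum_sub_distrib, Category.assoc,
        Preadditive.comp_neg, Preadditive.comp_sum]
      abel

theorem IsDirectSum.id_mem_factorThrough {T : ObjectProperty C} {n : ℕ} {X : Fin n → C} {Z : C}
    (h : IsDirectSum X Z) (hX : ∀ a, T (X a)) : 𝟙 Z ∈ factorThrough T Z Z := by
  obtain ⟨i, p, -, -, h⟩ := h
  rw [← h]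
  exact sum_mem fun a _ => comp_mem_factorThrough_of_mem (hX a) _ _

theorem isDirectSum_pair {X Y Z : C} (i : X ⟶ Z) (p : Z ⟶ X) (j : Y ⟶ Z) (r : Z ⟶ Y)
    (hip : i ≫ p = 𝟙 X) (hjr : j ≫ r = 𝟙 Y) (hir : i ≫ r = 0) (hjp : j ≫ p = 0)
    (h : p ≫ i + r ≫ j = 𝟙 Z) : IsDirectSum ![X, Y] Z := by
  refine ⟨Fin.cons i (Fin.cons j fun a => a.elim0), Fin.cons p (Fin.cons r fun a => a.elim0),
    ?_, ?_, ?_⟩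
  · rw [Fin.forall_fin_two]; exact ⟨hip, hjr⟩
  · simp only [Fin.forall_fin_two]
    exact ⟨⟨fun h => absurd rfl h, fun _ => hir⟩, ⟨fun _ => hjp, fun h => absurd rfl h⟩⟩
  · rw [Fin.sum_univ_two]; exact h

/-- The existence of a zero object and of binary direct sums. -/
def HasSums (C : Type u) [Category.{v} C] [Preadditive C] : Prop :=
  (∃ Z : C, 𝟙 Z = 0) ∧ ∀ X Y : C, ∃ (Z : C) (i : X ⟶ Z) (p : Z ⟶ X) (j : Y ⟶ Z) (r : Z ⟶ Y),
    i ≫ p = 𝟙 X ∧ j ≫ r = 𝟙 Y ∧ i ≫ r = 0 ∧ j ≫ p = 0 ∧ p ≫ i + r ≫ j = 𝟙 Z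

theorem HasSums.hasFiniteBiproducts (h : HasSums C) : HasFiniteBiproducts C := by
  obtain ⟨⟨Z, hZ⟩, h⟩ := h
  have : HasZeroObject C := ⟨Z, (IsZero.iff_id_eq_zero Z).2 hZ⟩
  have : HasBinaryBiproducts C := ⟨fun X Y => by
    obtain ⟨Z, i, p, j, r, h1, h2, h3, h4, h5⟩ := h X Y
    exact HasBinaryBiproduct.mk ⟨⟨Z, p, r, i, j, h1, h3, h4, h2⟩,
      isBinaryBilimitOfTotal _ h5⟩⟩
  have : HasBinaryProducts C := inferInstance
  have : HasTerminal C := inferInstance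
  have : HasFiniteProducts C := hasFiniteProducts_of_has_binary_and_terminal
  exact HasFiniteBiproducts.of_hasFiniteProducts

end Preadditive

/-! ### Tensor subcategories and duals -/

section Closure

variable {C : Type u} [Category.{v} C] [Preadditive C] [MonoidalCategory C]

theorem tensorClosure.retract {S : ObjectProperty C} {X Z : C} (hX : tensorClosure S X) (i : Z ⟶ X)
    (p : X ⟶ Z) (h : i ≫ p = 𝟙 Z) : tensorClosure S Z :=
  tensorClosure.summand X X Z i p 0 0 (by simp [h]) hX hX

theorem tensorClosure.iso {S : ObjectProperty C} {X Z : C} (hX : tensorClosure S X) (e : Z ≅ X) :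
    tensorClosure S Z :=
  hX.retract e.hom e.inv e.hom_inv_id

theorem tensorClosure.of_id_eq_zero {S : ObjectProperty C} {Z : C} (hZ : 𝟙 Z = 0) :
    tensorClosure S Z :=
  tensorClosure.unit.retract 0 0 (by rw [hZ, comp_zero])

/-- As there are direct sums, a sum of morphisms through objects of the subcategory factors through
a single one. -/
theorem tensorClosure.exists_factor {S : ObjectProperty C} (hC : HasSums C) {X Y : C} {f : X ⟶ Y}
    (hf : f ∈ factorThrough (tensorClosure S) X Y) :
    ∃ (W : C) (p : X ⟶ W) (i : W ⟶ Y), tensorClosure S W ∧ p ≫ i = f := by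
  induction hf using AddSubgroup.closure_induction with
  | mem f hf => exact hf
  | zero => exact ⟨𝟙_ C, 0, 0, .unit, comp_zero⟩
  | add f g _ _ hf hg =>
    obtain ⟨W, p, i, hW, rfl⟩ := hf
    obtain ⟨W', p', i', hW', rfl⟩ := hg
    obtain ⟨Z, a, b, c, d, h1, h2, h3, h4, h5⟩ := hC.2 W W'
    refine ⟨Z, p ≫ a + p' ≫ c, b ≫ i + d ≫ i', .summand _ _ _ b a d c h5 hW hW', ?_⟩
    simp only [Preadditive.add_comp, Preadditive.comp_add, Category.assoc, reassoc_of% h1,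
      reassoc_of% h2, reassoc_of% h3, reassoc_of% h4, zero_comp, comp_zero, add_zero, zero_add]
  | neg f _ hf =>
    obtain ⟨W, p, i, hW, rfl⟩ := hf
    exact ⟨W, -p, i, hW, Preadditive.neg_comp _ _⟩

theorem tensorClosure.hasSums (S : ObjectProperty C) (h : HasSums C) :
    HasSums (tensorClosure S).FullSubcategory := by
  obtain ⟨⟨Z, hZ⟩, h⟩ := h
  refine ⟨⟨⟨Z, .of_id_eq_zero hZ⟩, ObjectProperty.hom_ext _ hZ⟩, fun X Y => ?_⟩
  obtain ⟨Z, i, p, j, r, h1, h2, h3, h4, h5⟩ := h X.obj Y.obj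
  exact ⟨⟨Z, .summand _ _ _ p i r j h5 X.property Y.property⟩, ObjectProperty.homMk i,
    ObjectProperty.homMk p, ObjectProperty.homMk j, ObjectProperty.homMk r,
    ObjectProperty.hom_ext _ h1, ObjectProperty.hom_ext _ h2, ObjectProperty.hom_ext _ h3,
    ObjectProperty.hom_ext _ h4, ObjectProperty.hom_ext _ h5⟩

/-- A retract of a finite sum of objects of the subcategory belongs to it. -/
theorem tensorClosure.of_id_mem {S : ObjectProperty C} (hC : HasSums C) {Z : C}
    (hZ : 𝟙 Z ∈ factorThrough (tensorClosure S) Z Z) : tensorClosure S Z := by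
  obtain ⟨W, p, i, hW, h⟩ := tensorClosure.exists_factor hC hZ
  exact hW.retract p i h

/-- If the tensor products of objects in `T` and `T'` are retracts of sums of objects in `U`, then
the same holds for tensor products of retracts of sums. -/
theorem id_tensor_mem_factorThrough [MonoidalPreadditive C] {T T' U : ObjectProperty C} {X Y : C}
    (hX : 𝟙 X ∈ factorThrough T X X) (hY : 𝟙 Y ∈ factorThrough T' Y Y)
    (h : ∀ W W', T W → T' W' → 𝟙 (W ⊗ W') ∈ factorThrough U (W ⊗ W') (W ⊗ W')) :
    𝟙 (X ⊗ Y) ∈ factorThrough U (X ⊗ Y) (X ⊗ Y) := by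
  have key : ∀ f ∈ factorThrough T X X, ∀ g ∈ factorThrough T' Y Y,
      f ⊗ₘ g ∈ factorThrough U (X ⊗ Y) (X ⊗ Y) := by
    intro f hf g hg
    induction hf using AddSubgroup.closure_induction with
    | mem f hf =>
      obtain ⟨W, p, i, hW, rfl⟩ := hf
      induction hg using AddSubgroup.closure_induction with
      | mem g hg =>
        obtain ⟨W', p', i', hW', rfl⟩ := hg
        have := comp_mem_factorThrough (p ⊗ₘ p') (factorThrough_comp_mem (h W W' hW hW') (i ⊗ₘ i'))
        simpa using this
      | zero => rw [MonoidalPreadditive.tensor_zero]; exact zero_mem _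
      | add f g _ _ hf hg => rw [MonoidalPreadditive.tensor_add]; exact add_mem hf hg
      | neg f _ hf =>
        have h0 := MonoidalPreadditive.tensor_add (p ≫ i) f (-f)
        rw [add_neg_cancel, MonoidalPreadditive.tensor_zero] at h0
        rw [eq_neg_of_add_eq_zero_right h0.symm]
        exact neg_mem hf
    | zero => rw [MonoidalPreadditive.zero_tensor]; exact zero_mem _
    | add f g _ _ hf hg => rw [MonoidalPreadditive.add_tensor]; exact add_mem hf hg
    | neg f _ hf =>
      have h0 := MonoidalPreadditive.add_tensor f (-f) g
      rw [add_neg_cancel, MonoidalPreadditive.zero_tensor] at h0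
      rw [eq_neg_of_add_eq_zero_right h0.symm]
      exact neg_mem hf
  have := key _ hX _ hY
  rwa [MonoidalCategory.id_tensorHom_id] at this

theorem rightAdjointMate_add [MonoidalPreadditive C] {X Y : C} [HasRightDual X] [HasRightDual Y]
    (f g : X ⟶ Y) : rightAdjointMate (f + g) = rightAdjointMate f + rightAdjointMate g := by
  simp only [rightAdjointMate, MonoidalPreadditive.whiskerLeft_add,
    MonoidalPreadditive.add_whiskerRight, Preadditive.add_comp, Preadditive.comp_add]

/-- A tensor subcategory is closed under duals if the duals of its generators belong to it. -/
theorem tensorClosure.rightDual [MonoidalPreadditive C] [RightRigidCategory C]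
    {S : ObjectProperty C} (h : ∀ X, S X → tensorClosure S (Xᘁ)) {X : C} (hX : tensorClosure S X) :
    tensorClosure S (Xᘁ) := by
  induction hX with
  | of X hX => exact h X hX
  | unit =>
    exact tensorClosure.unit.iso (rightDualIso
      (RightRigidCategory.rightDual (𝟙_ C)).exact exactPairingUnit)
  | tensor X Y _ _ hX hY => exact (tensorClosure.tensor _ _ hY hX).iso (rightDualTensorIso X Y)
  | summand X Y Z i p j r hZ _ _ hX hY =>
    refine .summand _ _ _ (pᘁ) (iᘁ) (rᘁ) (jᘁ) ?_ hX hY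
    rw [← comp_rightAdjointMate, ← comp_rightAdjointMate, ← rightAdjointMate_add, hZ,
      rightAdjointMate_id]

end Closure

section Transfer

variable {C : Type u} [Category.{v} C] [MonoidalCategory C]

/-- An exact pairing of objects of a full monoidal subcategory. -/
@[reducible]
def fullSubcategoryPairing (P : ObjectProperty C) [P.IsMonoidal] (X Y : P.FullSubcategory)
    (e : ExactPairing X.obj Y.obj) : ExactPairing X Y where
  coevaluation' := ObjectProperty.homMk (e.coevaluation' : 𝟙_ C ⟶ X.obj ⊗ Y.obj)
  evaluation' := ObjectProperty.homMk (e.evaluation' : Y.obj ⊗ X.obj ⟶ 𝟙_ C)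
  coevaluation_evaluation' := ObjectProperty.hom_ext _ e.coevaluation_evaluation'
  evaluation_coevaluation' := ObjectProperty.hom_ext _ e.evaluation_coevaluation'

variable {k : Type} [Field k] [Preadditive C] [Linear k C] [MonoidalPreadditive C]
  [MonoidalLinear k C]

namespace NegligibleQuotient

/-- The class of an exact pairing. -/
@[reducible]
def projPairing {X Y : C} (e : ExactPairing X Y) :
    ExactPairing (⟨X⟩ : NegligibleQuotient k C) ⟨Y⟩ where
  coevaluation' := proj (e.coevaluation' : 𝟙_ C ⟶ X ⊗ Y)
  evaluation' := proj (e.evaluation' : Y ⊗ X ⟶ 𝟙_ C)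
  coevaluation_evaluation' := congrArg (proj (k := k)) e.coevaluation_evaluation'
  evaluation_coevaluation' := congrArg (proj (k := k)) e.evaluation_coevaluation'

/-- A braiding descends to the quotient by negligible morphisms. -/
instance [BraidedCategory C] : BraidedCategory (NegligibleQuotient k C) where
  braiding X Y := projIso (β_ X.as Y.as)
  braiding_naturality_right X Y Z f := by
    obtain ⟨f, rfl⟩ := proj_surjective f
    exact congrArg proj (BraidedCategory.braiding_naturality_right X.as f)
  braiding_naturality_left f Z := by
    obtain ⟨f, rfl⟩ := proj_surjective f
    exact congrArg proj (BraidedCategory.braiding_naturality_left f Z.as)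
  hexagon_forward X Y Z := congrArg proj (BraidedCategory.hexagon_forward X.as Y.as Z.as)
  hexagon_reverse X Y Z := congrArg proj (BraidedCategory.hexagon_reverse X.as Y.as Z.as)

theorem proj_eq_zero {X Y : C} {f : X ⟶ Y} : proj (k := k) f = 0 ↔ f ∈ negligible k X Y :=
  Submodule.Quotient.mk_eq_zero _

theorem proj_zero (X Y : C) : proj (k := k) (0 : X ⟶ Y) = 0 := rfl

theorem hasSums (h : HasSums C) : HasSums (NegligibleQuotient k C) := by
  obtain ⟨⟨Z, hZ⟩, h⟩ := h
  refine ⟨⟨⟨Z⟩, ?_⟩, fun X Y => ?_⟩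
  · rw [← proj_id, hZ, proj_zero]
  · obtain ⟨Z, i, p, j, r, h1, h2, h3, h4, h5⟩ := h X.as Y.as
    refine ⟨⟨Z⟩, proj i, proj p, proj j, proj r, ?_, ?_, ?_, ?_, ?_⟩
    · exact congrArg proj h1
    · exact congrArg proj h2
    · exact congrArg proj h3
    · exact congrArg proj h4
    · exact congrArg proj h5

end NegligibleQuotient

end Transfer

/-! ### Scalars and pairings of simple objects -/

section Scalars

variable {k : Type} [Field k] {C : Type u} [Category.{v} C] [Preadditive C] [Linear k C]
  [MonoidalCategory C] [MonoidalPreadditive C] [MonoidalLinear k C]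

/-- If all endomorphisms of `Y` are scalars, then all morphisms `𝟙 ⟶ X ⊗ Y` are multiples of the
coevaluation, by Frobenius reciprocity. -/
theorem exists_smul_coevaluation {X Y : C} (hY : ∀ f : Y ⟶ Y, ∃ c : k, f = c • 𝟙 Y)
    (e : ExactPairing X Y) (f : 𝟙_ C ⟶ X ⊗ Y) : ∃ c : k, f = c • e.coevaluation' := by
  let φ := @tensorLeftHomEquiv C _ _ (𝟙_ C) X Y Y e
  obtain ⟨c, hc⟩ := hY ((ρ_ Y).inv ≫ φ.symm f)
  refine ⟨c, ?_⟩
  have h2 : φ.symm f = c • (ρ_ Y).hom := by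
    rw [Iso.inv_comp_eq] at hc
    rw [hc, Linear.comp_smul, Category.comp_id]
  have h3 : φ (c • (ρ_ Y).hom) = c • φ (ρ_ Y).hom := by
    simp [φ, tensorLeftHomEquiv]
  have h4 : φ (ρ_ Y).hom = e.coevaluation' := by
    change (λ_ _).inv ≫ e.coevaluation' ▷ _ ≫ (α_ _ _ _).hom ≫ X ◁ (ρ_ Y).hom = _
    simp [← unitors_equal]
  rw [← φ.apply_symm_apply f, h2, h3, h4]

/-- If all endomorphisms of `Y` are scalars, then all morphisms `Y ⊗ X ⟶ 𝟙` are multiples of the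
evaluation, by Frobenius reciprocity. -/
theorem exists_smul_evaluation {X Y : C} (hY : ∀ f : Y ⟶ Y, ∃ c : k, f = c • 𝟙 Y)
    (e : ExactPairing X Y) (f : Y ⊗ X ⟶ 𝟙_ C) : ∃ c : k, f = c • e.evaluation' := by
  let φ := @tensorRightHomEquiv C _ _ Y X Y (𝟙_ C) e
  obtain ⟨c, hc⟩ := hY (φ f ≫ (λ_ Y).hom)
  refine ⟨c, ?_⟩
  have h2 : φ f = c • (λ_ Y).inv := by
    rw [← Iso.eq_comp_inv] at hc
    rw [hc, Linear.smul_comp, Category.id_comp]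
  have h3 : φ.symm (c • (λ_ Y).inv) = c • φ.symm (λ_ Y).inv := by
    simp [φ, tensorRightHomEquiv]
  have h4 : φ.symm (λ_ Y).inv = e.evaluation' := by
    change (λ_ Y).inv ▷ X ≫ (α_ _ _ _).hom ≫ _ ◁ e.evaluation' ≫ _ = _
    simp [← unitors_equal]
  rw [← φ.symm_apply_apply f, h2, h3, h4]

/-- If all endomorphisms of `Y` are scalars, two exact pairings of `X` and `Y` differ by a
scalar. -/
theorem exists_smul_pairing {X Y : C} (hY : ∀ f : Y ⟶ Y, ∃ c : k, f = c • 𝟙 Y) (hY0 : 𝟙 Y ≠ 0)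
    (e e' : ExactPairing X Y) : ∃ c d : k, c * d = 1 ∧
      e'.coevaluation' = c • e.coevaluation' ∧ e'.evaluation' = d • e.evaluation' := by
  obtain ⟨c, hc⟩ := exists_smul_coevaluation hY e e'.coevaluation'
  obtain ⟨d, hd⟩ := exists_smul_evaluation hY e e'.evaluation'
  refine ⟨c, d, ?_, hc, hd⟩
  have h5 := e'.coevaluation_evaluation'
  rw [hc, hd] at h5
  simp only [MonoidalLinear.whiskerLeft_smul, MonoidalLinear.smul_whiskerRight, Linear.smul_comp,
    Linear.comp_smul, smul_smul] at h5
  rw [e.coevaluation_evaluation'] at h5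
  have h6 : (c * d) • 𝟙 Y = 𝟙 Y := by
    have := congrArg (fun f => (ρ_ Y).inv ≫ f ≫ (λ_ Y).hom) h5
    simpa [mul_comm] using this
  have h7 : (c * d - 1) • 𝟙 Y = 0 := by rw [sub_smul, h6, one_smul, sub_self]
  exact sub_eq_zero.1 ((smul_eq_zero.1 h7).resolve_right hY0)

end Scalars

/-! ### The universal `r`-form -/

section RForm

open WithConv

variable {k : Type} [Field k] {q : kˣ}

/-- The bialgebra structure of `O_q(SL₂)`, which makes its functionals a convolution algebra. -/
instance : Bialgebra k (Oq q) :=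
  Bialgebra.ofAlgHom (comul q) (counit q)
    (Oq.algHom_ext fun i j => by
      simp [comul_gen, TensorProduct.add_tmul, TensorProduct.tmul_add]
      abel)
    (Oq.algHom_ext fun i j => by
      fin_cases i <;> fin_cases j <;> simp [comul_gen, counit_gen])
    (Oq.algHom_ext fun i j => by
      fin_cases i <;> fin_cases j <;> simp [comul_gen, counit_gen])

/-- The character `K^{1/2}` of `O_q(SL₂)` given by a square root `s` of `q`. -/
def sqrtTorus (q s : kˣ) : Oq q →ₐ[k] k :=
  lift (fun i j => if i = j then (if i = 0 then (s : k) else ((s⁻¹ : kˣ) : k)) else 0)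
    (by simp) (by simp) (by simp) (by simp) (by simp) (by simp) (by simp)

theorem sqrtTorus_gen (s : kˣ) (i j : Fin 2) : sqrtTorus q s (gen q i j) =
    if i = j then (if i = 0 then (s : k) else ((s⁻¹ : kˣ) : k)) else 0 :=
  lift_gen _ _ _ _ _ _ _ _ i j

/-- The values `r(t_{yx}, -)` of the `r`-form on the generators, as the entries `(x, y)` of a
representation of `O_q(SL₂)` by upper triangular matrices. -/
def halfRep (q s : kˣ) (hs : (q : k) = s ^ 2) : Oq q →ₐ[k] Matrix (Fin 2) (Fin 2) k :=
  lift ![![!![(s : k), 0; 0, ((s⁻¹ : kˣ) : k)], !![0, (s : k) - ((s⁻¹ : kˣ) : k) ^ 3; 0, 0]],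
      ![0, !![((s⁻¹ : kˣ) : k), 0; 0, (s : k)]]]
    (by
      ext i j; fin_cases i <;> fin_cases j <;> simp [hs]
      field_simp)
    (by simp)
    (by
      ext i j; fin_cases i <;> fin_cases j <;> simp [hs]
      field_simp)
    (by simp) (by simp)
    (by simp [Matrix.one_fin_two]) (by simp [Matrix.one_fin_two])

variable {s : kˣ} (hs : (q : k) = s ^ 2)

theorem halfRep_gen (i j : Fin 2) : halfRep q s hs (gen q i j) =
    ![![!![(s : k), 0; 0, ((s⁻¹ : kˣ) : k)], !![0, (s : k) - ((s⁻¹ : kˣ) : k) ^ 3; 0, 0]],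
      ![0, !![((s⁻¹ : kˣ) : k), 0; 0, (s : k)]]] i j :=
  lift_gen _ _ _ _ _ _ _ _ i j

/-- The representation `halfRep` is upper triangular, with the characters `K^{1/2}` and `K^{-1/2}`
on the diagonal. -/
theorem halfRep_diag (x : Oq q) : halfRep q s hs x 1 0 = 0 ∧
    halfRep q s hs x 0 0 = sqrtTorus q s x ∧ halfRep q s hs x 1 1 = sqrtTorus q s⁻¹ x := by
  let S : Subalgebra k (Oq q) :=
    { carrier := {x | halfRep q s hs x 1 0 = 0 ∧
        halfRep q s hs x 0 0 = sqrtTorus q s x ∧ halfRep q s hs x 1 1 = sqrtTorus q s⁻¹ x}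
      mul_mem' := by
        rintro x y ⟨h1, h2, h3⟩ ⟨h4, h5, h6⟩
        refine ⟨?_, ?_, ?_⟩ <;> simp [Matrix.mul_apply, *]
      add_mem' := by
        rintro x y ⟨h1, h2, h3⟩ ⟨h4, h5, h6⟩
        refine ⟨?_, ?_, ?_⟩ <;> simp [*]
      algebraMap_mem' := fun r => by
        refine ⟨?_, ?_, ?_⟩ <;> simp [AlgHom.commutes, Matrix.algebraMap_matrix_apply] }
  refine Oq.mem_of_gen S (fun i j => ?_) x
  change _ ∧ _ ∧ _
  rw [halfRep_gen, sqrtTorus_gen, sqrtTorus_gen]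
  fin_cases i <;> fin_cases j <;> simp

/-- The functional `r(t_{ij}, -)`. -/
def rGen (i j : Fin 2) : WithConv (Oq q →ₗ[k] k) :=
  toConv { toFun := fun x => halfRep q s hs x j i
           map_add' := fun x y => by simp
           map_smul' := fun c x => by simp }

theorem rGen_apply (i j : Fin 2) (x : Oq q) : (rGen hs i j).ofConv x = halfRep q s hs x j i := rfl

theorem rGen_zero_one : rGen hs 0 1 = 0 :=
  WithConv.ext (LinearMap.ext fun x => (halfRep_diag hs x).1)

theorem conv_apply_coef (f g : WithConv (Oq q →ₗ[k] k)) (X : Corep q) (i j : X.ι) :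
    (f * g).ofConv (X.M i j) = ∑ l, f.ofConv (X.M i l) * g.ofConv (X.M l j) := by
  change LinearMap.mul' k k (TensorProduct.map f.ofConv g.ofConv (comul q (X.M i j))) = _
  simp [X.comul_M]

theorem commute_character (φ : Oq q →ₐ[k] Matrix (Fin 2) (Fin 2) k) (χ : Oq q →ₐ[k] k)
    (x y : Oq q) :
    Commute (((Algebra.ofId k (Matrix (Fin 2) (Fin 2) k)).comp χ) x) (φ y) :=
  show _ = _ from Algebra.commutes (χ x) (φ y)

/-- Convolution with a character, inside the representation `halfRep`. -/
theorem conv_character (χ : kˣ) (i j : Fin 2) (x : Oq q) :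
    (toConv (sqrtTorus q χ).toLinearMap * rGen hs i j).ofConv x =
      convHom ((Algebra.ofId k _).comp (sqrtTorus q χ)) (halfRep q s hs)
        (fun x y => commute_character _ _ x y) x j i := by
  change LinearMap.mul' k k (TensorProduct.map (sqrtTorus q χ).toLinearMap (rGen hs i j).ofConv
    (comul q x)) = (Algebra.TensorProduct.lift ((Algebra.ofId k _).comp (sqrtTorus q χ))
      (halfRep q s hs) (fun x y => commute_character _ _ x y) (comul q x) :
        Matrix (Fin 2) (Fin 2) k) j i
  induction comul q x with
  | zero => simp
  | add u v hu hv => rw [map_add, map_add, map_add, hu, hv]; rfl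
  | tmul u v => simp [Algebra.ofId_apply, rGen_apply, ← Algebra.smul_def]

theorem character_conv (χ : kˣ) (i j : Fin 2) (x : Oq q) :
    (rGen hs i j * toConv (sqrtTorus q χ).toLinearMap).ofConv x =
      convHom (halfRep q s hs) ((Algebra.ofId k _).comp (sqrtTorus q χ))
        (fun x y => (commute_character _ _ y x).symm) x j i := by
  change LinearMap.mul' k k (TensorProduct.map (rGen hs i j).ofConv (sqrtTorus q χ).toLinearMap
    (comul q x)) = (Algebra.TensorProduct.lift (halfRep q s hs)
      ((Algebra.ofId k _).comp (sqrtTorus q χ)) (fun x y => (commute_character _ _ y x).symm)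
        (comul q x) : Matrix (Fin 2) (Fin 2) k) j i
  induction comul q x with
  | zero => simp
  | add u v hu hv => rw [map_add, map_add, map_add, hu, hv]; rfl
  | tmul u v =>
    simp [Algebra.ofId_apply, rGen_apply, ← Algebra.commutes, ← Algebra.smul_def, mul_comm]

theorem rGen_zero_zero : rGen hs 0 0 = toConv (sqrtTorus q s).toLinearMap :=
  WithConv.ext (LinearMap.ext fun x => (halfRep_diag hs x).2.1)

theorem rGen_one_one : rGen hs 1 1 = toConv (sqrtTorus q s⁻¹).toLinearMap :=
  WithConv.ext (LinearMap.ext fun x => (halfRep_diag hs x).2.2)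

/-- For two upper triangular representations with the same diagonal, proportionality of the upper
right entries can be checked on generators. -/
theorem upperTriangular_eq {Φ Ψ : Oq q →ₐ[k] Matrix (Fin 2) (Fin 2) k} (c : k)
    (h : ∀ i j, Φ (gen q i j) 1 0 = 0 ∧ Ψ (gen q i j) 1 0 = 0 ∧
      Φ (gen q i j) 0 0 = Ψ (gen q i j) 0 0 ∧ Φ (gen q i j) 1 1 = Ψ (gen q i j) 1 1 ∧
      Φ (gen q i j) 0 1 = c * Ψ (gen q i j) 0 1) (x : Oq q) : Φ x 0 1 = c * Ψ x 0 1 := by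
  let S : Subalgebra k (Oq q) :=
    { carrier := {x | Φ x 1 0 = 0 ∧ Ψ x 1 0 = 0 ∧ Φ x 0 0 = Ψ x 0 0 ∧ Φ x 1 1 = Ψ x 1 1 ∧
        Φ x 0 1 = c * Ψ x 0 1}
      mul_mem' := by
        rintro x y ⟨h1, h2, h3, h4, h5⟩ ⟨h1', h2', h3', h4', h5'⟩
        refine ⟨?_, ?_, ?_, ?_, ?_⟩ <;>
          simp [Matrix.mul_apply, h1, h2, h3, h4, h5, h1', h2', h3', h4', h5']
        ring
      add_mem' := by
        rintro x y ⟨h1, h2, h3, h4, h5⟩ ⟨h1', h2', h3', h4', h5'⟩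
        refine ⟨?_, ?_, ?_, ?_, ?_⟩ <;>
          simp [h1, h2, h3, h4, h5, h1', h2', h3', h4', h5', mul_add]
      algebraMap_mem' := fun r => by
        refine ⟨?_, ?_, ?_, ?_, ?_⟩ <;> simp [AlgHom.commutes, Matrix.algebraMap_matrix_apply] }
  exact (Oq.mem_of_gen S (fun i j => h i j) x).2.2.2.2

/-- Conjugation by a character rescales the off-diagonal entry of `halfRep`. -/
theorem character_comm (χ : kˣ) (x : Oq q) :
    (toConv (sqrtTorus q χ).toLinearMap * rGen hs 1 0).ofConv x =
      (χ : k) ^ 2 * (rGen hs 1 0 * toConv (sqrtTorus q χ).toLinearMap).ofConv x := by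
  rw [conv_character, character_conv]
  refine upperTriangular_eq _ (fun i j => ?_) x
  rw [convHom_gen, convHom_gen]
  fin_cases i <;> fin_cases j <;>
    simp [halfRep_gen, sqrtTorus_gen, Algebra.ofId_apply, Algebra.algebraMap_eq_smul_one, mul_comm]
  field_simp

theorem character_mul_character :
    (toConv (sqrtTorus q s).toLinearMap * toConv (sqrtTorus q s⁻¹).toLinearMap :
      WithConv (Oq q →ₗ[k] k)) = 1 := by
  have h : convHom (sqrtTorus q s) (sqrtTorus q s⁻¹) (fun _ _ => Commute.all _ _) = counit q :=
    Oq.algHom_ext fun i j => by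
      rw [convHom_gen, counit_gen]
      fin_cases i <;> fin_cases j <;> simp [sqrtTorus_gen]
  refine WithConv.ext (LinearMap.ext fun x => ?_)
  refine Eq.trans ?_ (DFunLike.congr_fun h x)
  change LinearMap.mul' k k (TensorProduct.map (sqrtTorus q s).toLinearMap
    (sqrtTorus q s⁻¹).toLinearMap (comul q x)) =
    Algebra.TensorProduct.lift (sqrtTorus q s) (sqrtTorus q s⁻¹) (fun _ _ => Commute.all _ _)
      (comul q x)
  induction comul q x with
  | zero => simp
  | add u v hu hv => rw [map_add, map_add, map_add, hu, hv]
  | tmul u v => simp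

/-- The universal `r`-form, as a homomorphism from `O_q(SL₂)` to its convolution algebra of
functionals. It is determined by the functionals `r(t_{ij}, -)`. The defining relations of
`O_q(SL₂)` hold for them since `r(t_{00}, -)` and `r(t_{11}, -)` are inverse characters,
`r(t_{01}, -)` vanishes, and `r(t_{10}, -)` commutes with the characters up to a scalar. -/
def rHom : Oq q →ₐ[k] WithConv (Oq q →ₗ[k] k) :=
  lift (rGen hs)
    (by simp [rGen_zero_one])
    (by
      rw [rGen_zero_zero, hs]
      exact WithConv.ext (LinearMap.ext fun x => character_comm hs s x))
    (by simp [rGen_zero_one])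
    (by
      rw [rGen_one_one, hs]
      refine WithConv.ext (LinearMap.ext fun x => ?_)
      have := character_comm hs s⁻¹ x
      change (rGen hs 1 0 * toConv (sqrtTorus q s⁻¹).toLinearMap).ofConv x =
        (s : k) ^ 2 * (toConv (sqrtTorus q s⁻¹).toLinearMap * rGen hs 1 0).ofConv x
      rw [this, ← mul_assoc, ← mul_pow]
      simp)
    (by simp [rGen_zero_one])
    (by
      rw [rGen_zero_one, rGen_zero_zero, rGen_one_one, character_mul_character]
      simp)
    (by
      have := character_mul_character (q := q) (s := s⁻¹)
      rw [inv_inv] at this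
      rw [rGen_zero_one, rGen_zero_zero, rGen_one_one, this]
      simp)

/-- The universal `r`-form. -/
def rForm (x y : Oq q) : k := (rHom hs x).ofConv y

theorem rForm_gen (i j : Fin 2) (y : Oq q) : rForm hs (gen q i j) y = halfRep q s hs y j i := by
  rw [rForm, rHom, lift_gen]; rfl

theorem rForm_one (y : Oq q) : rForm hs 1 y = counit q y := by
  rw [rForm, map_one]; rfl

theorem rForm_mul_coef (x x' : Oq q) (X : Corep q) (i j : X.ι) :
    rForm hs (x * x') (X.M i j) = ∑ l, rForm hs x (X.M i l) * rForm hs x' (X.M l j) := by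
  rw [rForm, map_mul, conv_apply_coef]; rfl

/-- The functional `r(-, y)`. -/
def rLeft (y : Oq q) : Oq q →ₗ[k] k where
  toFun x := rForm hs x y
  map_add' x x' := by simp only [rForm, map_add]; rfl
  map_smul' c x := by simp only [rForm, map_smul]; rfl

/-- The functional `r(x, -)`. -/
def rRight (x : Oq q) : Oq q →ₗ[k] k := (rHom hs x).ofConv

end RForm

/-! ### The braiding of tilting modules -/

namespace Corep

open scoped Kronecker

variable {k : Type} [Field k] {q s : kˣ} (hs : (q : k) = s ^ 2)

section Matrices

variable {l m n : Type} [Fintype l] [Fintype m] [Fintype n] [DecidableEq l] [DecidableEq m]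
  [DecidableEq n]

/-- The first hexagon identity in coordinates. -/
theorem hexagon_forward_matrix (P : Matrix (m × l) (l × m) k) (Q : Matrix (n × l) (l × n) k)
    (R : Matrix ((m × n) × l) (l × (m × n)) k)
    (h : ∀ y' z' x' x y z, R ((y', z'), x') (x, (y, z)) =
      ∑ a, Q (z', x') (a, z) * P (y', a) (x, y)) :
    perm k (Equiv.prodAssoc m n l) * R * perm k (Equiv.prodAssoc l m n) =
      ((1 : Matrix m m k) ⊗ₖ Q) * perm k (Equiv.prodAssoc m l n) *
        (P ⊗ₖ (1 : Matrix n n k)) := by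
  rw [perm_mul, mul_perm, mul_perm]
  ext ⟨y', z', x'⟩ ⟨⟨x, y⟩, z⟩
  refine (h y' z' x' x y z).trans ?_
  simp [Matrix.mul_apply, Fintype.sum_prod_type, Matrix.one_apply]

/-- The second hexagon identity in coordinates. -/
theorem hexagon_reverse_matrix (P : Matrix (n × l) (l × n) k) (Q : Matrix (n × m) (m × n) k)
    (R : Matrix (n × (l × m)) ((l × m) × n) k)
    (h : ∀ x' y' z' x y z, R (z', (x', y')) ((x, y), z) =
      ∑ a, P (z', x') (x, a) * Q (a, y') (y, z)) :
    perm k (Equiv.prodAssoc n l m).symm * R * perm k (Equiv.prodAssoc l m n).symm =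
      (P ⊗ₖ (1 : Matrix m m k)) * perm k (Equiv.prodAssoc l n m).symm *
        ((1 : Matrix l l k) ⊗ₖ Q) := by
  rw [perm_mul, mul_perm, mul_perm]
  ext ⟨⟨z', x'⟩, y'⟩ ⟨x, y, z⟩
  refine (h x' y' z' x y z).trans ?_
  simp [Matrix.mul_apply, Fintype.sum_prod_type, Matrix.one_apply]

/-- The first hexagon identity, solved for the braiding with a tensor product. -/
theorem hexagon_forward_matrix' (P : Matrix (m × l) (l × m) k) (Q : Matrix (n × l) (l × n) k)
    (R : Matrix ((m × n) × l) (l × (m × n)) k)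
    (h : ∀ y' z' x' x y z, R ((y', z'), x') (x, (y, z)) =
      ∑ a, Q (z', x') (a, z) * P (y', a) (x, y)) :
    perm k (Equiv.prodAssoc m n l).symm * (((1 : Matrix m m k) ⊗ₖ Q) *
      perm k (Equiv.prodAssoc m l n) * (P ⊗ₖ (1 : Matrix n n k))) *
        perm k (Equiv.prodAssoc l m n).symm = R := by
  rw [← hexagon_forward_matrix P Q R h, perm_mul, mul_perm, perm_mul, mul_perm]
  rfl

/-- The second hexagon identity, solved for the braiding with a tensor product. -/
theorem hexagon_reverse_matrix' (P : Matrix (n × l) (l × n) k) (Q : Matrix (n × m) (m × n) k)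
    (R : Matrix (n × (l × m)) ((l × m) × n) k)
    (h : ∀ x' y' z' x y z, R (z', (x', y')) ((x, y), z) =
      ∑ a, P (z', x') (x, a) * Q (a, y') (y, z)) :
    perm k (Equiv.prodAssoc n l m) * ((P ⊗ₖ (1 : Matrix m m k)) *
      perm k (Equiv.prodAssoc l n m).symm * ((1 : Matrix l l k) ⊗ₖ Q)) *
        perm k (Equiv.prodAssoc l m n) = R := by
  rw [← hexagon_reverse_matrix P Q R h, perm_mul, mul_perm, perm_mul, mul_perm]
  rfl

end Matrices

/-- The matrix of the braiding: `x ⊗ y ↦ ∑ r(x₁, y₁) y₀ ⊗ x₀`. -/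
def braidMat (X Y : Corep q) : Matrix (Y.ι × X.ι) (X.ι × Y.ι) k :=
  Matrix.of fun i j => rForm hs (X.M i.2 j.1) (Y.M i.1 j.2)

theorem braidMat_natural_left {X X' : Corep q} (f : X ⟶ X') (Y : Corep q) :
    ((1 : Matrix Y.ι Y.ι k) ⊗ₖ mat f) * braidMat hs X Y =
      braidMat hs X' Y * (mat f ⊗ₖ (1 : Matrix Y.ι Y.ι k)) := by
  ext ⟨y', x'⟩ ⟨x, y⟩
  have := congrFun (congrFun (map_mul_mat (rLeft hs (Y.M y' y)) f) x') x
  simpa [Matrix.mul_apply, Fintype.sum_prod_type, Matrix.one_apply, rLeft, braidMat]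
    using this.symm

theorem braidMat_natural_right (X : Corep q) {Y Y' : Corep q} (f : Y ⟶ Y') :
    (mat f ⊗ₖ (1 : Matrix X.ι X.ι k)) * braidMat hs X Y =
      braidMat hs X Y' * ((1 : Matrix X.ι X.ι k) ⊗ₖ mat f) := by
  ext ⟨y', x'⟩ ⟨x, y⟩
  have := congrFun (congrFun (map_mul_mat (rRight hs (X.M x' x)) f) y') y
  simpa [Matrix.mul_apply, Fintype.sum_prod_type, Matrix.one_apply, rRight, rForm, braidMat]
    using this.symm

/-- The inverse of the braiding. -/
def braidInv (X Y : Corep q) : Matrix (X.ι × Y.ι) (Y.ι × X.ι) k :=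
  Matrix.of fun i j => rForm hs (antipode q (X.M i.1 j.2)) (Y.M i.2 j.1)

theorem braidMat_mul_braidInv (X Y : Corep q) : braidMat hs X Y * braidInv hs X Y = 1 := by
  ext ⟨y', x'⟩ ⟨y, x⟩
  have h := congrArg (rLeft hs (Y.M y' y)) (X.sum_mul_antipode x' x)
  rw [map_sum] at h
  have h1 : rLeft hs (Y.M y' y) (if x' = x then 1 else 0) =
      (1 : Matrix (Y.ι × X.ι) (Y.ι × X.ι) k) (y', x') (y, x) := by
    have h2 : rLeft hs (Y.M y' y) 1 = if y' = y then 1 else 0 :=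
      (rForm_one hs _).trans (Y.counit_M y' y)
    rw [apply_ite (rLeft hs (Y.M y' y)), h2, map_zero, Matrix.one_apply]
    simp only [Prod.mk.injEq]
    split_ifs <;> simp_all
  rw [← h1, ← h, Matrix.mul_apply, Fintype.sum_prod_type]
  exact Finset.sum_congr rfl fun a _ =>
    (rForm_mul_coef hs (X.M x' a) (antipode q (X.M a x)) Y y' y).symm

theorem braidInv_mul_braidMat (X Y : Corep q) : braidInv hs X Y * braidMat hs X Y = 1 := by
  ext ⟨x', y'⟩ ⟨x, y⟩
  have h := congrArg (rLeft hs (Y.M y' y)) (X.sum_antipode_mul x' x)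
  rw [map_sum] at h
  have h1 : rLeft hs (Y.M y' y) (if x' = x then 1 else 0) =
      (1 : Matrix (X.ι × Y.ι) (X.ι × Y.ι) k) (x', y') (x, y) := by
    have h2 : rLeft hs (Y.M y' y) 1 = if y' = y then 1 else 0 :=
      (rForm_one hs _).trans (Y.counit_M y' y)
    rw [apply_ite (rLeft hs (Y.M y' y)), h2, map_zero, Matrix.one_apply]
    simp only [Prod.mk.injEq]
    split_ifs <;> simp_all
  rw [← h1, ← h, Matrix.mul_apply, Fintype.sum_prod_type, Finset.sum_comm]
  exact Finset.sum_congr rfl fun a _ =>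
    (rForm_mul_coef hs (antipode q (X.M x' a)) (X.M a x) Y y' y).symm

/-- The `r`-form is anti-multiplicative in the second variable, when the first one is a matrix
coefficient of `X`. -/
def RMul (X : Corep q) : Prop :=
  ∀ (N P : Corep q) (a b : N.ι) (c d : P.ι) (i j : X.ι),
    rForm hs (X.M i j) (N.M a b * P.M c d) =
      ∑ l, rForm hs (X.M i l) (P.M c d) * rForm hs (X.M l j) (N.M a b)

theorem rMul_fund : RMul hs (fund q) := fun N P a b c d i j => by
  refine (rForm_gen hs i j _).trans ?_
  rw [map_mul]
  refine (Matrix.mul_apply).trans ?_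
  refine Finset.sum_congr rfl fun l _ => ?_
  rw [mul_comm]
  exact (congrArg₂ _ (rForm_gen hs i l _) (rForm_gen hs l j _)).symm

theorem rMul_unit : RMul hs (𝟙_ (Corep q)) := fun N P a b c d i j => by
  have h : ∀ (i j : (𝟙_ (Corep q)).ι) y, rForm hs ((𝟙_ (Corep q)).M i j) y = counit q y :=
    fun i j y => rForm_one hs y
  rw [h, map_mul, mul_comm]
  refine Eq.trans ?_ (Finset.sum_congr rfl fun l _ => (congrArg₂ _ (h i l _) (h l j _)).symm)
  exact (Fintype.sum_unique (ι := Unit) fun _ => counit q (P.M c d) * counit q (N.M a b)).symm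

theorem sum_comm_four {α β γ δ : Type} [Fintype α] [Fintype β] [Fintype γ] [Fintype δ]
    (f : α → β → γ → δ → k) :
    ∑ a, ∑ b, ∑ c, ∑ d, f a b c d = ∑ c, ∑ d, ∑ b, ∑ a, f a b c d := by
  have h := Finset.sum_comm (s := Finset.univ) (t := Finset.univ)
    (f := fun (x : β × α) (y : γ × δ) => f x.2 x.1 y.1 y.2)
  rw [Finset.sum_comm]
  simpa only [Fintype.sum_prod_type] using h

theorem sum_mul_sum_comm {α β γ δ : Type} [Fintype α] [Fintype β] [Fintype γ] [Fintype δ]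
    (f : γ → β → k) (g : γ → α → k) (f' : δ → β → k) (g' : δ → α → k) :
    ∑ x : α × β, (∑ m, f m x.2 * g m x.1) * ∑ m', f' m' x.2 * g' m' x.1 =
      ∑ m : γ × δ, (∑ y, f m.1 y * f' m.2 y) * ∑ x, g m.1 x * g' m.2 x := by
  simp only [Fintype.sum_prod_type, Finset.sum_mul_sum]
  rw [sum_comm_four]
  refine Finset.sum_congr rfl fun m _ => Finset.sum_congr rfl fun m' _ =>
    Finset.sum_congr rfl fun y _ => Finset.sum_congr rfl fun x _ => ?_
  ring

/-- Anti-multiplicativity is inherited by tensor products: both sides are expanded by the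
multiplicativity of the `r`-form in the first variable, applied to the coefficients of `N ⊗ P`, `P`
and `N`. -/
theorem RMul.tensor {X X' : Corep q} (hX : RMul hs X) (hX' : RMul hs X') : RMul hs (X ⊗ X') :=
    fun N P a b c d i j => by
  have h1 := rForm_mul_coef hs (X.M i.1 j.1) (X'.M i.2 j.2) (N ⊗ P) (a, c) (b, d)
  have h2 : ∀ x : N.ι × P.ι, rForm hs (X.M i.1 j.1) (N.M a x.1 * P.M c x.2) *
      rForm hs (X'.M i.2 j.2) (N.M x.1 b * P.M x.2 d) = _ := fun x =>
    congrArg₂ _ (hX N P a x.1 c x.2 i.1 j.1) (hX' N P x.1 b x.2 d i.2 j.2)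
  have h3 := sum_mul_sum_comm (fun m y => rForm hs (X.M i.1 m) (P.M c y))
    (fun m x => rForm hs (X.M m j.1) (N.M a x)) (fun m y => rForm hs (X'.M i.2 m) (P.M y d))
    (fun m x => rForm hs (X'.M m j.2) (N.M x b))
  have h4 : ∀ m : X.ι × X'.ι, rForm hs (X.M i.1 m.1 * X'.M i.2 m.2) (P.M c d) *
      rForm hs (X.M m.1 j.1 * X'.M m.2 j.2) (N.M a b) = _ := fun m =>
    congrArg₂ _ (rForm_mul_coef hs _ _ P c d) (rForm_mul_coef hs _ _ N a b)
  exact h1.trans ((Finset.sum_congr rfl fun x _ => h2 x).trans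
    (h3.trans (Finset.sum_congr rfl fun m _ => (h4 m).symm)))

theorem rMul_iff {X : Corep q} : RMul hs X ↔ ∀ (N P : Corep q) (a b : N.ι) (c d : P.ι),
    X.M.map (rLeft hs (N.M a b * P.M c d)) =
      X.M.map (rLeft hs (P.M c d)) * X.M.map (rLeft hs (N.M a b)) :=
  ⟨fun h N P a b c d => Matrix.ext fun i j => h N P a b c d i j,
    fun h N P a b c d i j => congrFun (congrFun (h N P a b c d) i) j⟩

theorem RMul.summand {X Y Z : Corep q} (i : Z ⟶ X) (p : X ⟶ Z) (j : Z ⟶ Y) (r : Y ⟶ Z)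
    (h : i ≫ p + j ≫ r = 𝟙 Z) (hX : RMul hs X) (hY : RMul hs Y) : RMul hs Z := by
  rw [rMul_iff] at hX hY ⊢
  intro N P a b c d
  have h1 : mat p * mat i + mat r * mat j = 1 := congrArg mat h
  have key : ∀ {W : Corep q} (i : Z ⟶ W) (p : W ⟶ Z) (f g : Oq q →ₗ[k] k),
      mat p * (W.M.map f * W.M.map g) * mat i = Z.M.map f * (mat p * mat i) * Z.M.map g := by
    intro W i p f g
    calc _ = (mat p * W.M.map f) * (W.M.map g * mat i) := by simp only [Matrix.mul_assoc]
      _ = _ := by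
        rw [← map_mul_mat f p, map_mul_mat g i]
        simp only [Matrix.mul_assoc]
  calc Z.M.map (rLeft hs (N.M a b * P.M c d)) =
        Z.M.map (rLeft hs (N.M a b * P.M c d)) * (mat p * mat i + mat r * mat j) := by
        rw [h1, Matrix.mul_one]
    _ = mat p * X.M.map (rLeft hs (N.M a b * P.M c d)) * mat i +
        mat r * Y.M.map (rLeft hs (N.M a b * P.M c d)) * mat j := by
        rw [Matrix.mul_add, ← Matrix.mul_assoc, ← Matrix.mul_assoc, map_mul_mat, map_mul_mat]
    _ = Z.M.map (rLeft hs (P.M c d)) * (mat p * mat i + mat r * mat j) *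
        Z.M.map (rLeft hs (N.M a b)) := by
        rw [hX, hY, key, key, Matrix.mul_add, Matrix.add_mul]
    _ = _ := by rw [h1, Matrix.mul_one]

theorem rMul_of_tilting {X : Corep q} (hX : tensorClosure (fun X => X = fund q) X) : RMul hs X := by
  induction hX with
  | of X hX => subst hX; exact rMul_fund hs
  | unit => exact rMul_unit hs
  | tensor X Y _ _ hX hY => exact RMul.tensor hs hX hY
  | summand X Y Z i p j r h _ _ hX hY => exact RMul.summand hs i p j r h hX hY

/-- The braiding of `X` and `Y` is a homomorphism. -/
def IsBraided (X Y : Corep q) : Prop := ∃ c : X ⊗ Y ⟶ Y ⊗ X, mat c = braidMat hs X Y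

/-- The braiding of `V₁` with itself is `s + s⁻¹ U`, where `U` is the composite of the invariant
form and the invariant vector; this is the skein relation of the Kauffman bracket. -/
theorem isBraided_fund : IsBraided hs (fund q) (fund q) := by
  have hq : ((q⁻¹ : kˣ) : k) = ((s : k) ^ 2)⁻¹ := by simp [hs]
  have key : ∀ x x' y y' : Fin 2, mat ((s : k) • 𝟙 (fund q ⊗ fund q) +
      ((s⁻¹ : kˣ) : k) • (cap q ≫ cup q)) (y', x') (x, y) =
        braidMat hs (fund q) (fund q) (y', x') (x, y) := fun x x' y y' => by
    have h0 : mat (𝟙 (fund q ⊗ fund q)) (y', x') (x, y) =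
        (1 : Matrix (Fin 2 × Fin 2) (Fin 2 × Fin 2) k) (y', x') (x, y) := rfl
    have h1 : mat (cap q ≫ cup q) (y', x') (x, y) =
        !![0, 1; -(q : k), 0] y' x' * !![0, -((q⁻¹ : kˣ) : k); 1, 0] x y :=
      (Matrix.mul_apply).trans (Fintype.sum_unique (ι := Unit) _)
    have h2 : braidMat hs (fund q) (fund q) (y', x') (x, y) = _ :=
      rForm_gen hs x' x (gen q y' y)
    have h3 : mat ((s : k) • 𝟙 (fund q ⊗ fund q) +
      ((s⁻¹ : kˣ) : k) • (cap q ≫ cup q)) (y', x') (x, y) =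
      (s : k) * mat (𝟙 (fund q ⊗ fund q)) (y', x') (x, y) +
        ((s⁻¹ : kˣ) : k) * mat (cap q ≫ cup q) (y', x') (x, y) := rfl
    rw [h3, h2, h0, h1, halfRep_gen]
    fin_cases x <;> fin_cases y <;> fin_cases x' <;> fin_cases y' <;>
      simp [hq, hs] <;> field_simp <;> ring
  exact ⟨_, Matrix.ext fun i j => key j.1 i.2 j.2 i.1⟩

theorem IsBraided.tensor_right {X Y Z : Corep q} (hX : RMul hs X) (hY : IsBraided hs X Y)
    (hZ : IsBraided hs X Z) : IsBraided hs X (Y ⊗ Z) := by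
  obtain ⟨c, hc⟩ := hY
  obtain ⟨d, hd⟩ := hZ
  refine ⟨(α_ X Y Z).inv ≫ (c ▷ Z ≫ (α_ Y X Z).hom ≫ Y ◁ d) ≫ (α_ Y Z X).inv, ?_⟩
  exact hexagon_forward_matrix' (mat c) (mat d) (braidMat hs X (Y ⊗ Z))
    fun y' z' x' x y z => by rw [hc, hd]; exact hX Y Z y' y z' z x' x

theorem IsBraided.tensor_left {X Y Z : Corep q} (hX : IsBraided hs X Z)
    (hY : IsBraided hs Y Z) : IsBraided hs (X ⊗ Y) Z := by
  obtain ⟨c, hc⟩ := hX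
  obtain ⟨d, hd⟩ := hY
  refine ⟨(α_ X Y Z).hom ≫ (X ◁ d ≫ (α_ X Z Y).inv ≫ c ▷ Y) ≫ (α_ Z X Y).hom, ?_⟩
  exact hexagon_reverse_matrix' (mat c) (mat d) (braidMat hs (X ⊗ Y) Z)
    fun x' y' z' x y z => by
      rw [hc, hd]; exact rForm_mul_coef hs (X.M x' x) (Y.M y' y) Z z' z

theorem IsBraided.unit_left (Y : Corep q) : IsBraided hs (𝟙_ (Corep q)) Y := by
  refine ⟨(λ_ Y).hom ≫ (ρ_ Y).inv, ?_⟩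
  have h : perm k (Equiv.prodPUnit Y.ι).symm * perm k (Equiv.punitProd Y.ι) =
      (braidMat hs (𝟙_ (Corep q)) Y : Matrix (Y.ι × Unit) (Unit × Y.ι) k) := by
    rw [perm_mul_perm]
    ext ⟨y', u⟩ ⟨u', y⟩
    refine Eq.trans ?_ ((rForm_one hs _).trans (Y.counit_M y' y)).symm
    simp [perm, Matrix.one_apply]
  exact h

theorem isBraided_fund_unit : IsBraided hs (fund q) (𝟙_ (Corep q)) := by
  refine ⟨(ρ_ (fund q)).hom ≫ (λ_ (fund q)).inv, ?_⟩
  have h : perm k (Equiv.punitProd (Fin 2)).symm * perm k (Equiv.prodPUnit (Fin 2)) =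
      (braidMat hs (fund q) (𝟙_ (Corep q)) : Matrix (Unit × Fin 2) (Fin 2 × Unit) k) := by
    rw [perm_mul_perm]
    ext ⟨u, x'⟩ ⟨x, u'⟩
    refine Eq.trans ?_ (rForm_gen hs x' x 1).symm
    rw [map_one]
    simp [perm, Matrix.one_apply, eq_comm]
  exact h

theorem mat_conj_left {X Z W : Corep q} {c : X ⊗ W ⟶ W ⊗ X} (hc : mat c = braidMat hs X W)
    (i : Z ⟶ X) (p : X ⟶ Z) : mat (i ▷ W ≫ c ≫ W ◁ p) =
      braidMat hs Z W * ((mat p * mat i) ⊗ₖ (1 : Matrix W.ι W.ι k)) := by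
  have h1 : ∀ T : Matrix (W.ι × X.ι) (X.ι × W.ι) k, mat c = T → mat (i ▷ W ≫ c ≫ W ◁ p) =
      ((1 : Matrix W.ι W.ι k) ⊗ₖ mat p) * T * (mat i ⊗ₖ (1 : Matrix W.ι W.ι k)) := by
    rintro T rfl; rfl
  refine (h1 _ hc).trans ?_
  rw [braidMat_natural_left, Matrix.mul_assoc, ← Matrix.mul_kronecker_mul, Matrix.mul_one]

theorem mat_conj_right {X Z W : Corep q} {c : W ⊗ X ⟶ X ⊗ W} (hc : mat c = braidMat hs W X)
    (i : Z ⟶ X) (p : X ⟶ Z) : mat (W ◁ i ≫ c ≫ p ▷ W) =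
      braidMat hs W Z * ((1 : Matrix W.ι W.ι k) ⊗ₖ (mat p * mat i)) := by
  have h1 : ∀ T : Matrix (X.ι × W.ι) (W.ι × X.ι) k, mat c = T → mat (W ◁ i ≫ c ≫ p ▷ W) =
      (mat p ⊗ₖ (1 : Matrix W.ι W.ι k)) * T * ((1 : Matrix W.ι W.ι k) ⊗ₖ mat i) := by
    rintro T rfl; rfl
  refine (h1 _ hc).trans ?_
  rw [braidMat_natural_right, Matrix.mul_assoc, ← Matrix.mul_kronecker_mul, Matrix.mul_one]

/-- If `Z` is a summand, its braiding is a sum of conjugates of the braidings of `X` and `Y`. -/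
theorem IsBraided.summand_left {X Y Z W : Corep q} (i : Z ⟶ X) (p : X ⟶ Z) (j : Z ⟶ Y) (r : Y ⟶ Z)
    (h : i ≫ p + j ≫ r = 𝟙 Z) (hX : IsBraided hs X W) (hY : IsBraided hs Y W) :
    IsBraided hs Z W := by
  obtain ⟨c, hc⟩ := hX
  obtain ⟨d, hd⟩ := hY
  refine ⟨i ▷ W ≫ c ≫ W ◁ p + j ▷ W ≫ d ≫ W ◁ r, ?_⟩
  have h2 : mat p * mat i + mat r * mat j = 1 := congrArg mat h
  rw [mat_add, mat_conj_left hs hc, mat_conj_left hs hd]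
  refine (Matrix.mul_add _ _ _).symm.trans ?_
  rw [← Matrix.add_kronecker, h2, Matrix.one_kronecker_one, Matrix.mul_one]

theorem IsBraided.summand_right {X Y Z W : Corep q} (i : Z ⟶ X) (p : X ⟶ Z) (j : Z ⟶ Y) (r : Y ⟶ Z)
    (h : i ≫ p + j ≫ r = 𝟙 Z) (hX : IsBraided hs W X) (hY : IsBraided hs W Y) :
    IsBraided hs W Z := by
  obtain ⟨c, hc⟩ := hX
  obtain ⟨d, hd⟩ := hY
  refine ⟨W ◁ i ≫ c ≫ p ▷ W + W ◁ j ≫ d ≫ r ▷ W, ?_⟩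
  have h2 : mat p * mat i + mat r * mat j = 1 := congrArg mat h
  rw [mat_add, mat_conj_right hs hc, mat_conj_right hs hd]
  refine (Matrix.mul_add _ _ _).symm.trans ?_
  rw [← Matrix.kronecker_add, h2, Matrix.one_kronecker_one, Matrix.mul_one]

/-- Braidings of tilting modules are homomorphisms, since this holds for `V₁` and is inherited by
tensor products (by the hexagon identities) and summands. -/
theorem isBraided_of_tilting {X Y : Corep q} (hX : tensorClosure (fun X => X = fund q) X)
    (hY : tensorClosure (fun X => X = fund q) Y) : IsBraided hs X Y := by
  induction hX with
  | of X hX =>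
    subst hX
    induction hY with
    | of Y hY => subst hY; exact isBraided_fund hs
    | unit => exact isBraided_fund_unit hs
    | tensor Y Z _ _ hY hZ => exact .tensor_right hs (rMul_fund hs) hY hZ
    | summand X Y Z i p j r h _ _ hX hY => exact .summand_right hs i p j r h hX hY
  | unit => exact .unit_left hs Y
  | tensor X Y _ _ hX hY => exact .tensor_left hs hX hY
  | summand X Y Z i p j r h _ _ hX hY => exact .summand_left hs i p j r h hX hY

/-- The inverse matrix of a homomorphism is a homomorphism. -/
theorem mat_inv_comm {X Y : Corep q} (c : X ⟶ Y) (T : Matrix X.ι Y.ι k) (h : mat c * T = 1)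
    (h' : T * mat c = 1) : X.M * sc q T = sc q T * Y.M := by
  have h1 : sc q (mat c) * sc q T = 1 := by rw [← sc_mul, h, sc_one]
  have h2 : sc q T * sc q (mat c) = 1 := by rw [← sc_mul, h', sc_one]
  calc X.M * sc q T = sc q T * sc q (mat c) * X.M * sc q T := by rw [h2, Matrix.one_mul]
    _ = sc q T * (sc q (mat c) * X.M) * sc q T := by simp only [Matrix.mul_assoc]
    _ = sc q T * Y.M := by
      rw [← mat_comm, Matrix.mul_assoc, Matrix.mul_assoc, h1, Matrix.mul_one]

/-- The braiding isomorphism. -/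
def braidIso {X Y : Corep q} (h : IsBraided hs X Y) : X ⊗ Y ≅ Y ⊗ X where
  hom := ofMat (braidMat hs X Y) (by obtain ⟨c, hc⟩ := h; rw [← hc]; exact mat_comm c)
  inv := ofMat (braidInv hs X Y) (by
    obtain ⟨c, hc⟩ := h
    exact mat_inv_comm c (braidInv hs X Y) (by rw [hc]; exact braidMat_mul_braidInv hs X Y)
      (by rw [hc]; exact braidInv_mul_braidMat hs X Y))
  hom_inv_id := hom_ext (braidInv_mul_braidMat hs X Y)
  inv_hom_id := hom_ext (braidMat_mul_braidInv hs X Y)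

end Corep

section

open Corep

variable {k : Type} [Field k] {q s : kˣ}

/-- The braiding of tilting modules, for a square root `s` of `q`. -/
@[reducible]
def tiltingBraided (hs : (q : k) = s ^ 2) : BraidedCategory (Tilting q) where
  braiding X Y := (ObjectProperty.fullyFaithfulι _).preimageIso
    (X := X ⊗ Y) (Y := Y ⊗ X) (braidIso hs (isBraided_of_tilting hs X.property Y.property))
  braiding_naturality_right X _ _ f := ObjectProperty.hom_ext _
    (Corep.hom_ext (braidMat_natural_right hs X.obj f.hom).symm)
  braiding_naturality_left f Z := ObjectProperty.hom_ext _
    (Corep.hom_ext (braidMat_natural_left hs f.hom Z.obj).symm)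
  hexagon_forward X Y Z := ObjectProperty.hom_ext _ (Corep.hom_ext
    (hexagon_forward_matrix (braidMat hs X.obj Y.obj) (braidMat hs X.obj Z.obj)
      (braidMat hs X.obj (Y.obj ⊗ Z.obj)) fun y' z' x' x y z =>
        rMul_of_tilting hs X.property Y.obj Z.obj y' y z' z x' x))
  hexagon_reverse X Y Z := ObjectProperty.hom_ext _ (Corep.hom_ext
    (hexagon_reverse_matrix (braidMat hs X.obj Z.obj) (braidMat hs Y.obj Z.obj)
      (braidMat hs (X.obj ⊗ Y.obj) Z.obj) fun x' y' z' x y z =>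
        rForm_mul_coef hs (X.obj.M x' x) (Y.obj.M y' y) Z.obj z' z))

end

/-! ### Duals of tilting modules and negligible morphisms -/

section Closed

/-- All morphisms `𝟙 ⟶ V ⊗ U` factor through the coevaluation of `V`. -/
theorem exists_coevaluation_comp {T : Type u} [Category.{v} T] [MonoidalCategory T] {V V' U : T}
    (e : ExactPairing V V') (a : 𝟙_ T ⟶ V ⊗ U) :
    ∃ g : V' ⟶ U, a = e.coevaluation' ≫ V ◁ g := by
  let φ := @tensorLeftHomEquiv T _ _ (𝟙_ _) V V' U e
  refine ⟨(ρ_ _).inv ≫ φ.symm a, ?_⟩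
  have h : a = (λ_ _).inv ≫ e.coevaluation' ▷ _ ≫ (α_ _ _ _).hom ≫ V ◁ φ.symm a :=
    (φ.apply_symm_apply a).symm
  conv_lhs => rw [h]
  simp [← unitors_equal]

variable {k : Type} [Field k] {T : Type u} [Category.{v} T] [Preadditive T] [Linear k T]
  [MonoidalCategory T] [MonoidalPreadditive T] [MonoidalLinear k T]

theorem closed_eq_zero_of_negligible {X Y Z : T} {f : X ⟶ Y} (hf : f ∈ negligible k X Y)
    (a : 𝟙_ T ⟶ X ⊗ Z) (b : Y ⊗ Z ⟶ 𝟙_ T) : a ≫ f ▷ Z ≫ b = 0 := by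
  have := hf (𝟙_ _) Z (a ≫ (λ_ _).inv) ((λ_ _).hom ≫ b)
  simpa using this

theorem closed_eq_zero_of_negligible' {X Y Z : T} {f : X ⟶ Y} (hf : f ∈ negligible k X Y)
    (a : 𝟙_ T ⟶ Z ⊗ X) (b : Z ⊗ Y ⟶ 𝟙_ T) : a ≫ Z ◁ f ≫ b = 0 := by
  have := hf Z (𝟙_ _) (a ≫ Z ◁ (ρ_ _).inv) (Z ◁ (ρ_ _).hom ≫ b)
  simpa using this

/-- In a braided category, an object with scalar endomorphisms and dimension zero is negligible: a
closed diagram through it can be braided into a multiple of its loop. -/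
theorem negligible_of_loop_eq_zero [BraidedCategory T] {V V' : T}
    (hV : ∀ f : V ⟶ V, ∃ c : k, f = c • 𝟙 V) (e : ExactPairing V V') (e' : ExactPairing V' V)
    (h0 : e.coevaluation' ≫ e'.evaluation' = 0) : 𝟙 V ∈ negligible k V V := by
  intro W Z a b
  have key : ∀ (U : T) (a : 𝟙_ _ ⟶ V ⊗ U) (b : V ⊗ U ⟶ 𝟙_ _), a ≫ b = 0 := by
    intro U a b
    obtain ⟨g, rfl⟩ := exists_coevaluation_comp e a
    obtain ⟨c, hc⟩ := exists_smul_evaluation hV e' (V ◁ g ≫ b)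
    rw [Category.assoc, hc, Linear.comp_smul, h0, smul_zero]
  have := key (Z ⊗ W) (a ≫ (β_ W (V ⊗ Z)).hom ≫ (α_ _ _ _).hom)
    ((α_ _ _ _).inv ≫ (β_ W (V ⊗ Z)).inv ≫ b)
  simpa using this

end Closed

namespace Corep

open scoped Kronecker

variable {k : Type} [Field k] {q : kˣ}

/-- The direct sum of representations. -/
def sum (X Y : Corep q) : Corep q where
  ι := X.ι ⊕ Y.ι
  M := Matrix.fromBlocks X.M 0 0 Y.M
  comul_M := by
    rintro (i | i) (j | j) <;> simp [X.comul_M, Y.comul_M]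
  counit_M := by
    rintro (i | i) (j | j) <;> simp [X.counit_M, Y.counit_M]

section Matrices

variable {m n : Type} [Fintype m] [Fintype n] (A : Matrix m m (Oq q)) (B : Matrix n n (Oq q))

theorem fromBlocks_mul_inl [DecidableEq m] : Matrix.fromBlocks A 0 0 B *
    sc q (Matrix.fromRows (1 : Matrix m m k) (0 : Matrix n m k)) =
      sc q (Matrix.fromRows (1 : Matrix m m k) (0 : Matrix n m k)) * A := by
  ext (i | i) j <;> simp [sc, Matrix.mul_apply, Matrix.one_apply, apply_ite (algebraMap k (Oq q))]

theorem fromBlocks_mul_inr [DecidableEq n] : Matrix.fromBlocks A 0 0 B *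
    sc q (Matrix.fromRows (0 : Matrix m n k) (1 : Matrix n n k)) =
      sc q (Matrix.fromRows (0 : Matrix m n k) (1 : Matrix n n k)) * B := by
  ext (i | i) j <;> simp [sc, Matrix.mul_apply, Matrix.one_apply, apply_ite (algebraMap k (Oq q))]

theorem fst_mul_fromBlocks [DecidableEq m] :
    A * sc q (Matrix.fromCols (1 : Matrix m m k) (0 : Matrix m n k)) =
    sc q (Matrix.fromCols (1 : Matrix m m k) (0 : Matrix m n k)) * Matrix.fromBlocks A 0 0 B := by
  ext i (j | j) <;> simp [sc, Matrix.mul_apply, Matrix.one_apply, apply_ite (algebraMap k (Oq q))]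

theorem snd_mul_fromBlocks [DecidableEq n] :
    B * sc q (Matrix.fromCols (0 : Matrix n m k) (1 : Matrix n n k)) =
    sc q (Matrix.fromCols (0 : Matrix n m k) (1 : Matrix n n k)) * Matrix.fromBlocks A 0 0 B := by
  ext i (j | j) <;> simp [sc, Matrix.mul_apply, Matrix.one_apply, apply_ite (algebraMap k (Oq q))]

theorem inl_mul_fst_add [DecidableEq m] [DecidableEq n] :
    Matrix.fromRows (1 : Matrix m m k) (0 : Matrix n m k) * Matrix.fromCols 1 (0 : Matrix m n k) +
      Matrix.fromRows (0 : Matrix m n k) (1 : Matrix n n k) *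
        Matrix.fromCols (0 : Matrix n m k) 1 = 1 := by
  ext (i | i) (j | j) <;> simp [Matrix.one_apply]

end Matrices

theorem hasSums : HasSums (Corep q) :=
  ⟨⟨⟨Empty, 0, fun i => i.elim, fun i => i.elim⟩, hom_ext (Matrix.ext fun i => i.elim)⟩,
    fun X Y => ⟨X.sum Y, ofMat _ (fromBlocks_mul_inl X.M Y.M), ofMat _ (fst_mul_fromBlocks X.M Y.M),
      ofMat _ (fromBlocks_mul_inr X.M Y.M), ofMat _ (snd_mul_fromBlocks X.M Y.M),
      hom_ext ((Matrix.fromCols_mul_fromRows _ _ _ _).trans (by simp)),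
      hom_ext ((Matrix.fromCols_mul_fromRows _ _ _ _).trans (by simp)),
      hom_ext ((Matrix.fromCols_mul_fromRows _ _ _ _).trans (by simp)),
      hom_ext ((Matrix.fromCols_mul_fromRows _ _ _ _).trans (by simp)),
      hom_ext inl_mul_fst_add⟩⟩

/-- Representations have right duals. -/
instance : RightRigidCategory (Corep q) where
  rightDual X := { rightDual := X.dual, exact := dualPairing X }

/-- The dual of a tilting module is a tilting module, as `V₁` is self-dual. -/
theorem tilting_dual {X : Corep q} (hX : tensorClosure (fun X => X = fund q) X) :
    tensorClosure (fun X => X = fund q) X.dual := by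
  refine tensorClosure.rightDual (S := fun X => X = fund q) (fun X hX => ?_) hX
  subst hX
  exact (tensorClosure.of (S := fun X => X = fund q) _ rfl).iso
    (rightDualIso (dualPairing _) (fundPairing q))

end Corep

section Negligible

open Corep

variable {k : Type} [Field k] {q : kˣ}

/-- The dual of a tilting module. -/
def Tilting.dual (X : Tilting q) : Tilting q := ⟨X.obj.dual, tilting_dual X.property⟩

/-- The dual of a tilting module is a right dual. -/
@[reducible]
def Tilting.pairing (X : Tilting q) : ExactPairing X X.dual :=
  fullSubcategoryPairing _ _ _ (dualPairing X.obj)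

/-- The dual of a tilting module is a left dual. -/
@[reducible]
def Tilting.pairing' (X : Tilting q) : ExactPairing X.dual X :=
  fullSubcategoryPairing _ _ _ (dualPairing' X.obj)

/-- The loop with the pivotal evaluation is a quantum trace. -/
theorem Tilting.loop (X : Tilting q) (f : X ⟶ X) :
    X.pairing.coevaluation' ≫ f ▷ X.dual ≫ X.pairing'.evaluation' =
      (mat f.hom * X.obj.Kinv).trace • 𝟙 _ :=
  ObjectProperty.hom_ext _ (dualCoev_comp X.obj f.hom)

/-- The loop with the pivotal coevaluation is a quantum trace. -/
theorem Tilting.loop' (X : Tilting q) (f : X ⟶ X) :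
    X.pairing'.coevaluation' ≫ X.dual ◁ f ≫ X.pairing.evaluation' =
      (mat f.hom * X.obj.Kmat).trace • 𝟙 _ :=
  ObjectProperty.hom_ext _ (dualCoev'_comp X.obj f.hom)

theorem Tilting.smul_id_unit_eq_zero {c : k} (h : c • 𝟙 (𝟙_ (Tilting q)) = 0) : c = 0 := by
  have h1 : c • 𝟙 (𝟙_ (Corep q)) = 0 := congrArg (fun f => f.hom) h
  have h2 : c * (1 : Matrix Unit Unit k) () () = 0 := congrFun (congrFun (congrArg mat h1) ()) ()
  simpa using h2

/-- The quantum traces of a negligible endomorphism vanish, since they are closed diagrams. -/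
theorem trace_eq_zero_of_negligible {X : Tilting q} {f : X ⟶ X} (hf : f ∈ negligible k X X) :
    (mat f.hom * X.obj.Kinv).trace = 0 ∧ (mat f.hom * X.obj.Kmat).trace = 0 :=
  ⟨Tilting.smul_id_unit_eq_zero ((X.loop f).symm.trans (closed_eq_zero_of_negligible hf _ _)),
    Tilting.smul_id_unit_eq_zero ((X.loop' f).symm.trans (closed_eq_zero_of_negligible' hf _ _))⟩

/-- A tilting module with scalar endomorphisms and quantum dimension zero is negligible. -/
theorem negligible_of_trace_eq_zero {s : kˣ} (hs : (q : k) = s ^ 2) {V : Tilting q}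
    (hV : ∀ f : V ⟶ V, ∃ c : k, f = c • 𝟙 V) (h0 : V.obj.Kinv.trace = 0) :
    𝟙 V ∈ negligible k V V := by
  let := tiltingBraided hs
  refine negligible_of_loop_eq_zero hV V.pairing V.pairing' ?_
  have h1 := V.loop (𝟙 V)
  rw [MonoidalCategory.id_whiskerRight, Category.id_comp] at h1
  have h : (mat (𝟙 V : V ⟶ V).hom * V.obj.Kinv).trace = 0 := by
    rw [← h0]; exact congrArg _ (Matrix.one_mul _)
  rw [h1, h, zero_smul]

end Negligible

/-! ### The Weyl modules -/

section Weyl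

open Corep
open scoped Kronecker

variable {k : Type} [Field k]

/-- The quantum integer `[n]_q`. -/
def qn (q : kˣ) (n : ℕ) : k :=
  ((q : k) ^ n - ((q⁻¹ : kˣ) : k) ^ n) / ((q : k) - ((q⁻¹ : kˣ) : k))

theorem qn_zero (q : kˣ) : qn q 0 = 0 := by simp [qn]

/-- The addition formula for quantum integers. -/
theorem qn_add (q : kˣ) (a b : ℕ) :
    qn q (a + b) = (q : k) ^ b * qn q a + ((q⁻¹ : kˣ) : k) ^ a * qn q b := by
  simp only [qn, pow_add]
  ring

section Split

variable {q : kˣ} (X : Corep q) {n : Type} [DecidableEq n] (P : Matrix n X.ι k)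
  (J : Matrix X.ι n k)

/-! If `J * P` is an idempotent endomorphism of `X`, split by `P * J = 1`, then its image, with
coefficients `P M J`, is a representation, and `P` and `J` are homomorphisms. -/

theorem split_proj [Fintype n] (h : X.M * sc q (J * P) = sc q (J * P) * X.M) (hPJ : P * J = 1) :
    sc q P * X.M * sc q J * sc q P = sc q P * X.M := by
  rw [Matrix.mul_assoc, ← sc_mul, Matrix.mul_assoc, h, ← Matrix.mul_assoc, ← sc_mul,
    ← Matrix.mul_assoc, hPJ, Matrix.one_mul]

theorem split_incl [Fintype n] (h : X.M * sc q (J * P) = sc q (J * P) * X.M) (hPJ : P * J = 1) :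
    X.M * sc q J = sc q J * (sc q P * X.M * sc q J) := by
  rw [← Matrix.mul_assoc, ← Matrix.mul_assoc, ← sc_mul, ← h, Matrix.mul_assoc, ← sc_mul,
    Matrix.mul_assoc, hPJ, Matrix.mul_one]

theorem split_comul [Fintype n] (h : X.M * sc q (J * P) = sc q (J * P) * X.M) (hPJ : P * J = 1)
    (i j : n) :
    comul q ((sc q P * X.M * sc q J) i j) =
      ∑ l, (sc q P * X.M * sc q J) i l ⊗ₜ[k] (sc q P * X.M * sc q J) l j := by
  -- In terms of matrices over `O_q ⊗ O_q`, comultiplicativity of `M` reads `Δ(M) = M_L * M_R`.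
  let L : Oq q →ₐ[k] Oq q ⊗[k] Oq q := Algebra.TensorProduct.includeLeft
  let R : Oq q →ₐ[k] Oq q ⊗[k] Oq q := Algebra.TensorProduct.includeRight
  have hmul : ∀ {l m n : Type} [Fintype m] (A : Matrix l m (Oq q)) (B : Matrix m n (Oq q)) i j,
      (A.map L * B.map R) i j = ∑ x, A i x ⊗ₜ[k] B x j := fun A B i j => by
    simp [Matrix.mul_apply, L, R]
  have hM : X.M.map (comul q) = X.M.map L * X.M.map R := Matrix.ext fun i j => by
    rw [hmul]; exact X.comul_M i j
  have hsc : ∀ {m n : Type} (T : Matrix m n k) (f g : Oq q →ₐ[k] Oq q ⊗[k] Oq q),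
      (sc q T).map f = (sc q T).map g := fun T f g => Matrix.ext fun i j =>
    (f.commutes _).trans (g.commutes _).symm
  have key : (sc q P * X.M * sc q J).map (comul q) =
      (sc q P * X.M * sc q J).map L * (sc q P * X.M * sc q J).map R := by
    calc _ = (sc q P).map L * (X.M.map L * X.M.map R) * (sc q J).map R := by
          rw [Matrix.map_mul, Matrix.map_mul, hM, hsc P (comul q) L, hsc J (comul q) R]
      _ = (sc q P * X.M).map L * (X.M * sc q J).map R := by
          rw [Matrix.map_mul, Matrix.map_mul]
          simp only [Matrix.mul_assoc]
      _ = (sc q P * X.M * sc q J * sc q P).map L * (X.M * sc q J).map R := by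
          rw [split_proj X P J h hPJ]
      _ = _ := by
          rw [Matrix.map_mul (M := sc q P), hsc P L R, Matrix.mul_assoc, ← Matrix.map_mul,
            ← Matrix.mul_assoc (sc q P)]
  exact (congrFun (congrFun key i) j).trans (hmul _ _ i j)

theorem split_counit (hPJ : P * J = 1) (i j : n) :
    counit q ((sc q P * X.M * sc q J) i j) = if i = j then 1 else 0 := by
  have h1 : X.M.map (counit q).toLinearMap = 1 := Matrix.ext fun i j =>
    (X.counit_M i j).trans Matrix.one_apply.symm
  have h2 : (sc q P * X.M * sc q J).map (counit q).toLinearMap = P * J := by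
    rw [map_mul_sc, map_sc_mul, h1, Matrix.mul_one]
  rw [← Matrix.one_apply, ← hPJ, ← h2]
  rfl

end Split

/-- The inclusion of the Weyl module with highest weight `n + 1` in the tensor product of the one
with highest weight `n` and the fundamental representation:
`u_j ↦ u_j ⊗ e₀ + q^(n + 1 - j) u_(j - 1) ⊗ e₁`. -/
def weylIncl (q : kˣ) (n : ℕ) : Matrix (Fin (n + 1) × Fin 2) (Fin (n + 2)) k :=
  Matrix.of fun x j => ![if x.1.castSucc = j then 1 else 0,
    if x.1.succ = j then (q : k) ^ (n - x.1 : ℕ) else 0] x.2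

/-- The projection of the tensor product onto the Weyl module with highest weight `n + 1`. -/
def weylProj (q : kˣ) (n : ℕ) : Matrix (Fin (n + 2)) (Fin (n + 1) × Fin 2) k :=
  Matrix.of fun j x => ![if x.1.castSucc = j then
      ((q⁻¹ : kˣ) : k) ^ (x.1 : ℕ) * qn q (n + 1 - x.1) / qn q (n + 1) else 0,
    if x.1.succ = j then qn q (x.1 + 1) / qn q (n + 1) else 0] x.2

theorem sum_castSucc {n : ℕ} (G : ℕ → k) (hG : G (n + 1) = 0) (j : Fin (n + 2)) :
    ∑ i : Fin (n + 1), (if i.castSucc = j then G i else 0) = G j := by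
  induction j using Fin.lastCases with
  | last => simp [Fin.castSucc_ne_last, hG]
  | cast j => simp

theorem sum_succ {n : ℕ} (G : ℕ → k) (hG : G 0 = 0) (j : Fin (n + 2)) :
    ∑ i : Fin (n + 1), (if i.succ = j then G (i + 1) else 0) = G j := by
  induction j using Fin.cases with
  | zero => simp [hG]
  | succ j => simp

theorem sum_castSucc_castSucc {n : ℕ} (G : ℕ → k) (hG : G (n + 1) = 0) (j j' : Fin (n + 2)) :
    ∑ i : Fin (n + 1), (if i.castSucc = j' then if i.castSucc = j then G i else 0 else 0) =
      if j = j' then G j else 0 := by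
  split_ifs with hj
  · subst hj
    rw [← sum_castSucc G hG j]
    exact Finset.sum_congr rfl fun i _ => by split_ifs <;> rfl
  · exact Finset.sum_eq_zero fun i _ => by split_ifs with h1 h2 <;> simp_all

theorem sum_succ_succ {n : ℕ} (G : ℕ → k) (hG : G 0 = 0) (j j' : Fin (n + 2)) :
    ∑ i : Fin (n + 1), (if i.succ = j' then if i.succ = j then G (i + 1) else 0 else 0) =
      if j = j' then G j else 0 := by
  split_ifs with hj
  · subst hj
    rw [← sum_succ G hG j]
    exact Finset.sum_congr rfl fun i _ => by split_ifs <;> rfl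
  · exact Finset.sum_eq_zero fun i _ => by split_ifs with h1 h2 <;> simp_all

/-- The addition formula for `[n]`, with `n = (n - j) + j`. -/
theorem qn_split (q : kˣ) {n j : ℕ} (hj : j ≤ n) :
    ((q⁻¹ : kˣ) : k) ^ j * qn q (n - j) + (q : k) ^ (n - j) * qn q j = qn q n := by
  obtain ⟨m, rfl⟩ := Nat.exists_eq_add_of_le hj
  rw [qn_add, Nat.add_sub_cancel_left, add_comm]

theorem weylProj_mul_weylIncl {q : kˣ} {n : ℕ} (h : qn q (n + 1) ≠ 0) :
    weylProj q n * weylIncl q n = 1 := by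
  ext j j'
  rw [Matrix.mul_apply, Fintype.sum_prod_type]
  simp only [Fin.sum_univ_two, weylProj, weylIncl, Matrix.of_apply, Matrix.cons_val_zero,
    Matrix.cons_val_one, Finset.sum_add_distrib, mul_ite, mul_one, mul_zero, ite_mul, zero_mul]
  rcases eq_or_ne j j' with rfl | hj
  · have h1 := sum_castSucc (n := n)
      (fun i => ((q⁻¹ : kˣ) : k) ^ i * qn q (n + 1 - i) / qn q (n + 1)) (by simp [qn_zero]) j
    have h2 := sum_succ (n := n)
      (fun i => qn q i / qn q (n + 1) * (q : k) ^ (n + 1 - i)) (by simp [qn_zero]) j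
    simp only [Nat.add_sub_add_right] at h2
    rw [Matrix.one_apply_eq]
    calc _ = _ + _ := congrArg₂ _
          (Eq.trans (Finset.sum_congr rfl fun i _ => by split_ifs <;> rfl) h1)
          (Eq.trans (Finset.sum_congr rfl fun i _ => by split_ifs <;> rfl) h2)
      _ = _ := by
        rw [div_mul_eq_mul_div, ← add_div, mul_comm (qn q j), qn_split q (Nat.lt_succ_iff.1 j.2),
          div_self h]
  · rw [Matrix.one_apply_ne hj, Finset.sum_eq_zero, Finset.sum_eq_zero, add_zero]
    · intro i _; split_ifs with h1 h2 <;> simp_all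
    · intro i _; split_ifs with h1 h2 <;> simp_all

/-- The inclusion of the Weyl module with highest weight `n` in the tensor product of the one
with highest weight `n + 1` and the fundamental representation: one leg of `weylProj` is bent by
the invariant vector in `V₁ ⊗ V₁`. -/
def weylIncl' (q : kˣ) (n : ℕ) : Matrix (Fin (n + 2) × Fin 2) (Fin (n + 1)) k :=
  Matrix.of fun y x => ![-(q : k) * weylProj q n y.1 (x, 1), weylProj q n y.1 (x, 0)] y.2

/-- The projection onto the Weyl module with highest weight `n`, up to a scalar: one leg of
`weylIncl` is bent by the invariant form on `V₁ ⊗ V₁`. -/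
def weylProj' (q : kˣ) (n : ℕ) : Matrix (Fin (n + 1)) (Fin (n + 2) × Fin 2) k :=
  Matrix.of fun x y => ![weylIncl q n (x, 1) y.1, -((q⁻¹ : kˣ) : k) * weylIncl q n (x, 0) y.1] y.2

/-- The Jones–Wenzl recursion: the idempotent which defines the Weyl module with highest weight `n +
2` is expressed by the homomorphisms for the previous step. -/
theorem weylIncl_mul_weylProj {q : kˣ} {n : ℕ} (h : qn q (n + 1) ≠ 0) (h' : qn q (n + 2) ≠ 0) :
    weylIncl q (n + 1) * weylProj q (n + 1) =
      1 + (qn q (n + 1) / qn q (n + 2)) • (weylIncl' q n * weylProj' q n) := by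
  ext ⟨i, ε⟩ ⟨i', ε'⟩
  rw [Matrix.add_apply, Matrix.smul_apply, Matrix.mul_apply, Matrix.mul_apply]
  fin_cases ε <;> fin_cases ε' <;>
    simp only [weylProj, weylIncl, weylIncl', weylProj', Matrix.of_apply, Matrix.cons_val_zero,
      Matrix.cons_val_one, mul_ite, mul_one, mul_zero, ite_mul, zero_mul, Fin.zero_eta, Fin.mk_one,
      one_mul, Finset.sum_ite_eq, Finset.mem_univ, if_true, smul_eq_mul, Matrix.one_apply,
      Prod.mk.injEq, and_true, Fin.castSucc_inj, Fin.succ_inj]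
  · have h1 := sum_succ_succ (n := n)
      (fun m => -(q : k) * (qn q m / qn q (n + 1)) * (q : k) ^ (n + 1 - m)) (by simp [qn_zero]) i i'
    simp only [Nat.add_sub_add_right] at h1
    rw [h1]
    split_ifs with hi
    · subst hi
      have h2 := qn_split q (n := n + 2) (j := i) i.2.le
      rw [Nat.succ_sub (Nat.lt_succ_iff.1 i.2), pow_succ] at h2
      rw [Nat.succ_sub (Nat.lt_succ_iff.1 i.2)]
      field_simp
      linear_combination h2
    · simp
  · induction i' using Fin.lastCases with
    | last =>
      rw [if_neg (fun h0 => by have := congrArg Fin.val h0; simp at this; omega),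
        Finset.sum_eq_zero fun x _ => if_neg (Fin.castSucc_ne_last x)]
      simp
    | cast x =>
      have hc : i.castSucc = x.castSucc.succ ↔ x.succ = i := by simp [Fin.ext_iff, eq_comm]
      simp only [Fin.castSucc_inj, Finset.sum_ite_eq', Finset.mem_univ, if_true, hc]
      by_cases hi : x.succ = i
      · simp [hi]
        field_simp
      · simp [hi]
  · induction i' using Fin.cases with
    | zero =>
      rw [if_neg (fun h0 => by have := congrArg Fin.val h0; simp at this),
        Finset.sum_eq_zero fun x _ => if_neg (Fin.succ_ne_zero x)]
      simp
    | succ x =>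
      have hc : i.succ = x.succ.castSucc ↔ x.castSucc = i := by simp [Fin.ext_iff, eq_comm]
      simp only [Fin.succ_inj, Finset.sum_ite_eq', Finset.mem_univ, if_true, hc]
      by_cases hi : x.castSucc = i
      · have h2 : n + 1 - (x : ℕ) = (n - x) + 1 := Nat.succ_sub (Nat.lt_succ_iff.1 x.2)
        simp [← hi, h2, pow_succ]
        field_simp
      · simp [hi]
  · have h1 := sum_castSucc_castSucc (n := n)
      (fun m => ((q⁻¹ : kˣ) : k) ^ m * qn q (n + 1 - m) / qn q (n + 1) * -((q⁻¹ : kˣ) : k))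
      (by simp [qn_zero]) i i'
    rw [h1]
    split_ifs with hi
    · subst hi
      have h2 := qn_split q (n := n + 2) (j := i + 1) i.2
      rw [pow_succ, show n + 2 - ((i : ℕ) + 1) = n + 1 - i by omega] at h2
      field_simp
      linear_combination h2
    · simp

/-- A partial trace of the Jones–Wenzl idempotent is the scalar `-[n + 2] / [n + 1]`. -/
theorem weylProj'_mul_weylIncl' {q : kˣ} {n : ℕ} (h : qn q (n + 1) ≠ 0) :
    weylProj' q n * weylIncl' q n = -(qn q (n + 2) / qn q (n + 1)) • 1 := by
  ext i i'
  rw [Matrix.mul_apply, Fintype.sum_prod_type]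
  simp only [weylProj, weylIncl, weylIncl', weylProj', Matrix.of_apply, Matrix.cons_val_zero,
      Matrix.cons_val_one, mul_ite, mul_one, mul_zero, ite_mul, zero_mul, Fin.sum_univ_two,
      Finset.sum_add_distrib, Finset.sum_ite_eq, Finset.mem_univ, if_true, Fin.castSucc_inj,
      Fin.succ_inj]
  rw [Matrix.smul_apply, Matrix.one_apply]
  split_ifs with hi
  · subst hi
    have h2 := qn_split q (n := n + 2) (j := i + 1) (Nat.succ_le_succ i.2.le)
    have h3 : n + 1 - (i : ℕ) = (n - i) + 1 := Nat.succ_sub (Nat.lt_succ_iff.1 i.2)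
    rw [pow_succ, show n + 2 - ((i : ℕ) + 1) = n + 1 - i by omega, h3, pow_succ] at h2
    rw [h3, smul_eq_mul]
    field_simp
    linear_combination -h2
  · simp

end Weyl

section WeylModules

open Corep
open scoped Kronecker

variable {k : Type} [Field k]

/-- The matrix coefficients of the Weyl module with highest weight `n`. -/
def weylM (q : kˣ) : (n : ℕ) → Matrix (Fin (n + 1)) (Fin (n + 1)) (Oq q)
  | 0 => 1
  | n + 1 => sc q (weylProj q n) * (weylM q n ⊗ₖ Matrix.of (gen q)) * sc q (weylIncl q n)

/-- The matrix `M` is the matrix of coefficients of a representation. -/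
def IsCoaction {q : kˣ} {n : Type} [Fintype n] [DecidableEq n] (M : Matrix n n (Oq q)) : Prop :=
  (∀ i j, comul q (M i j) = ∑ l, M i l ⊗ₜ[k] M l j) ∧
    ∀ i j, counit q (M i j) = if i = j then 1 else 0

/-- The representation with a given matrix of coefficients. -/
abbrev IsCoaction.corep {q : kˣ} {n : Type} [Fintype n] [DecidableEq n] {M : Matrix n n (Oq q)}
    (h : IsCoaction M) : Corep q := ⟨n, M, h.1, h.2⟩

section Matrices

variable {m n : Type} [Fintype m] [DecidableEq m]

/-- The coefficients of a morphism whose leg is bent by an invariant vector. -/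
theorem cup_whisker (P : Matrix n (m × Fin 2) k) (c : Matrix (Fin 2 × Fin 2) Unit k) (x : m) (y : n)
    (ε : Fin 2) :
    ((P ⊗ₖ (1 : Matrix (Fin 2) (Fin 2) k)) * (perm k (Equiv.prodAssoc m (Fin 2) (Fin 2)).symm *
      (((1 : Matrix m m k) ⊗ₖ c) * perm k (Equiv.prodPUnit m).symm))) (y, ε) x =
        ∑ δ, P y (x, δ) * c (δ, ε) () := by
  rw [mul_perm, perm_mul]
  simp [Matrix.mul_apply, Fintype.sum_prod_type, Matrix.one_apply]

/-- The coefficients of a morphism whose leg is bent by an invariant form. -/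
theorem whisker_cap (J : Matrix (m × Fin 2) n k) (c : Matrix Unit (Fin 2 × Fin 2) k) (x : m) (y : n)
    (ε : Fin 2) :
    (perm k (Equiv.prodPUnit m) * (((1 : Matrix m m k) ⊗ₖ c) *
      (perm k (Equiv.prodAssoc m (Fin 2) (Fin 2)) *
        (J ⊗ₖ (1 : Matrix (Fin 2) (Fin 2) k))))) x (y, ε) =
        ∑ δ, c () (δ, ε) * J (x, δ) y := by
  rw [perm_mul, perm_mul]
  simp [Matrix.mul_apply, Fintype.sum_prod_type, Matrix.one_apply]

end Matrices

section Bend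

variable {q : kˣ} {X Y : Corep q}

/-- The morphism `X ⟶ Y ⊗ V₁` which corresponds to `X ⊗ V₁ ⟶ Y`. -/
def bendRight (p : X ⊗ fund q ⟶ Y) : X ⟶ Y ⊗ fund q :=
  (((ρ_ X).inv ≫ X ◁ cup q) ≫ (α_ X (fund q) (fund q)).inv) ≫ p ▷ fund q

/-- The morphism `Y ⊗ V₁ ⟶ X` which corresponds to `Y ⟶ X ⊗ V₁`. -/
def bendLeft (i : Y ⟶ X ⊗ fund q) : Y ⊗ fund q ⟶ X :=
  ((i ▷ fund q ≫ (α_ X (fund q) (fund q)).hom) ≫ X ◁ cap q) ≫ (ρ_ X).hom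

theorem mat_bendRight (p : X ⊗ fund q ⟶ Y) (x : X.ι) (y : Y.ι) (ε : Fin 2) :
    mat (bendRight p) (y, ε) x = ∑ δ : Fin 2, mat p y (x, δ) * !![0, 1; -(q : k), 0] δ ε :=
  cup_whisker (mat p) (mat (cup q)) x y ε

theorem mat_bendLeft (i : Y ⟶ X ⊗ fund q) (x : X.ι) (y : Y.ι) (ε : Fin 2) :
    mat (bendLeft i) x (y, ε) =
      ∑ δ : Fin 2, !![0, -((q⁻¹ : kˣ) : k); 1, 0] δ ε * mat i (x, δ) y :=
  whisker_cap (mat i) (mat (cap q)) x y ε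

end Bend

variable {q : kˣ}

/-- The statement that the Weyl modules of highest weights `n` and `n + 1` are defined, and that the
inclusion and the projection are homomorphisms. -/
structure IsWeyl (q : kˣ) (n : ℕ) : Prop where
  coaction : IsCoaction (weylM q n)
  coaction_succ : IsCoaction (weylM q (n + 1))
  proj : weylM q (n + 1) * sc q (weylProj q n) =
    sc q (weylProj q n) * (weylM q n ⊗ₖ Matrix.of (gen q))
  incl : (weylM q n ⊗ₖ Matrix.of (gen q)) * sc q (weylIncl q n) =
    sc q (weylIncl q n) * weylM q (n + 1)

/-- It suffices that the idempotent on the tensor product with `V₁` is a homomorphism. -/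
theorem IsWeyl.of_coaction {n : ℕ} (h : IsCoaction (weylM q n)) (hn : qn q (n + 1) ≠ 0)
    (he : (weylM q n ⊗ₖ Matrix.of (gen q)) * sc q (weylIncl q n * weylProj q n) =
      sc q (weylIncl q n * weylProj q n) * (weylM q n ⊗ₖ Matrix.of (gen q))) : IsWeyl q n where
  coaction := h
  coaction_succ :=
    ⟨split_comul (h.corep ⊗ fund q) (weylProj q n) (weylIncl q n) he (weylProj_mul_weylIncl hn),
      split_counit (h.corep ⊗ fund q) (weylProj q n) (weylIncl q n) (weylProj_mul_weylIncl hn)⟩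
  proj := split_proj (h.corep ⊗ fund q) (weylProj q n) (weylIncl q n) he (weylProj_mul_weylIncl hn)
  incl := split_incl (h.corep ⊗ fund q) (weylProj q n) (weylIncl q n) he (weylProj_mul_weylIncl hn)

theorem isCoaction_zero : IsCoaction (weylM q 0) := by
  have h : ∀ x : Fin (0 + 1), x = 0 := fun x => Subsingleton.elim (α := Fin 1) x 0
  refine ⟨fun i j => ?_, fun i j => ?_⟩ <;> rw [h i, h j]
  · simp [weylM, Algebra.TensorProduct.one_def]
  · simp [weylM]

theorem weylIncl_zero (hn : qn q 1 ≠ 0) : weylIncl q 0 * weylProj q 0 = 1 := by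
  ext ⟨i, ε⟩ ⟨i', ε'⟩
  rw [Matrix.mul_apply, Fin.sum_univ_two]
  have h : ∀ x : Fin 1, x = 0 := fun x => Subsingleton.elim x 0
  rw [h i, h i']
  fin_cases ε <;> fin_cases ε' <;> simp [weylIncl, weylProj, hn]

theorem isWeyl_zero (hn : qn q 1 ≠ 0) : IsWeyl q 0 :=
  .of_coaction isCoaction_zero hn (by rw [weylIncl_zero hn, sc_one, Matrix.mul_one, Matrix.one_mul])

/-- The Weyl module with highest weight `n`. -/
abbrev IsWeyl.obj {n : ℕ} (h : IsWeyl q n) : Corep q := h.coaction.corep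

/-- The Weyl module with highest weight `n + 1`. -/
abbrev IsWeyl.objSucc {n : ℕ} (h : IsWeyl q n) : Corep q := h.coaction_succ.corep

/-- The inclusion as a homomorphism. -/
def IsWeyl.inclHom {n : ℕ} (h : IsWeyl q n) : h.objSucc ⟶ h.obj ⊗ fund q :=
  ofMat (weylIncl q n) h.incl

/-- The projection as a homomorphism. -/
def IsWeyl.projHom {n : ℕ} (h : IsWeyl q n) : h.obj ⊗ fund q ⟶ h.objSucc :=
  ofMat (weylProj q n) h.proj

theorem IsWeyl.mat_bendRight {n : ℕ} (h : IsWeyl q n) :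
    mat (bendRight h.projHom) = weylIncl' q n := by
  have key : ∀ (x : Fin (n + 1)) (y : Fin (n + 2)) (ε : Fin 2),
      ∑ δ : Fin 2, weylProj q n y (x, δ) * !![0, 1; -(q : k), 0] δ ε = weylIncl' q n (y, ε) x := by
    intro x y ε
    fin_cases ε <;> simp [weylIncl', mul_comm]
  ext ⟨y, ε⟩ x
  exact (Verlinde.mat_bendRight h.projHom x y ε).trans (key x y ε)

theorem IsWeyl.mat_bendLeft {n : ℕ} (h : IsWeyl q n) :
    mat (bendLeft h.inclHom) = weylProj' q n := by
  have key : ∀ (x : Fin (n + 1)) (y : Fin (n + 2)) (ε : Fin 2),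
      ∑ δ : Fin 2, !![0, -((q⁻¹ : kˣ) : k); 1, 0] δ ε * weylIncl q n (x, δ) y =
        weylProj' q n x (y, ε) := by
    intro x y ε
    fin_cases ε <;> simp [weylProj']
  ext x ⟨y, ε⟩
  exact (Verlinde.mat_bendLeft h.inclHom x y ε).trans (key x y ε)

/-- By the Jones–Wenzl recursion, the next idempotent is a combination of homomorphisms. -/
theorem IsWeyl.succ {n : ℕ} (h : IsWeyl q n) (hn : qn q (n + 1) ≠ 0) (hn' : qn q (n + 2) ≠ 0) :
    IsWeyl q (n + 1) := by
  have h1 := mat_comm (𝟙 _ + (qn q (n + 1) / qn q (n + 2)) •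
    (bendLeft h.inclHom ≫ bendRight h.projHom))
  refine .of_coaction h.coaction_succ hn' ?_
  rw [weylIncl_mul_weylProj hn hn', ← h.mat_bendRight, ← h.mat_bendLeft]
  exact h1

theorem isWeyl_of_ne_zero {n : ℕ} (hn : ∀ m ≤ n, qn q (m + 1) ≠ 0) : IsWeyl q n := by
  induction n with
  | zero => exact isWeyl_zero (hn 0 le_rfl)
  | succ n ih =>
    exact (ih fun m hm => hn m (hm.trans n.le_succ)).succ (hn n n.le_succ) (hn (n + 1) le_rfl)

end WeylModules

/-! ### Weights and homomorphisms of Weyl modules -/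

section Weights

open Corep
open scoped Kronecker

variable {k : Type} [Field k]

/-- The weights `q^(n - 2 i)` of the Weyl module. -/
def weylK (q : kˣ) (n : ℕ) : Matrix (Fin (n + 1)) (Fin (n + 1)) k :=
  Matrix.diagonal fun i => (q : k) ^ (n - i : ℕ) * ((q⁻¹ : kˣ) : k) ^ (i : ℕ)

/-- The inverses of the weights of the Weyl module. -/
def weylKinv (q : kˣ) (n : ℕ) : Matrix (Fin (n + 1)) (Fin (n + 1)) k :=
  Matrix.diagonal fun i => ((q⁻¹ : kˣ) : k) ^ (n - i : ℕ) * (q : k) ^ (i : ℕ)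

/-- The lowering operator of the Weyl module. -/
def weylF (q : kˣ) (n : ℕ) : Matrix (Fin (n + 1)) (Fin (n + 1)) k :=
  Matrix.of fun i j => if (j : ℕ) + 1 = i then qn q i else 0

theorem qn_succ (q : kˣ) (hq : (q : k) - ((q⁻¹ : kˣ) : k) ≠ 0) (n : ℕ) :
    qn q (n + 1) = (q : k) * qn q n + ((q⁻¹ : kˣ) : k) ^ n := by
  rw [qn_add, pow_one, show qn q 1 = 1 by rw [qn, pow_one, pow_one, div_self hq], mul_one]

theorem fund_Kmat (q : kˣ) :
    (fund q).Kmat = (Matrix.diagonal ![(q : k), ((q⁻¹ : kˣ) : k)] : Matrix (Fin 2) (Fin 2) k) := by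
  ext i j
  refine (torus_gen i j).trans ?_
  fin_cases i <;> fin_cases j <;> simp

theorem fund_Kinv (q : kˣ) :
    (fund q).Kinv = (Matrix.diagonal ![((q⁻¹ : kˣ) : k), (q : k)] : Matrix (Fin 2) (Fin 2) k) := by
  ext i j
  refine (torusInv_gen i j).trans ?_
  fin_cases i <;> fin_cases j <;> simp

theorem fund_Fmat (q : kˣ) : (fund q).Fmat = (!![0, 0; 1, 0] : Matrix (Fin 2) (Fin 2) k) := by
  ext i j
  refine (lowering_gen i j).trans ?_
  fin_cases i <;> fin_cases j <;> simp

theorem weylK_mul_incl (q : kˣ) (n : ℕ) :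
    (weylK q n ⊗ₖ (Matrix.diagonal ![(q : k), ((q⁻¹ : kˣ) : k)] : Matrix (Fin 2) (Fin 2) k)) *
      weylIncl q n = weylIncl q n * weylK q (n + 1) := by
  rw [weylK, weylK, Matrix.diagonal_kronecker_diagonal]
  ext ⟨i, ε⟩ j
  rw [Matrix.diagonal_mul, Matrix.mul_diagonal]
  fin_cases ε <;> simp only [weylIncl, Matrix.of_apply, Fin.zero_eta, Fin.mk_one,
    Matrix.cons_val_zero, Matrix.cons_val_one] <;> split_ifs with hj
  · subst hj
    rw [Fin.val_castSucc, Nat.succ_sub (Nat.lt_succ_iff.1 i.2), pow_succ]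
    ring
  · rw [mul_zero, zero_mul]
  · subst hj
    rw [Fin.val_succ, Nat.add_sub_add_right, pow_succ]
    ring
  · rw [mul_zero, zero_mul]

theorem weylKinv_mul_incl (q : kˣ) (n : ℕ) :
    (weylKinv q n ⊗ₖ (Matrix.diagonal ![((q⁻¹ : kˣ) : k), (q : k)] : Matrix (Fin 2) (Fin 2) k)) *
      weylIncl q n = weylIncl q n * weylKinv q (n + 1) := by
  rw [weylKinv, weylKinv, Matrix.diagonal_kronecker_diagonal]
  ext ⟨i, ε⟩ j
  rw [Matrix.diagonal_mul, Matrix.mul_diagonal]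
  fin_cases ε <;> simp only [weylIncl, Matrix.of_apply, Fin.zero_eta, Fin.mk_one,
    Matrix.cons_val_zero, Matrix.cons_val_one] <;> split_ifs with hj
  · subst hj
    rw [Fin.val_castSucc, Nat.succ_sub (Nat.lt_succ_iff.1 i.2), pow_succ]
    ring
  · rw [mul_zero, zero_mul]
  · subst hj
    rw [Fin.val_succ, Nat.add_sub_add_right, pow_succ]
    ring
  · rw [mul_zero, zero_mul]

theorem weylF_mul_incl (q : kˣ) (hq : (q : k) - ((q⁻¹ : kˣ) : k) ≠ 0) (n : ℕ) :
    (weylF q n ⊗ₖ (1 : Matrix (Fin 2) (Fin 2) k) + weylK q n ⊗ₖ !![0, 0; 1, 0]) * weylIncl q n =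
        weylIncl q n * weylF q (n + 1) := by
  rw [weylK]
  ext ⟨i, ε⟩ j
  rw [Matrix.add_mul, Matrix.add_apply, Matrix.mul_apply, Matrix.mul_apply, Matrix.mul_apply,
    Fintype.sum_prod_type, Fintype.sum_prod_type]
  fin_cases ε <;>
  simp [weylIncl, weylF, Matrix.one_apply, Matrix.diagonal_apply]
  · have h1 : ∑ x : Fin (n + 2), (if (j : ℕ) + 1 = x then if i.castSucc = x then qn q x else 0
        else 0) = if (j : ℕ) + 1 = i then qn q i else 0 := by
      rw [Finset.sum_eq_single i.castSucc (fun x _ hx => by rw [if_neg hx.symm, ite_self])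
        (fun h => absurd (Finset.mem_univ _) h)]
      simp
    rw [h1]
    split_ifs with hj
    · rw [Finset.sum_eq_single ⟨j, by omega⟩ (fun x _ hx => ?_)
        (fun h => absurd (Finset.mem_univ _) h)]
      · simp [hj]
      · have h2 : x.castSucc ≠ j := by
          rintro rfl
          exact hx rfl
        rw [if_neg h2, ite_self]
    · refine Finset.sum_eq_zero fun x _ => ?_
      split_ifs with h2 h3
      · subst h3; exact absurd h2 hj
      · rfl
      · rfl
  · have h1 : ∑ x : Fin (n + 2), (if (j : ℕ) + 1 = x then if i.succ = x then
        (q : k) ^ (n - i : ℕ) * qn q x else 0 else 0) =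
          if i.castSucc = j then (q : k) ^ (n - i : ℕ) * qn q (i + 1) else 0 := by
      rw [Finset.sum_eq_single i.succ (fun x _ hx => by rw [if_neg hx.symm, ite_self])
        (fun h => absurd (Finset.mem_univ _) h)]
      simp [Fin.ext_iff, eq_comm]
    rw [h1]
    split_ifs with hj
    · subst hj
      have h2 := sum_succ (n := n) (fun m => qn q m * (q : k) ^ (n + 1 - m)) (by simp [qn_zero])
        i.castSucc
      have h3 : ∑ x : Fin (n + 1), (if (x : ℕ) + 1 = i then if x.succ = i.castSucc then
          qn q i * (q : k) ^ (n - x : ℕ) else 0 else 0) =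
            qn q i * (q : k) ^ (n + 1 - i : ℕ) := by
        refine Eq.trans (Finset.sum_congr rfl fun x _ => ?_) h2
        by_cases h4 : x.succ = i.castSucc
        · have h5 : (x : ℕ) + 1 = i := congrArg Fin.val h4
          rw [if_pos h5, if_pos h4, if_pos h4, ← h5, Nat.add_sub_add_right]
        · rw [if_neg h4, if_neg h4, ite_self]
      rw [h3, Nat.succ_sub (Nat.lt_succ_iff.1 i.2), pow_succ, qn_succ q hq]
      simp
      ring
    · rw [add_zero]
      refine Finset.sum_eq_zero fun x _ => ?_
      split_ifs with h2 h3
      · exact absurd (by ext; simp [← h3, h2]) hj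
      · rfl
      · rfl

theorem map_weylM_zero {q : kˣ} : (weylM q 0).map (torus q) = weylK q 0 ∧
    (weylM q 0).map (torusInv q) = weylKinv q 0 ∧ (weylM q 0).map (lowering q) = weylF q 0 := by
  have h : ∀ x : Fin (0 + 1), x = 0 := fun x => Subsingleton.elim (α := Fin 1) x 0
  refine ⟨?_, ?_, ?_⟩ <;> ext i j <;> rw [h i, h j]
  · simp [weylM, weylK]
  · simp [weylM, weylKinv]
  · simp [weylM, weylF, lowering_one]

/-- The action of `K`, `K⁻¹` and `F` on the Weyl modules. -/
theorem map_weylM {q : kˣ} (hq : (q : k) - ((q⁻¹ : kˣ) : k) ≠ 0) {n : ℕ}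
    (hn : ∀ m ≤ n, qn q (m + 1) ≠ 0) : (weylM q (n + 1)).map (torus q) = weylK q (n + 1) ∧
      (weylM q (n + 1)).map (torusInv q) = weylKinv q (n + 1) ∧
        (weylM q (n + 1)).map (lowering q) = weylF q (n + 1) := by
  have step : ∀ {n : ℕ}, IsWeyl q n → qn q (n + 1) ≠ 0 → ((weylM q n).map (torus q) = weylK q n ∧
      (weylM q n).map (torusInv q) = weylKinv q n ∧ (weylM q n).map (lowering q) = weylF q n) →
      (weylM q (n + 1)).map (torus q) = weylK q (n + 1) ∧
      (weylM q (n + 1)).map (torusInv q) = weylKinv q (n + 1) ∧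
        (weylM q (n + 1)).map (lowering q) = weylF q (n + 1) := by
    rintro n hW hn ⟨h1, h2, h3⟩
    have hπ := weylProj_mul_weylIncl hn
    -- The actions on the tensor product determine those on its summand.
    have key : ∀ {A : Matrix (Fin (n + 1) × Fin 2) (Fin (n + 1) × Fin 2) k}
        {B C : Matrix (Fin (n + 2)) (Fin (n + 2)) k}, A * weylIncl q n = weylIncl q n * B →
        A * weylIncl q n = weylIncl q n * C → B = C := by
      intro A B C hB hC
      have := congrArg (fun T => weylProj q n * T) (hB.symm.trans hC)
      simpa only [← Matrix.mul_assoc, hπ, Matrix.one_mul] using this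
    have e1 : hW.obj.Kmat = weylK q n := h1
    have e2 : hW.obj.Kinv = weylKinv q n := h2
    have e3 : hW.obj.Fmat = weylF q n := h3
    refine ⟨key (Kmat_mul_mat hW.inclHom) ?_, key (Kinv_mul_mat hW.inclHom) ?_,
      key (Fmat_mul_mat hW.inclHom) ?_⟩
    · rw [Kmat_tensor, e1, fund_Kmat]
      exact weylK_mul_incl q n
    · rw [Kinv_tensor, e2, fund_Kinv]
      exact weylKinv_mul_incl q n
    · rw [Fmat_tensor, e1, e3, fund_Fmat]
      exact weylF_mul_incl q hq n
  induction n with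
  | zero => exact step (isWeyl_of_ne_zero hn) (hn 0 le_rfl) map_weylM_zero
  | succ n ih =>
    exact step (isWeyl_of_ne_zero hn) (hn (n + 1) le_rfl) (ih fun m hm => hn m (hm.trans n.le_succ))

/-- A homomorphism of Weyl modules, as a matrix that commutes with the action of `K` and of `F`, is
diagonal with equal entries, and it vanishes if the highest weights are different. -/
theorem weylHom_entries {q : kˣ} (hq : IsPrimitiveRoot (q : k) 16)
    (hqn : ∀ m, 1 ≤ m → m ≤ 7 → qn q m ≠ 0) {m n : ℕ} (hm : m ≤ 7) (hn : n ≤ 7)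
    {T : Matrix (Fin (n + 1)) (Fin (m + 1)) k} (hK : weylK q n * T = T * weylK q m)
    (hF : weylF q n * T = T * weylF q m) :
    (∀ i j, T i j ≠ 0 → (i : ℕ) = j ∧ m = n) ∧
      ∀ (i : ℕ) (hi : i < n + 1) (hj : i < m + 1), T ⟨i, hi⟩ ⟨i, hj⟩ = T 0 0 := by
  -- The entries of the relation `F T = T F`, inside the matrix, in the first row, and in the last
  -- column.
  have hF1 : ∀ (i j : ℕ) (hi : i + 1 < n + 1) (hj : j + 1 < m + 1),
      qn q (i + 1) * T ⟨i, by omega⟩ ⟨j, by omega⟩ = T ⟨i + 1, hi⟩ ⟨j + 1, hj⟩ * qn q (j + 1) := by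
    intro i j hi hj
    have h := congrFun (congrFun hF ⟨i + 1, hi⟩) ⟨j, by omega⟩
    rw [Matrix.mul_apply, Matrix.mul_apply, Finset.sum_eq_single ⟨i, by omega⟩,
      Finset.sum_eq_single ⟨j + 1, hj⟩] at h
    · simpa [weylF] using h
    · intro b _ hb
      rw [weylF, Matrix.of_apply, if_neg (fun h0 => hb (Fin.ext h0.symm)), mul_zero]
    · exact fun h0 => absurd (Finset.mem_univ _) h0
    · intro b _ hb
      rw [weylF, Matrix.of_apply, if_neg (fun h0 => hb (Fin.ext (Nat.succ_injective h0))), zero_mul]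
    · exact fun h0 => absurd (Finset.mem_univ _) h0
  have hF2 : ∀ (j : ℕ) (hj : j + 1 < m + 1), T ⟨0, n.succ_pos⟩ ⟨j + 1, hj⟩ = 0 := by
    intro j hj
    have h := congrFun (congrFun hF ⟨0, n.succ_pos⟩) ⟨j, by omega⟩
    rw [Matrix.mul_apply, Matrix.mul_apply, Finset.sum_eq_zero,
      Finset.sum_eq_single ⟨j + 1, hj⟩] at h
    · have h1 := hqn (j + 1) (by omega) (by omega)
      simpa [weylF, h1] using h.symm
    · intro b _ hb
      rw [weylF, Matrix.of_apply, if_neg (fun h0 => hb (Fin.ext h0.symm)), mul_zero]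
    · exact fun h0 => absurd (Finset.mem_univ _) h0
    · intro b _
      rw [weylF, Matrix.of_apply, if_neg (Nat.succ_ne_zero _), zero_mul]
  have hF3 : ∀ (i : ℕ) (hi : i + 1 < n + 1), T ⟨i, by omega⟩ ⟨m, m.lt_succ_self⟩ = 0 := by
    intro i hi
    have h := congrFun (congrFun hF ⟨i + 1, hi⟩) ⟨m, m.lt_succ_self⟩
    rw [Matrix.mul_apply, Matrix.mul_apply, Finset.sum_eq_single ⟨i, by omega⟩,
      Finset.sum_eq_zero] at h
    · have h1 := hqn (i + 1) (by omega) (by omega)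
      simpa [weylF, h1] using h
    · intro b _
      rw [weylF, Matrix.of_apply, if_neg (fun h0 => absurd b.2 (by simp at h0; omega)), mul_zero]
    · intro b _ hb
      rw [weylF, Matrix.of_apply, if_neg (fun h0 => hb (Fin.ext (Nat.succ_injective h0))), zero_mul]
    · exact fun h0 => absurd (Finset.mem_univ _) h0
  -- Hence it vanishes above the main diagonal, and above the diagonal through the lower right
  -- corner.
  have h1 : ∀ (i j : ℕ) (hi : i < n + 1) (hj : j < m + 1), i < j → T ⟨i, hi⟩ ⟨j, hj⟩ = 0 := by
    intro i
    induction i with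
    | zero =>
      intro j hi hj hij
      obtain ⟨j, rfl⟩ := Nat.exists_eq_succ_of_ne_zero hij.ne'
      exact hF2 j hj
    | succ i ih =>
      intro j hi hj hij
      obtain ⟨j, rfl⟩ := Nat.exists_eq_succ_of_ne_zero (Nat.ne_zero_of_lt hij)
      have h := hF1 i j hi hj
      rw [ih j _ _ (Nat.lt_of_succ_lt_succ hij), mul_zero] at h
      exact (mul_eq_zero.1 h.symm).resolve_right (hqn (j + 1) (by omega) (by omega))
  have h2 : ∀ (d i j : ℕ) (hi : i < n + 1) (hj : j < m + 1), j + d = m → m + i < n + j →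
      T ⟨i, hi⟩ ⟨j, hj⟩ = 0 := by
    intro d
    induction d with
    | zero =>
      intro i j hi hj hd hij
      obtain rfl : j = m := hd
      exact hF3 i (by omega)
    | succ d ih =>
      intro i j hi hj hd hij
      have h := hF1 i j (by omega) (by omega)
      rw [ih (i + 1) (j + 1) _ _ (by omega) (by omega), zero_mul] at h
      exact (mul_eq_zero.1 h).resolve_left (hqn (i + 1) (by omega) (by omega))
  -- It also preserves weights, and these are distinct since `m, n ≤ 7` and `q` has order `16`.
  have h3 : ∀ (i j : ℕ) (hi : i < n + 1) (hj : j < m + 1), T ⟨i, hi⟩ ⟨j, hj⟩ ≠ 0 →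
      n + 2 * j = m + 2 * i := by
    intro i j hi hj hT
    have h := congrFun (congrFun hK ⟨i, hi⟩) ⟨j, hj⟩
    rw [weylK, weylK, Matrix.diagonal_mul, Matrix.mul_diagonal, mul_comm] at h
    have h4 := mul_left_cancel₀ hT h
    have h5 : (q : k) ^ ((n - i) + j) = (q : k) ^ ((m - j) + i) := by
      have hi1 : (q : k) ^ i * ((q⁻¹ : kˣ) : k) ^ i = 1 := by rw [← mul_pow]; simp
      have hj1 : (q : k) ^ j * ((q⁻¹ : kˣ) : k) ^ j = 1 := by rw [← mul_pow]; simp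
      rw [pow_add, pow_add]
      linear_combination (q : k) ^ i * (q : k) ^ j * h4 - (q : k) ^ (n - i) * (q : k) ^ j * hi1
        + (q : k) ^ (m - j) * (q : k) ^ i * hj1
    have := hq.pow_inj (by omega) (by omega) h5
    omega
  refine ⟨fun i j hT => ?_, fun i => ?_⟩
  · have h4 := h3 i j i.2 j.2 hT
    have h5 : ¬ (i : ℕ) < j := fun h => hT (h1 i j i.2 j.2 h)
    have h6 : ¬ m + i < n + j := fun h => hT (h2 (m - j) i j i.2 j.2 (by omega) h)
    omega
  · induction i with
    | zero => exact fun _ _ => rfl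
    | succ i ih =>
      intro hi hj
      rw [← ih (by omega) (by omega)]
      have h := hF1 i i hi hj
      rw [mul_comm] at h
      exact (mul_right_cancel₀ (hqn (i + 1) (by omega) (by omega)) h).symm

variable {q : kˣ}

theorem sub_inv_ne_zero (hq : IsPrimitiveRoot (q : k) 16) : (q : k) - ((q⁻¹ : kˣ) : k) ≠ 0 := by
  intro h
  have h1 : (q : k) ^ 2 = 1 := by
    have h2 : (q : k) * ((q⁻¹ : kˣ) : k) = 1 := by simp
    linear_combination (q : k) * h + h2
  exact absurd (hq.pow_eq_one_iff_dvd 2 |>.1 h1) (by norm_num)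

/-- At a primitive root of order `16` the first quantum integer that vanishes is `[8]`. -/
theorem qn_ne_zero (hq : IsPrimitiveRoot (q : k) 16) (m : ℕ) (h1 : 1 ≤ m) (h7 : m ≤ 7) :
    qn q m ≠ 0 := by
  intro h
  have h2 : (q : k) ^ m - ((q⁻¹ : kˣ) : k) ^ m = 0 :=
    (div_eq_zero_iff.1 h).resolve_right (sub_inv_ne_zero hq)
  have h3 : (q : k) ^ (m + m) = 1 := by
    have h4 : (q : k) ^ m * ((q⁻¹ : kˣ) : k) ^ m = 1 := by rw [← mul_pow]; simp
    rw [pow_add]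
    linear_combination (q : k) ^ m * h2 + h4
  have := hq.pow_eq_one_iff_dvd _ |>.1 h3
  omega

theorem isWeyl (hq : IsPrimitiveRoot (q : k) 16) {n : ℕ} (hn : n + 1 ≤ 7) : IsWeyl q n :=
  isWeyl_of_ne_zero fun m hm => qn_ne_zero hq (m + 1) (by omega) (by omega)

theorem isCoaction_weylM (hq : IsPrimitiveRoot (q : k) 16) {n : ℕ} (hn : n ≤ 7) :
    IsCoaction (weylM q n) := by
  cases n with
  | zero => exact isCoaction_zero
  | succ n => exact (isWeyl hq hn).coaction_succ

/-- The Weyl module with highest weight `n ≤ 7`. -/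
abbrev weyl (hq : IsPrimitiveRoot (q : k) 16) {n : ℕ} (hn : n ≤ 7) : Corep q :=
  (isCoaction_weylM hq hn).corep

theorem weyl_actions (hq : IsPrimitiveRoot (q : k) 16) {n : ℕ} (hn : n ≤ 7) :
    (weyl hq hn).Kmat = weylK q n ∧ (weyl hq hn).Kinv = weylKinv q n ∧
      (weyl hq hn).Fmat = weylF q n := by
  cases n with
  | zero => exact map_weylM_zero
  | succ n =>
    exact map_weylM (sub_inv_ne_zero hq) fun m hm => qn_ne_zero hq (m + 1) (by omega) (by omega)

/-- Schur's lemma for Weyl modules with different highest weights. -/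
theorem weyl_hom_eq_zero (hq : IsPrimitiveRoot (q : k) 16) {m n : ℕ} (hm : m ≤ 7) (hn : n ≤ 7)
    (hmn : m ≠ n) (f : weyl hq hm ⟶ weyl hq hn) : f = 0 := by
  have hK := Kmat_mul_mat f
  have hF := Fmat_mul_mat f
  rw [(weyl_actions hq hm).1, (weyl_actions hq hn).1] at hK
  rw [(weyl_actions hq hm).2.2, (weyl_actions hq hn).2.2] at hF
  have h := (weylHom_entries hq (qn_ne_zero hq) hm hn hK hF).1
  refine hom_ext (Matrix.ext fun i j => ?_)
  by_contra h0
  exact hmn (h i j h0).2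

/-- Schur's lemma for endomorphisms of a Weyl module. -/
theorem weyl_end_eq_smul (hq : IsPrimitiveRoot (q : k) 16) {n : ℕ} (hn : n ≤ 7)
    (f : weyl hq hn ⟶ weyl hq hn) : ∃ c : k, f = c • 𝟙 _ := by
  have hK := Kmat_mul_mat f
  have hF := Fmat_mul_mat f
  rw [(weyl_actions hq hn).1] at hK
  rw [(weyl_actions hq hn).2.2] at hF
  obtain ⟨h1, h2⟩ := weylHom_entries hq (qn_ne_zero hq) hn hn hK hF
  have key : ∀ i j : Fin (n + 1), mat f i j =
      mat f (0 : Fin (n + 1)) (0 : Fin (n + 1)) *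
        (1 : Matrix (Fin (n + 1)) (Fin (n + 1)) k) i j := by
    intro i j
    by_cases hij : i = j
    · subst hij
      rw [Matrix.one_apply_eq, mul_one]
      exact h2 i i.2 i.2
    · rw [Matrix.one_apply_ne hij, mul_zero]
      by_contra h0
      exact hij (Fin.ext (h1 i j h0).1)
  exact ⟨_, hom_ext (Matrix.ext key)⟩

end Weights

/-! ### Weyl modules as tilting modules and as objects of the Verlinde category -/

section Standard

open Corep

variable {k : Type} [Field k] {q : kˣ} (hq : IsPrimitiveRoot (q : k) 16)

/-- The Weyl module of highest weight zero is the trivial representation. -/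
def weylZeroIso : weyl hq (Nat.zero_le 7) ≅ 𝟙_ (Corep q) :=
  isoOfEquiv (X := weyl hq (Nat.zero_le 7)) (Y := unit q) (Equiv.ofUnique (Fin 1) Unit)
      fun i j => by
    have h : i = j := Subsingleton.elim (α := Fin 1) i j
    subst h
    exact (Matrix.one_apply_eq _).trans (Matrix.one_apply_eq (α := Oq q) _).symm

theorem weyl_retract {n : ℕ} (hn : n + 1 ≤ 7) :
    (isWeyl hq hn).inclHom ≫ (isWeyl hq hn).projHom = 𝟙 (weyl hq hn) :=
  hom_ext (weylProj_mul_weylIncl (qn_ne_zero hq (n + 1) (by omega) hn))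

theorem weylM_one (h : qn q 1 ≠ 0) : weylM q 1 = Matrix.of (gen q) := by
  have h1 : ∀ x : Fin (0 + 1), x = 0 := fun x => Subsingleton.elim (α := Fin 1) x 0
  ext i j
  rw [weylM, weylM, Matrix.mul_apply]
  simp only [Matrix.mul_apply, Fintype.sum_prod_type, Fin.sum_univ_two]
  fin_cases i <;> fin_cases j <;> simp [weylProj, weylIncl, h]

/-- The fundamental representation is the Weyl module of highest weight one. -/
def weylOneIso : weyl hq (show 1 ≤ 7 by norm_num) ≅ fund q :=
  isoOfEquiv (X := weyl hq (show 1 ≤ 7 by norm_num)) (Y := fund q) (Equiv.refl (Fin 2)) fun i j =>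
    (congrFun (congrFun (weylM_one (qn_ne_zero hq 1 le_rfl (by norm_num))) i) j).symm

theorem weyl_tilting {n : ℕ} (hn : n ≤ 7) :
    tensorClosure (fun X => X = fund q) (weyl hq hn) := by
  induction n with
  | zero => exact tensorClosure.unit.iso (weylZeroIso hq)
  | succ n ih => exact ((ih (by omega)).tensor _ _ (.of _ rfl)).retract _ _ (weyl_retract hq hn)

/-- The tensor product of a Weyl module and the fundamental representation is a direct sum of two
Weyl modules. -/
theorem weyl_tensor_fund {n : ℕ} (hn : n + 2 ≤ 7) :
    ∃ (i : weyl hq (show n ≤ 7 by omega) ⟶ weyl hq (show n + 1 ≤ 7 by omega) ⊗ fund q)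
      (p : weyl hq (show n + 1 ≤ 7 by omega) ⊗ fund q ⟶ weyl hq (show n ≤ 7 by omega))
      (j : weyl hq hn ⟶ weyl hq (show n + 1 ≤ 7 by omega) ⊗ fund q)
      (r : weyl hq (show n + 1 ≤ 7 by omega) ⊗ fund q ⟶ weyl hq hn),
      i ≫ p = 𝟙 _ ∧ j ≫ r = 𝟙 _ ∧ i ≫ r = 0 ∧ j ≫ p = 0 ∧ p ≫ i + r ≫ j = 𝟙 _ := by
  have h1 := qn_ne_zero hq (n + 1) (by omega) (by omega)
  have h2 := qn_ne_zero hq (n + 2) (by omega) (by omega)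
  let h := isWeyl hq (show n + 1 ≤ 7 by omega)
  refine ⟨bendRight h.projHom, -(qn q (n + 1) / qn q (n + 2)) • bendLeft h.inclHom,
    (isWeyl hq hn).inclHom, (isWeyl hq hn).projHom, hom_ext ?_, weyl_retract hq hn,
    weyl_hom_eq_zero hq _ _ (by omega) _, weyl_hom_eq_zero hq _ _ (by omega) _, hom_ext ?_⟩
  · have key : (-(qn q (n + 1) / qn q (n + 2)) • weylProj' q n) * weylIncl' q n = 1 := by
      rw [Matrix.smul_mul, weylProj'_mul_weylIncl' h1, smul_smul, neg_mul_neg,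
        div_mul_div_cancel₀ h2, div_self h1, one_smul]
    rw [mat_comp, mat_smul, h.mat_bendRight, h.mat_bendLeft]
    exact key
  · have key : weylIncl' q n * (-(qn q (n + 1) / qn q (n + 2)) • weylProj' q n) +
        weylIncl q (n + 1) * weylProj q (n + 1) = 1 := by
      rw [weylIncl_mul_weylProj h1 h2, Matrix.mul_smul, neg_smul]
      abel
    rw [mat_add, mat_comp, mat_smul, h.mat_bendRight, h.mat_bendLeft]
    exact key

/-- The Weyl module of highest weight `n ≤ 7` as a tilting module. -/
def weylT {n : ℕ} (hn : n ≤ 7) : Tilting q := ⟨weyl hq hn, weyl_tilting hq hn⟩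

theorem weylT_end {n : ℕ} (hn : n ≤ 7) (f : weylT hq hn ⟶ weylT hq hn) : ∃ c : k, f = c • 𝟙 _ := by
  obtain ⟨c, hc⟩ := weyl_end_eq_smul hq hn f.hom
  exact ⟨c, ObjectProperty.hom_ext _ hc⟩

theorem weylT_hom_eq_zero {m n : ℕ} (hm : m ≤ 7) (hn : n ≤ 7) (hmn : m ≠ n)
    (f : weylT hq hm ⟶ weylT hq hn) : f = 0 :=
  ObjectProperty.hom_ext _ (weyl_hom_eq_zero hq hm hn hmn f.hom)

/-- The quantum dimension of a Weyl module is a quantum integer. -/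
theorem trace_weylK (q : kˣ) (hq : (q : k) - ((q⁻¹ : kˣ) : k) ≠ 0) (n : ℕ) :
    (weylK q n).trace = qn q (n + 1) := by
  rw [weylK, Matrix.trace_diagonal, Fin.sum_univ_eq_sum_range
    (fun i => (q : k) ^ (n - i) * ((q⁻¹ : kˣ) : k) ^ i) (n + 1)]
  induction n with
  | zero =>
    exact (by simp : _ = (1 : k)).trans (div_self (by simpa using hq)).symm |>.trans (by simp [qn])
  | succ n ih =>
    rw [Finset.sum_range_succ, qn_succ q hq (n + 1), ← ih, Nat.sub_self, pow_zero, one_mul,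
      Finset.mul_sum]
    congr 1
    refine Finset.sum_congr rfl fun i hi => ?_
    rw [Nat.succ_sub (Nat.lt_succ_iff.1 (Finset.mem_range.1 hi)), pow_succ]
    ring

theorem trace_weylKinv (q : kˣ) (hq : (q : k) - ((q⁻¹ : kˣ) : k) ≠ 0) (n : ℕ) :
    (weylKinv q n).trace = qn q (n + 1) := by
  rw [← trace_weylK q hq n, weylK, weylKinv, Matrix.trace_diagonal, Matrix.trace_diagonal,
    ← Equiv.sum_comp Fin.revPerm]
  refine Finset.sum_congr rfl fun i _ => ?_
  have h1 : n - ((Fin.revPerm i : Fin (n + 1)) : ℕ) = i := by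
    rw [Fin.revPerm_apply, Fin.val_rev]; omega
  have h2 : ((Fin.revPerm i : Fin (n + 1)) : ℕ) = n - i := by
    rw [Fin.revPerm_apply, Fin.val_rev]; omega
  rw [h1, h2, mul_comm]

theorem qn_eight (hq : IsPrimitiveRoot (q : k) 16) : qn q 8 = 0 := by
  have h1 : (q : k) ^ 16 = 1 := hq.pow_eq_one
  have h2 : (q : k) ^ 8 * ((q⁻¹ : kˣ) : k) ^ 8 = 1 := by rw [← mul_pow]; simp
  have h3 : (q : k) ^ 8 - ((q⁻¹ : kˣ) : k) ^ 8 = 0 := by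
    linear_combination ((q⁻¹ : kˣ) : k) ^ 8 * h1 - (q : k) ^ 8 * h2
  rw [qn, h3, zero_div]

/-- The Weyl module of highest weight `n ≤ 7` as an object of the Verlinde category. -/
def vObj {n : ℕ} (hn : n ≤ 7) : VerlindeCat q := ⟨weylT hq hn⟩

theorem vObj_end {n : ℕ} (hn : n ≤ 7) (f : vObj hq hn ⟶ vObj hq hn) : ∃ c : k, f = c • 𝟙 _ := by
  obtain ⟨f, rfl⟩ := NegligibleQuotient.proj_surjective f
  obtain ⟨c, rfl⟩ := weylT_end hq hn f
  exact ⟨c, rfl⟩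

theorem vObj_hom_eq_zero {m n : ℕ} (hm : m ≤ 7) (hn : n ≤ 7) (hmn : m ≠ n)
    (f : vObj hq hm ⟶ vObj hq hn) : f = 0 := by
  obtain ⟨f, rfl⟩ := NegligibleQuotient.proj_surjective f
  rw [weylT_hom_eq_zero hq hm hn hmn f]
  rfl

theorem vObj_qdim {n : ℕ} (hn : n ≤ 7) : (vObj hq hn).qdim = qn q (n + 1) := by
  refine Eq.trans ?_ (trace_weylK q (sub_inv_ne_zero hq) n)
  rw [← (weyl_actions hq hn).1]
  rfl

/-- For `n ≤ 6` the object `V_n` is not zero, since its quantum dimension `[n + 1]` is not. -/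
theorem vObj_id_ne_zero {n : ℕ} (hn : n ≤ 7) (hn' : n ≤ 6) : 𝟙 (vObj hq hn) ≠ 0 := by
  intro h
  have h1 := (trace_eq_zero_of_negligible (NegligibleQuotient.proj_eq_zero.1 h)).2
  have h2 : (vObj hq hn).qdim = 0 := by
    refine Eq.trans ?_ h1
    exact congrArg Matrix.trace (Matrix.one_mul (weyl hq hn).Kmat).symm
  exact qn_ne_zero hq (n + 1) (by omega) (by omega) ((vObj_qdim hq hn).symm.trans h2)

/-- The Weyl module of highest weight `7` is negligible, as its quantum dimension vanishes. -/
theorem vObj_seven {s : kˣ} (hs : (q : k) = s ^ 2) : 𝟙 (vObj hq le_rfl) = 0 := by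
  refine NegligibleQuotient.proj_eq_zero.2 (negligible_of_trace_eq_zero hs (weylT_end hq le_rfl) ?_)
  refine (congrArg Matrix.trace (weyl_actions hq le_rfl).2.1).trans ?_
  exact (trace_weylKinv q (sub_inv_ne_zero hq) 7).trans (qn_eight hq)

/-- The object `V_0` is the unit. -/
def vObjZeroIso : vObj hq (Nat.zero_le 7) ≅ 𝟙_ (VerlindeCat q) :=
  NegligibleQuotient.projIso (ObjectProperty.isoMk _ (weylZeroIso hq))

/-- The object `V_1` is the fundamental representation. -/
def vObjOneIso : vObj hq (show 1 ≤ 7 by norm_num) ≅ VerlindeCat.fund q :=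
  NegligibleQuotient.projIso (ObjectProperty.isoMk _ (weylOneIso hq))

theorem vObj_retract {n : ℕ} (hn : n + 1 ≤ 7) :
    ∃ (i : vObj hq hn ⟶ vObj hq (n.le_succ.trans hn) ⊗ VerlindeCat.fund q)
      (p : vObj hq (n.le_succ.trans hn) ⊗ VerlindeCat.fund q ⟶ vObj hq hn), i ≫ p = 𝟙 _ := by
  let fT : Tilting q := ⟨Corep.fund q, tensorClosure.of _ rfl⟩
  let i : weylT hq hn ⟶ weylT hq (n.le_succ.trans hn) ⊗ fT :=
    ObjectProperty.homMk (isWeyl hq hn).inclHom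
  let p : weylT hq (n.le_succ.trans hn) ⊗ fT ⟶ weylT hq hn :=
    ObjectProperty.homMk (isWeyl hq hn).projHom
  exact ⟨NegligibleQuotient.proj i, NegligibleQuotient.proj p,
    congrArg (NegligibleQuotient.proj (k := k)) (ObjectProperty.hom_ext _ (weyl_retract hq hn))⟩

/-- The fusion rule `V_{n+1} ⊗ V_1 ≅ V_n ⊕ V_{n+2}`. -/
theorem vObj_tensor_fund {n : ℕ} (hn : n + 2 ≤ 7) :
    IsDirectSum ![vObj hq (show n ≤ 7 by omega), vObj hq hn]
      (vObj hq (show n + 1 ≤ 7 by omega) ⊗ VerlindeCat.fund q) := by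
  obtain ⟨i, p, j, r, h1, h2, h3, h4, h5⟩ := weyl_tensor_fund hq hn
  have key : ∀ {X Y : Tilting q} {f g : X ⟶ Y}, f.hom = g.hom →
      (NegligibleQuotient.proj f : (⟨X⟩ : VerlindeCat q) ⟶ ⟨Y⟩) = NegligibleQuotient.proj g :=
    fun h => congrArg _ (ObjectProperty.hom_ext _ h)
  let fT : Tilting q := ⟨Corep.fund q, tensorClosure.of _ rfl⟩
  let i' : weylT hq (show n ≤ 7 by omega) ⟶ weylT hq (show n + 1 ≤ 7 by omega) ⊗ fT :=
    ObjectProperty.homMk i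
  let p' : weylT hq (show n + 1 ≤ 7 by omega) ⊗ fT ⟶ weylT hq (show n ≤ 7 by omega) :=
    ObjectProperty.homMk p
  let j' : weylT hq hn ⟶ weylT hq (show n + 1 ≤ 7 by omega) ⊗ fT := ObjectProperty.homMk j
  let r' : weylT hq (show n + 1 ≤ 7 by omega) ⊗ fT ⟶ weylT hq hn := ObjectProperty.homMk r
  exact isDirectSum_pair (NegligibleQuotient.proj i') (NegligibleQuotient.proj p')
    (NegligibleQuotient.proj j') (NegligibleQuotient.proj r') (key (f := i' ≫ p') h1)
    (key (f := j' ≫ r') h2) (key (f := i' ≫ r') (g := 0) h3) (key (f := j' ≫ p') (g := 0) h4)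
    (key (f := p' ≫ i' + r' ≫ j') h5)

/-- The quantum dimension is invariant under isomorphisms of the Verlinde category. -/
theorem VerlindeCat.qdim_eq_of_iso {X Y : VerlindeCat q} (e : X ≅ Y) : X.qdim = Y.qdim := by
  have key : ∀ {X Y : Tilting q} (f : X ⟶ Y) (g : Y ⟶ X),
      NegligibleQuotient.proj (k := k) (f ≫ g) = NegligibleQuotient.proj (𝟙 X) →
      X.obj.qdim = (mat g.hom * mat f.hom * X.obj.Kmat).trace := by
    intro X Y f g h
    have h0 : f ≫ g - 𝟙 X ∈ negligible k X X := (Submodule.Quotient.eq _).1 h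
    have h1 := (trace_eq_zero_of_negligible h0).2
    have h2 : ((mat g.hom * mat f.hom - 1) * X.obj.Kmat).trace = 0 := h1
    rw [Matrix.sub_mul, Matrix.trace_sub, Matrix.one_mul, sub_eq_zero] at h2
    exact h2.symm
  obtain ⟨f, hf⟩ := NegligibleQuotient.proj_surjective e.hom
  obtain ⟨g, hg⟩ := NegligibleQuotient.proj_surjective e.inv
  have h1 := key f g (by
    rw [NegligibleQuotient.proj_comp, NegligibleQuotient.proj_id, hf, hg, e.hom_inv_id])
  have h2 := key g f (by
    rw [NegligibleQuotient.proj_comp, NegligibleQuotient.proj_id, hf, hg, e.inv_hom_id])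
  refine h1.trans (Eq.trans ?_ h2.symm)
  rw [Matrix.mul_assoc, ← Kmat_mul_mat f.hom, ← Matrix.mul_assoc, Matrix.trace_mul_cycle]

end Standard

/-! ### Simple families -/

section SimpleFamily

variable {C : Type u} [Category.{v} C] [Preadditive C]

theorem id_mem_factorThrough_of_retract {T : ObjectProperty C} {X Z : C} (i : Z ⟶ X) (p : X ⟶ Z)
    (h : i ≫ p = 𝟙 Z) (hX : 𝟙 X ∈ factorThrough T X X) : 𝟙 Z ∈ factorThrough T Z Z := by
  have := comp_mem_factorThrough i (factorThrough_comp_mem hX p)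
  rwa [Category.id_comp, h] at this

theorem IsDirectSum.of_iso {n : ℕ} {X : Fin n → C} {Z Z' : C} (h : IsDirectSum X Z) (e : Z ≅ Z') :
    IsDirectSum X Z' := by
  obtain ⟨i, p, h1, h2, h3⟩ := h
  refine ⟨fun a => i a ≫ e.hom, fun a => e.inv ≫ p a, fun a => by simp [h1],
    fun a b hab => by simp [h2 a b hab], ?_⟩
  have h4 : ∑ a, (e.inv ≫ p a) ≫ i a ≫ e.hom = e.inv ≫ (∑ a, p a ≫ i a) ≫ e.hom := by
    rw [Preadditive.sum_comp, Preadditive.comp_sum]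
    simp
  rw [h4, h3, Category.id_comp, Iso.inv_hom_id]

theorem IsDirectSum.fullSubcategory {P : ObjectProperty C} {n : ℕ} {X : Fin n → C}
    {Z : P.FullSubcategory} (hX : ∀ a, P (X a)) (h : IsDirectSum X Z.obj) :
    IsDirectSum (fun a => (⟨X a, hX a⟩ : P.FullSubcategory)) Z := by
  obtain ⟨i, p, h1, h2, h3⟩ := h
  refine ⟨fun a => ObjectProperty.homMk (i a), fun a => ObjectProperty.homMk (p a),
    fun a => ObjectProperty.hom_ext _ (h1 a), fun a b hab => ObjectProperty.hom_ext _ (h2 a b hab),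
    P.ι.map_injective ?_⟩
  rw [Functor.map_sum, P.ι.map_id]
  exact h3

variable {k : Type} [Field k] [Linear k C]

theorem smul_id_bijective {X : C} (h : ∀ f : X ⟶ X, ∃ c : k, f = c • 𝟙 X) (h0 : 𝟙 X ≠ 0) :
    Function.Bijective fun c : k => c • 𝟙 X := by
  refine ⟨fun c d hcd => ?_, fun f => ?_⟩
  · have h1 : (c - d) • 𝟙 X = 0 := by rw [sub_smul]; exact sub_eq_zero.2 hcd
    exact sub_eq_zero.1 ((smul_eq_zero.1 h1).resolve_right h0)
  · obtain ⟨c, hc⟩ := h f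
    exact ⟨c, hc.symm⟩

theorem exists_smul_id_of_iso {X Y : C} (e : X ≅ Y) (h : ∀ f : X ⟶ X, ∃ c : k, f = c • 𝟙 X)
    (f : Y ⟶ Y) : ∃ c : k, f = c • 𝟙 Y := by
  obtain ⟨c, hc⟩ := h (e.hom ≫ f ≫ e.inv)
  refine ⟨c, ?_⟩
  have := congrArg (fun g => e.inv ≫ g ≫ e.hom) hc
  simpa using this

theorem id_ne_zero_of_iso {X Y : C} (e : X ≅ Y) (h : 𝟙 X ≠ 0) : 𝟙 Y ≠ 0 := fun h0 => h (by
  have : 𝟙 X = e.hom ≫ 𝟙 Y ≫ e.inv := by simp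
  rw [this, h0, zero_comp, comp_zero])

/-- Schur's lemma. -/
theorem IsSimpleFamily.isIso {S : Set C} (h : IsSimpleFamily k S) {X Y : C} (hX : X ∈ S)
    (hY : Y ∈ S) {f : X ⟶ Y} (hf : f ≠ 0) : IsIso f := by
  by_cases hXY : X = Y
  · subst hXY
    obtain ⟨c, rfl⟩ := (h.end_bijective X hX).2 f
    have hc : c ≠ 0 := by rintro rfl; exact hf (zero_smul k _)
    exact ⟨c⁻¹ • 𝟙 X, by simp [smul_smul, inv_mul_cancel₀ hc],
      by simp [smul_smul, mul_inv_cancel₀ hc]⟩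
  · exact absurd (h.hom_eq_zero X hX Y hY hXY f) hf

theorem IsSimpleFamily.id_ne_zero {S : Set C} (h : IsSimpleFamily k S) {X : C} (hX : X ∈ S) :
    𝟙 X ≠ 0 := fun h0 => by
  have := (h.end_bijective X hX).1 (a₁ := 1) (a₂ := 0) (by simp [h0])
  exact one_ne_zero this

/-- The simple objects are the objects isomorphic to a member of a simple family. -/
theorem IsSimpleFamily.simple_iff {S : Set C} (h : IsSimpleFamily k S) (W : C) :
    Simple W ↔ ∃ X ∈ S, Nonempty (W ≅ X) := by
  constructor
  · intro hW
    obtain ⟨n, X, hX, i, p, h1, -, h3⟩ := h.exists_sum W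
    cases n with
    | zero => exact absurd (by simpa using h3.symm) (id_nonzero W)
    | succ n =>
      have : IsSplitMono (i 0) := ⟨⟨p 0, h1 0⟩⟩
      have h0 : i 0 ≠ 0 := fun h0 => h.id_ne_zero (hX 0) (by rw [← h1, h0, zero_comp])
      have := isIso_of_mono_of_nonzero h0
      exact ⟨_, hX 0, ⟨(asIso (i 0)).symm⟩⟩
  · rintro ⟨X, hX, ⟨e⟩⟩
    suffices Simple X from Simple.of_iso e
    refine ⟨fun {Y} f hf => ⟨fun hi h0 => ?_, fun h0 => ?_⟩⟩
    · refine h.id_ne_zero hX ?_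
      exact (IsIso.inv_hom_id f).symm.trans ((congrArg (inv f ≫ ·) h0).trans comp_zero)
    · obtain ⟨n, Z, hZ, i, p, -, -, h3⟩ := h.exists_sum Y
      have : ∃ a, i a ≫ f ≠ 0 := by
        by_contra! h4
        apply h0
        rw [← Category.id_comp f, ← h3, Preadditive.sum_comp]
        exact Finset.sum_eq_zero fun a _ => by rw [Category.assoc, h4, comp_zero]
      obtain ⟨a, ha⟩ := this
      have := h.isIso (hZ a) hX ha
      have : IsSplitEpi f := ⟨⟨inv (i a ≫ f) ≫ i a, by rw [Category.assoc, IsIso.inv_hom_id]⟩⟩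
      exact isIso_of_mono_of_isSplitEpi f

end SimpleFamily

/-! ### Semisimplicity of the Verlinde category -/

section Semisimple

open Corep

variable {k : Type} [Field k] {q : kˣ} (hq : IsPrimitiveRoot (q : k) 16)

/-- The objects `V_m` with `m ≤ 6` and `m ≡ n` modulo `2`. -/
def parityObj (n : ℕ) : ObjectProperty (VerlindeCat q) := fun X =>
  ∃ (m : ℕ) (hm : m ≤ 6), m % 2 = n % 2 ∧ X = vObj hq (show m ≤ 7 by omega)

/-- The objects `V_m` with `m ≤ 6`. -/
def simpleObj : ObjectProperty (VerlindeCat q) := fun X =>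
  ∃ (m : ℕ) (hm : m ≤ 6), X = vObj hq (show m ≤ 7 by omega)

theorem parityObj_congr {m n : ℕ} (h : m % 2 = n % 2) : parityObj hq m = parityObj hq n := by
  unfold parityObj
  rw [h]

variable {s : kˣ} (hs : (q : k) = s ^ 2)
include hs

/-- The objects `V_n` with `n ≤ 7` are sums of objects `V_m` with `m ≤ 6` of the same parity: for `n
= 7` the object is zero. -/
theorem vObj_mem {n : ℕ} (hn : n ≤ 7) : 𝟙 (vObj hq hn) ∈ factorThrough (parityObj hq n) _ _ := by
  by_cases h : n ≤ 6
  · exact id_mem_factorThrough ⟨n, h, rfl, rfl⟩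
  · obtain rfl : n = 7 := by omega
    rw [vObj_seven hq hs]
    exact zero_mem _

theorem vObj_tensor_fund_mem {n : ℕ} (hn : n ≤ 6) :
    𝟙 (vObj hq (show n ≤ 7 by omega) ⊗ VerlindeCat.fund q) ∈
      factorThrough (parityObj hq (n + 1)) _ _ := by
  cases n with
  | zero =>
    exact id_mem_factorThrough_of_iso (((vObjZeroIso hq) ▷ᵢ _) ≪≫ λ_ _ ≪≫ (vObjOneIso hq).symm)
      ⟨1, by norm_num, rfl, rfl⟩
  | succ n =>
    refine factorThrough_le (T := fun X => 𝟙 X ∈ factorThrough (parityObj hq (n + 1 + 1)) X X)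
      (fun _ h => h) _ _ ((vObj_tensor_fund hq (show n + 2 ≤ 7 by omega)).id_mem_factorThrough ?_)
    intro a
    fin_cases a
    · exact parityObj_congr hq (show n % 2 = (n + 1 + 1) % 2 by omega) ▸ vObj_mem hq hs _
    · exact vObj_mem hq hs _

theorem tensor_fund_mem {X : VerlindeCat q} {n : ℕ}
    (hX : 𝟙 X ∈ factorThrough (parityObj hq n) X X) :
    𝟙 (X ⊗ VerlindeCat.fund q) ∈ factorThrough (parityObj hq (n + 1)) _ _ := by
  refine id_tensor_mem_factorThrough (T' := fun X => X = VerlindeCat.fund q) hX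
    (id_mem_factorThrough rfl) ?_
  rintro _ _ ⟨m, hm, hmn, rfl⟩ rfl
  rw [parityObj_congr hq (show (n + 1) % 2 = (m + 1) % 2 by omega)]
  exact vObj_tensor_fund_mem hq hs hm

/-- Parity is additive under tensor products. By induction on `n`, as `V_{n+1}` is a retract of `V_n
⊗ V_1`. -/
theorem vObj_tensor_mem {m n : ℕ} (hm : m ≤ 7) (hn : n ≤ 7) :
    𝟙 (vObj hq hm ⊗ vObj hq hn) ∈ factorThrough (parityObj hq (m + n)) _ _ := by
  induction n with
  | zero =>
    exact id_mem_factorThrough_of_retract (_ ◁ (vObjZeroIso hq).hom ≫ (ρ_ _).hom)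
      ((ρ_ _).inv ≫ _ ◁ (vObjZeroIso hq).inv) (by simp) (vObj_mem hq hs hm)
  | succ n ih =>
    obtain ⟨i, p, h⟩ := vObj_retract hq hn
    refine id_mem_factorThrough_of_retract (_ ◁ i ≫ (α_ _ _ _).inv) ((α_ _ _ _).hom ≫ _ ◁ p) ?_
      (tensor_fund_mem hq hs (ih (by omega)))
    rw [Category.assoc, Iso.inv_hom_id_assoc, ← MonoidalCategory.whiskerLeft_comp, h,
      MonoidalCategory.whiskerLeft_id]

theorem tensor_mem {X Y : VerlindeCat q} {m n : ℕ} (hX : 𝟙 X ∈ factorThrough (parityObj hq m) X X)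
    (hY : 𝟙 Y ∈ factorThrough (parityObj hq n) Y Y) :
    𝟙 (X ⊗ Y) ∈ factorThrough (parityObj hq (m + n)) _ _ := by
  refine id_tensor_mem_factorThrough hX hY ?_
  rintro _ _ ⟨a, ha, ham, rfl⟩ ⟨b, hb, hbn, rfl⟩
  rw [parityObj_congr hq (show (m + n) % 2 = (a + b) % 2 by omega)]
  exact vObj_tensor_mem hq hs _ _

omit hs in
theorem fund_mem : 𝟙 (VerlindeCat.fund q) ∈ factorThrough (parityObj hq 1) _ _ :=
  id_mem_factorThrough_of_iso (vObjOneIso hq).symm ⟨1, by norm_num, rfl, rfl⟩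

omit hs in
theorem unit_mem : 𝟙 (𝟙_ (VerlindeCat q)) ∈ factorThrough (parityObj hq 0) _ _ :=
  id_mem_factorThrough_of_iso (vObjZeroIso hq).symm ⟨0, by norm_num, rfl, rfl⟩

omit hs in
theorem summand_mem {T : ObjectProperty (VerlindeCat q)} {X Y Z : VerlindeCat q} (i : Z ⟶ X)
    (p : X ⟶ Z) (j : Z ⟶ Y) (r : Y ⟶ Z) (h : i ≫ p + j ≫ r = 𝟙 Z)
    (hX : 𝟙 X ∈ factorThrough T X X) (hY : 𝟙 Y ∈ factorThrough T Y Y) :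
    𝟙 Z ∈ factorThrough T Z Z := by
  have h1 := comp_mem_factorThrough i (factorThrough_comp_mem hX p)
  have h2 := comp_mem_factorThrough j (factorThrough_comp_mem hY r)
  rw [Category.id_comp] at h1 h2
  exact h ▸ add_mem h1 h2

/-- Every object of the Verlinde category is a direct summand of a direct sum of the `V_n`. -/
theorem id_mem_simpleObj (X : VerlindeCat q) : 𝟙 X ∈ factorThrough (simpleObj hq) X X := by
  have key : ∀ {n : ℕ} {X : VerlindeCat q}, 𝟙 X ∈ factorThrough (parityObj hq n) X X →
      𝟙 X ∈ factorThrough (simpleObj hq) X X := fun h => factorThrough_le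
    (fun W hW => by
      obtain ⟨m, hm, -, rfl⟩ := hW
      exact id_mem_factorThrough ⟨m, hm, rfl⟩) _ _ h
  have h : ∀ (X : Corep q) (hX : tensorClosure (fun X => X = Corep.fund q) X),
      𝟙 (⟨⟨X, hX⟩⟩ : VerlindeCat q) ∈ factorThrough (simpleObj hq) _ _ := by
    intro X hX
    induction hX with
    | of X hX =>
      subst hX
      exact key (fund_mem hq)
    | unit => exact key (unit_mem hq)
    | tensor X Y hX hY h1 h2 =>
      refine id_tensor_mem_factorThrough (C := VerlindeCat q) (X := ⟨⟨X, hX⟩⟩) (Y := ⟨⟨Y, hY⟩⟩)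
        h1 h2 ?_
      rintro _ _ ⟨a, ha, rfl⟩ ⟨b, hb, rfl⟩
      exact key (vObj_tensor_mem hq hs _ _)
    | summand X Y Z i p j r h hX hY h1 h2 =>
      let X' : Tilting q := ⟨X, hX⟩
      let Y' : Tilting q := ⟨Y, hY⟩
      let Z' : Tilting q := ⟨Z, .summand X Y Z i p j r h hX hY⟩
      let i' : Z' ⟶ X' := ObjectProperty.homMk i
      let p' : X' ⟶ Z' := ObjectProperty.homMk p
      let j' : Z' ⟶ Y' := ObjectProperty.homMk j
      let r' : Y' ⟶ Z' := ObjectProperty.homMk r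
      have h' : i' ≫ p' + j' ≫ r' = 𝟙 Z' := ObjectProperty.hom_ext _ h
      exact summand_mem (NegligibleQuotient.proj (k := k) i') (NegligibleQuotient.proj p')
        (NegligibleQuotient.proj j') (NegligibleQuotient.proj r')
        (congrArg (NegligibleQuotient.proj (k := k)) h') h1 h2
  exact h X.as.obj X.as.property

omit hs in
/-- Schur's lemma for the objects `V_n`. -/
theorem vObj_schur : ∀ X ∈ {X | simpleObj hq X}, ∀ Y ∈ {X | simpleObj hq X}, ∀ f : X ⟶ Y, f ≠ 0 →
    IsIso f := by
  rintro _ ⟨m, hm, rfl⟩ _ ⟨n, hn, rfl⟩ f hf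
  by_cases hmn : m = n
  · subst hmn
    obtain ⟨c, rfl⟩ := vObj_end hq _ f
    have hc : c ≠ 0 := by rintro rfl; exact hf (zero_smul k _)
    exact ⟨c⁻¹ • 𝟙 _, by simp [smul_smul, inv_mul_cancel₀ hc],
      by simp [smul_smul, mul_inv_cancel₀ hc]⟩
  · exact absurd (vObj_hom_eq_zero hq _ _ hmn f) hf

/-- The Verlinde category is semisimple, with simple objects `V_0, …, V_6`. -/
theorem isSimpleFamily_simpleObj : IsSimpleFamily k {X | simpleObj hq X} where
  end_bijective := by
    rintro _ ⟨n, hn, rfl⟩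
    exact smul_id_bijective (vObj_end hq _) (vObj_id_ne_zero hq _ hn)
  hom_eq_zero := by
    rintro _ ⟨m, hm, rfl⟩ _ ⟨n, hn, rfl⟩ hmn f
    exact vObj_hom_eq_zero hq _ _ (by rintro rfl; exact hmn rfl) f
  exists_sum X := exists_isDirectSum (vObj_schur hq) (id_mem_simpleObj hq hs X)

omit hs in
/-- The objects `V_0, …, V_6` are pairwise non-isomorphic. -/
theorem vObj_index_unique {m n : ℕ} (hm : m ≤ 7) (hn : n ≤ 7) (hm' : m ≤ 6)
    (e : vObj hq hm ≅ vObj hq hn) : m = n := by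
  by_contra hmn
  refine vObj_id_ne_zero hq hm hm' ?_
  rw [← e.hom_inv_id, vObj_hom_eq_zero hq hm hn hmn e.hom, zero_comp]

end Semisimple

/-! ### The even part of the Verlinde category -/

section Even

open Corep

variable {k : Type} [Field k] {q : kˣ} (hq : IsPrimitiveRoot (q : k) 16)

theorem VerlindeCat.hasSums (q : kˣ) : HasSums (VerlindeCat q) :=
  NegligibleQuotient.hasSums (tensorClosure.hasSums _ Corep.hasSums)

/-- For even `n` the object `V_n` is a retract of a tensor power of `V_1 ⊗ V_1`. -/
theorem isEven_vObj {n : ℕ} (hn : n ≤ 7) (h : n % 2 = 0) : VerlindeCat.IsEven q (vObj hq hn) := by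
  obtain ⟨m, rfl⟩ := Nat.dvd_of_mod_eq_zero h
  induction m with
  | zero => exact tensorClosure.unit.iso (vObjZeroIso hq)
  | succ m ih =>
    obtain ⟨i, p, h1⟩ := vObj_retract hq (n := 2 * m + 1) hn
    obtain ⟨j, r, h2⟩ := vObj_retract hq (n := 2 * m) (by omega)
    refine ((ih (by omega) (by omega)).tensor _ _ (.of _ rfl)).retract
      (i ≫ j ▷ _ ≫ (α_ _ _ _).hom) ((α_ _ _ _).inv ≫ r ▷ _ ≫ p) ?_
    have h3 : j ▷ VerlindeCat.fund q ≫ r ▷ VerlindeCat.fund q = 𝟙 _ := by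
      rw [← comp_whiskerRight, h2, id_whiskerRight]
    simp only [Category.assoc, Iso.hom_inv_id_assoc, reassoc_of% h3]
    exact h1

variable {s : kˣ} (hs : (q : k) = s ^ 2)

include hs in
/-- The even part consists of the direct sums of `V_0, V_2, V_4, V_6`. -/
theorem isEven_iff (Y : VerlindeCat q) :
    VerlindeCat.IsEven q Y ↔ 𝟙 Y ∈ factorThrough (parityObj hq 0) Y Y := by
  refine ⟨fun h => ?_, fun h => tensorClosure.of_id_mem (VerlindeCat.hasSums q)
    (factorThrough_le (fun W hW => ?_) _ _ h)⟩
  · induction h with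
    | of X hX =>
      subst hX
      have h := tensor_mem hq hs (fund_mem hq) (fund_mem hq)
      rwa [parityObj_congr hq (show (1 + 1) % 2 = 0 % 2 from rfl)] at h
    | unit => exact unit_mem hq
    | tensor X Y _ _ hX hY => exact tensor_mem (m := 0) (n := 0) hq hs hX hY
    | summand X Y Z i p j r h _ _ hX hY => exact summand_mem i p j r h hX hY
  · obtain ⟨m, hm, hm0, rfl⟩ := hW
    exact id_mem_factorThrough (isEven_vObj hq _ hm0)

include hs in
theorem exists_sum_of_isEven {Y : VerlindeCat q} (hY : VerlindeCat.IsEven q Y) :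
    ∃ (n : ℕ) (X : Fin n → VerlindeCat q), (∀ a, parityObj hq 0 (X a)) ∧ IsDirectSum X Y :=
  exists_isDirectSum (S := {X | parityObj hq 0 X})
    (fun X hX Y hY => vObj_schur hq
      X ⟨hX.choose, hX.choose_spec.choose, hX.choose_spec.choose_spec.2⟩
      Y ⟨hY.choose, hY.choose_spec.choose, hY.choose_spec.choose_spec.2⟩)
    ((isEven_iff hq hs Y).1 hY)

/-- The simple objects `V_0, V_2, V_4, V_6` of the even part. -/
def evenSimples : Set (EvenVerlinde q) := {W | parityObj hq 0 W.obj}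

theorem evenSimples_finite : (evenSimples hq).Finite := by
  have h : {X : VerlindeCat q | parityObj hq 0 X}.Finite := by
    refine (Set.finite_range fun i : Fin 8 => vObj hq (Nat.lt_succ_iff.1 i.2)).subset ?_
    rintro _ ⟨m, hm, -, rfl⟩
    exact ⟨⟨m, by omega⟩, rfl⟩
  refine h.preimage (f := fun W : EvenVerlinde q => W.obj) (Function.Injective.injOn ?_)
  rintro ⟨X, hX⟩ ⟨Y, hY⟩ h
  cases h
  rfl

include hs in
/-- The even part of the Verlinde category is semisimple, with simple objects
`V_0, V_2, V_4, V_6`. -/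
theorem isSimpleFamily_evenSimples : IsSimpleFamily k (evenSimples hq) where
  end_bijective := by
    rintro ⟨_, hW⟩ ⟨n, hn, -, rfl⟩
    refine smul_id_bijective (fun f => ?_) fun h =>
      vObj_id_ne_zero hq _ hn (congrArg (fun f => f.hom) h)
    obtain ⟨c, hc⟩ := vObj_end hq _ f.hom
    exact ⟨c, ObjectProperty.hom_ext _ hc⟩
  hom_eq_zero := by
    rintro ⟨_, hW⟩ ⟨m, hm, -, rfl⟩ ⟨_, hW'⟩ ⟨n, hn, -, rfl⟩ hmn f
    exact ObjectProperty.hom_ext _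
      (vObj_hom_eq_zero hq _ _ (by rintro rfl; exact hmn rfl) f.hom)
  exists_sum W := by
    obtain ⟨n, X, hX, h⟩ := exists_sum_of_isEven hq hs W.property
    have hX' : ∀ a, VerlindeCat.IsEven q (X a) := fun a => by
      obtain ⟨m, hm, hm0, h0⟩ := hX a
      exact h0 ▸ isEven_vObj hq _ hm0
    exact ⟨n, _, fun a => hX a, h.fullSubcategory hX'⟩

/-- The Verlinde category has right duals. -/
instance : RightRigidCategory (VerlindeCat q) where
  rightDual X := { rightDual := ⟨X.as.dual⟩, exact := NegligibleQuotient.projPairing X.as.pairing }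

/-- The even part is closed under duals, as `V_1 ⊗ V_1` is self-dual. -/
theorem isEven_dual {X : VerlindeCat q} (hX : VerlindeCat.IsEven q X) :
    VerlindeCat.IsEven q ⟨X.as.dual⟩ := by
  refine tensorClosure.rightDual (fun X hX => ?_) hX
  subst hX
  let e : (VerlindeCat.fund q)ᘁ ≅ VerlindeCat.fund q := rightDualIso
    (RightRigidCategory.rightDual (VerlindeCat.fund q)).exact
    (NegligibleQuotient.projPairing (fullSubcategoryPairing _ _ _ (fundPairing q)))
  exact (tensorClosure.of
    (S := fun X : VerlindeCat q => X = VerlindeCat.fund q ⊗ VerlindeCat.fund q) _ rfl).iso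
      (rightDualTensorIso _ _ ≪≫ (e ⊗ᵢ e))

/-- The dual of an object of the even part. -/
def EvenVerlinde.dual (X : EvenVerlinde q) : EvenVerlinde q :=
  ⟨⟨X.obj.as.dual⟩, isEven_dual X.property⟩

/-- The dual is a right dual. -/
@[reducible]
def EvenVerlinde.pairing (X : EvenVerlinde q) : ExactPairing X X.dual :=
  fullSubcategoryPairing _ _ _ (NegligibleQuotient.projPairing X.obj.as.pairing)

/-- The dual is a left dual. -/
@[reducible]
def EvenVerlinde.pairing' (X : EvenVerlinde q) : ExactPairing X.dual X :=
  fullSubcategoryPairing _ _ _ (NegligibleQuotient.projPairing X.obj.as.pairing')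

/-- The even part is rigid. -/
instance : RigidCategory (EvenVerlinde q) where
  rightDual X := { rightDual := X.dual, exact := X.pairing }
  leftDual X := { leftDual := X.dual, exact := X.pairing' }

include hq in
theorem unit_end (f : 𝟙_ (VerlindeCat q) ⟶ 𝟙_ (VerlindeCat q)) : ∃ c : k, f = c • 𝟙 _ :=
  exists_smul_id_of_iso (vObjZeroIso hq) (vObj_end hq _) f

include hq in
theorem unit_id_ne_zero : 𝟙 (𝟙_ (VerlindeCat q)) ≠ 0 :=
  id_ne_zero_of_iso (vObjZeroIso hq) (vObj_id_ne_zero hq _ (by norm_num))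

include hq hs in
theorem isFusion_even : IsFusion k (EvenVerlinde q) where
  preadditive := inferInstance
  linear := inferInstance
  biproducts := (tensorClosure.hasSums _ (VerlindeCat.hasSums q)).hasFiniteBiproducts
  rigid := ⟨inferInstance⟩
  unit_simple := smul_id_bijective (fun f => by
      obtain ⟨c, hc⟩ := unit_end hq f.hom
      exact ⟨c, ObjectProperty.hom_ext _ hc⟩)
    fun h => unit_id_ne_zero hq (congrArg (fun f => f.hom) h)
  semisimple := ⟨_, isSimpleFamily_evenSimples hq hs⟩
  finite := ⟨_, evenSimples_finite hq, isSimpleFamily_evenSimples hq hs⟩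

end Even

/-! ### Squared norms -/

section SquaredNorm

variable {k : Type} [Field k] {C : Type u} [Category.{v} C] [Preadditive C] [Linear k C]
  [MonoidalCategory C] [MonoidalPreadditive C] [MonoidalLinear k C]

/-- All endomorphisms of a right dual of an object with scalar endomorphisms are scalars. -/
theorem exists_smul_id_of_pairing {X Y : C} (hX : ∀ f : X ⟶ X, ∃ c : k, f = c • 𝟙 X)
    (e : ExactPairing X Y) (f : Y ⟶ Y) : ∃ c : k, f = c • 𝟙 Y := by
  let φ := @tensorRightHomEquiv C _ _ (𝟙_ C) X Y X e
  let ψ := @tensorLeftHomEquiv C _ _ (𝟙_ C) X Y Y e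
  obtain ⟨c, hc⟩ := hX ((λ_ X).inv ≫ φ.symm (e.coevaluation' ≫ X ◁ f))
  have h1 : φ.symm (e.coevaluation' ≫ X ◁ f) = c • (λ_ X).hom := by
    rw [Iso.inv_comp_eq] at hc
    rw [hc, Linear.comp_smul, Category.comp_id]
  have h2 : φ (c • (λ_ X).hom) = c • e.coevaluation' := by
    change (ρ_ (𝟙_ C)).inv ≫ 𝟙_ C ◁ e.coevaluation' ≫ (α_ _ _ _).inv ≫ (c • (λ_ X).hom) ▷ Y = _
    simp [unitors_equal]
  have h3 : e.coevaluation' ≫ X ◁ f = c • e.coevaluation' := by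
    rw [← h2, ← h1, Equiv.apply_symm_apply]
  refine ⟨c, ?_⟩
  have h4 := congrArg (fun g => Y ◁ g ≫ (α_ _ _ _).inv ≫ e.evaluation' ▷ Y) h3
  simp only [MonoidalLinear.whiskerLeft_smul, Linear.smul_comp, MonoidalCategory.whiskerLeft_comp,
    Category.assoc] at h4
  rw [e.coevaluation_evaluation', associator_inv_naturality_right_assoc, whisker_exchange,
    reassoc_of% e.coevaluation_evaluation'] at h4
  have h5 := congrArg (fun g => (ρ_ Y).inv ≫ g ≫ (λ_ Y).hom) h4
  simpa using h5

/-- The product of the two loops of an object with scalar endomorphisms does not depend on the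
dual and the pairings. -/
theorem loop_comp_loop_unique {V W W' : C} (hV : ∀ f : V ⟶ V, ∃ c : k, f = c • 𝟙 V) (hV0 : 𝟙 V ≠ 0)
    (e : ExactPairing V W) (e' : ExactPairing W V) (d : ExactPairing V W')
    (d' : ExactPairing W' V) :
    (d.coevaluation' ≫ d'.evaluation') ≫ (d'.coevaluation' ≫ d.evaluation') =
      (e.coevaluation' ≫ e'.evaluation') ≫ (e'.coevaluation' ≫ e.evaluation') := by
  let φ : W ≅ W' := rightDualIso e d
  let f : ExactPairing V W := @exactPairingCongrRight C _ _ V W W' d φ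
  let f' : ExactPairing W V := @exactPairingCongrLeft C _ _ W W' V d' φ
  have h1 : f.coevaluation' ≫ f'.evaluation' = d.coevaluation' ≫ d'.evaluation' := by
    change (d.coevaluation' ≫ V ◁ φ.inv) ≫ V ◁ φ.hom ≫ d'.evaluation' = _
    simp
  have h2 : f'.coevaluation' ≫ f.evaluation' = d'.coevaluation' ≫ d.evaluation' := by
    change (d'.coevaluation' ≫ φ.inv ▷ V) ≫ φ.hom ▷ V ≫ d.evaluation' = _
    simp
  have hW0 : 𝟙 W ≠ 0 := fun h => hV0 (by
    have := e.evaluation_coevaluation'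
    have h0 : e.evaluation' = 0 := by
      rw [← Category.id_comp e.evaluation', ← id_whiskerRight, h]
      simp
    rw [h0] at this
    have := congrArg (fun g => (λ_ V).inv ≫ g ≫ (ρ_ V).hom) this
    simpa using this.symm)
  obtain ⟨a, b, hab, ha, hb⟩ := exists_smul_pairing (exists_smul_id_of_pairing hV e) hW0 e f
  obtain ⟨a', b', hab', ha', hb'⟩ := exists_smul_pairing hV hV0 e' f'
  rw [← h1, ← h2, ha, hb, ha', hb']
  simp only [Linear.smul_comp, Linear.comp_smul, smul_smul]
  rw [show b * a' * (b' * a) = 1 by linear_combination a' * b' * hab + hab', one_smul]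

end SquaredNorm

/-! ### Amplitudes -/

section Trivalent

universe v' u'

/-- The object `X` occurs exactly once in `X ⊗ X`, and the invariant
`m' (m' ⊗ 1) (1 ⊗ m) m = t` of the embedding `m'` and the projection `m` is `t`. -/
def IsTrivalent {k : Type} [CommRing k] {C : Type u} [Category.{v} C] [Preadditive C] [Linear k C]
    [MonoidalCategory C] (X : C) (t : k) : Prop :=
  ∃ (m : X ⊗ X ⟶ X) (m' : X ⟶ X ⊗ X), m' ≫ m = 𝟙 X ∧ (∀ f : X ⊗ X ⟶ X, ∃ c : k, f = c • m) ∧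
    (∀ f : X ⟶ X ⊗ X, ∃ c : k, f = c • m') ∧
    m' ≫ m' ▷ X ≫ (α_ X X X).hom ≫ X ◁ m ≫ m = t • 𝟙 X

variable {k : Type} [Field k] {C : Type u} [Category.{v} C] [Preadditive C] [Linear k C]
  [MonoidalCategory C]

/-- The invariant of a trivalent object only depends on its isomorphism class. -/
theorem IsTrivalent.of_iso {X Y : C} {t : k} (h : IsTrivalent X t) (e : X ≅ Y) :
    IsTrivalent Y t := by
  obtain ⟨m, m', h1, h2, h3, h4⟩ := h
  refine ⟨(e.inv ⊗ₘ e.inv) ≫ m ≫ e.hom, e.inv ≫ m' ≫ (e.hom ⊗ₘ e.hom), ?_, fun f => ?_, fun f => ?_,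
    ?_⟩
  · simp [reassoc_of% h1]
  · obtain ⟨c, hc⟩ := h2 ((e.hom ⊗ₘ e.hom) ≫ f ≫ e.inv)
    refine ⟨c, ?_⟩
    have := congrArg (fun g => (e.inv ⊗ₘ e.inv) ≫ g ≫ e.hom) hc
    simpa using this
  · obtain ⟨c, hc⟩ := h3 (e.hom ≫ f ≫ (e.inv ⊗ₘ e.inv))
    refine ⟨c, ?_⟩
    have := congrArg (fun g => e.inv ≫ g ≫ (e.hom ⊗ₘ e.hom)) hc
    simpa using this
  · have h5 := congrArg (fun g => e.inv ≫ g ≫ e.hom) h4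
    have h6 : (e.inv ≫ m' ≫ (e.hom ⊗ₘ e.hom)) ≫ (e.inv ≫ m' ≫ (e.hom ⊗ₘ e.hom)) ▷ Y ≫
        (α_ Y Y Y).hom ≫ Y ◁ ((e.inv ⊗ₘ e.inv) ≫ m ≫ e.hom) ≫ (e.inv ⊗ₘ e.inv) ≫ m ≫ e.hom =
          e.inv ≫ (m' ≫ m' ▷ X ≫ (α_ X X X).hom ≫ X ◁ m ≫ m) ≫ e.hom := by
      have h7 : (e.hom ⊗ₘ e.hom) ≫ (e.inv ≫ m' ≫ (e.hom ⊗ₘ e.hom)) ▷ Y =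
          m' ▷ X ≫ ((e.hom ⊗ₘ e.hom) ⊗ₘ e.hom) := by
        rw [← tensorHom_id, ← tensorHom_id, tensorHom_comp_tensorHom, tensorHom_comp_tensorHom]
        simp
      have h8 : (e.hom ⊗ₘ (e.hom ⊗ₘ e.hom)) ≫ Y ◁ ((e.inv ⊗ₘ e.inv) ≫ m ≫ e.hom) ≫
          (e.inv ⊗ₘ e.inv) = X ◁ m := by
        rw [← id_tensorHom, ← id_tensorHom, tensorHom_comp_tensorHom, tensorHom_comp_tensorHom]
        simp
      simp only [Category.assoc, reassoc_of% h7, associator_naturality_assoc, reassoc_of% h8]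
    rw [h6]
    simpa using h5

variable [MonoidalPreadditive C] [MonoidalLinear k C]

/-- Passing to the dual morphism is injective, since a morphism can be recovered from its dual. -/
theorem rightAdjointMate_injective {X Y : C} [HasRightDual X] [HasRightDual Y] {f : X ⟶ Y}
    (h : rightAdjointMate f = 0) : f = 0 := by
  have h1 := coevaluation_comp_rightAdjointMate f
  rw [h, MonoidalPreadditive.whiskerLeft_zero, comp_zero] at h1
  have h2 : f = (λ_ X).inv ≫ (η_ X (Xᘁ) ≫ f ▷ _) ▷ X ≫ (α_ _ _ _).hom ≫ Y ◁ ε_ X (Xᘁ) ≫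
      (ρ_ Y).hom := by
    have h3 := ExactPairing.evaluation_coevaluation X (Xᘁ)
    have h4 : (λ_ X).inv ≫ (η_ X (Xᘁ) ≫ f ▷ _) ▷ X ≫ (α_ _ _ _).hom ≫ Y ◁ ε_ X (Xᘁ) ≫ (ρ_ Y).hom =
        (λ_ X).inv ≫ (η_ X (Xᘁ) ▷ X ≫ (α_ _ _ _).hom ≫ X ◁ ε_ X (Xᘁ)) ≫ (ρ_ X).hom ≫ f := by
      simp only [comp_whiskerRight, Category.assoc, associator_naturality_left_assoc,
        ← whisker_exchange_assoc, rightUnitor_naturality]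
    rw [h4, h3]
    simp
  rw [h2, ← h1]
  simp

section Mate

variable {X : C} [ExactPairing X X]

theorem dualVertex_smul (c : k) (m : X ⊗ X ⟶ X) : dualVertex (c • m) = c • dualVertex m := by
  simp [dualVertex]

theorem dualVertex_eq_zero {m : X ⊗ X ⟶ X} (h : dualVertex m = 0) : m = 0 :=
  @rightAdjointMate_injective C _ _ _ _ (X ⊗ X) X ⟨X ⊗ X⟩ ⟨X⟩ m h

theorem selfTrace_smul {D : k} (hD : η_ X X ≫ ε_ X X = D • 𝟙 (𝟙_ C)) (c : k) :
    selfTrace (c • 𝟙 X) = (c * D) • 𝟙 (𝟙_ C) := by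
  simp [selfTrace, hD, smul_smul]

end Mate

variable {X : C}

/-- The loop of a self-dual object with scalar endomorphisms does not depend on the pairing. -/
theorem loop_unique (hX : ∀ f : X ⟶ X, ∃ c : k, f = c • 𝟙 X) (hX0 : 𝟙 X ≠ 0)
    (e e' : ExactPairing X X) :
    e'.coevaluation' ≫ e'.evaluation' = e.coevaluation' ≫ e.evaluation' := by
  obtain ⟨c, d, hcd, hc, hd⟩ := exists_smul_pairing hX hX0 e e'
  rw [hc, hd, Linear.smul_comp, Linear.comp_smul, smul_smul, hcd, one_smul]

/-- For a trivalent self-dual object, all trivalent vertices `m` are multiples of each other, and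
both amplitudes can be expressed by the factor in `m_* m`. -/
theorem IsTrivalent.exists_factor {t D : k} (ht : IsTrivalent X t) (hX0 : 𝟙 X ≠ 0)
    (e : ExactPairing X X) (hD : e.coevaluation' ≫ e.evaluation' = D • 𝟙 (𝟙_ C)) :
    (∃ (m : X ⊗ X ⟶ X) (ν : k), ν ≠ 0 ∧ ∀ c : k, dualVertex (c • m) ≫ (c • m) = (c ^ 2 * ν) • 𝟙 X) ∧
    ∀ m : X ⊗ X ⟶ X, ∃ a : k, (m ≠ 0 → a ≠ 0) ∧ dualVertex m ≫ m = a • 𝟙 X ∧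
      ampT2 m = (a * D) • 𝟙 (𝟙_ C) ∧ ampT4 m = (a ^ 2 * (t * D)) • 𝟙 (𝟙_ C) := by
  obtain ⟨m₀, m₀', h1, h2, h3, h4⟩ := ht
  -- The dual of `m₀` is a non-zero multiple of the embedding `m₀'`.
  obtain ⟨ν, hν⟩ := h3 (dualVertex m₀)
  have hm₀ : m₀ ≠ 0 := fun h => hX0 (by rw [← h1, h, comp_zero])
  have hν0 : ν ≠ 0 := fun h => hm₀ (dualVertex_eq_zero (by rw [hν, h, zero_smul]))
  have key : ∀ c : k, dualVertex (c • m₀) ≫ (c • m₀) = (c ^ 2 * ν) • 𝟙 X := fun c => by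
    rw [dualVertex_smul, hν, Linear.smul_comp, Linear.smul_comp, Linear.comp_smul, h1, smul_smul,
      smul_smul]
    congr 1
    ring
  refine ⟨⟨m₀, ν, hν0, key⟩, fun m => ?_⟩
  obtain ⟨c, rfl⟩ := h2 m
  refine ⟨c ^ 2 * ν, fun h => ?_, key c, ?_, ?_⟩
  · exact mul_ne_zero (pow_ne_zero 2 (by rintro rfl; exact h (zero_smul k _))) hν0
  · rw [ampT2, key, selfTrace_smul hD]
  · have h5 : dualVertex (c • m₀) ≫ dualVertex (c • m₀) ▷ X ≫ (α_ X X X).hom ≫ X ◁ (c • m₀) ≫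
        (c • m₀) = ((c ^ 2 * ν) ^ 2 * t) • 𝟙 X := by
      rw [dualVertex_smul, hν]
      simp only [MonoidalLinear.smul_whiskerRight, MonoidalLinear.whiskerLeft_smul,
        Linear.smul_comp, Linear.comp_smul, smul_smul, h4]
      congr 1
      ring
    rw [ampT4, h5, selfTrace_smul hD, mul_assoc]

end Trivalent

/-! ### Trivalent vertices of the three-dimensional representation -/

section Adjoint

open Corep
open scoped Kronecker

variable {k : Type} [Field k]

section Matrices

variable {l m n p : Type} [Fintype m] [Fintype p] [DecidableEq m] [DecidableEq p]

theorem fuse_apply (P : Matrix l (m × p) k) (J : Matrix (p × p) n k) (a : l) (ε : p) (i : m)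
    (j : n) :
    ((P ⊗ₖ (1 : Matrix p p k)) * (perm k (Equiv.prodAssoc m p p).symm *
      ((1 : Matrix m m k) ⊗ₖ J))) (a, ε) (i, j) = ∑ b, P a (i, b) * J (b, ε) j := by
  rw [perm_mul]
  simp [Matrix.mul_apply, Fintype.sum_prod_type, Matrix.one_apply]

theorem unfuse_apply (J : Matrix (m × p) l k) (P : Matrix n (p × p) k) (a : l) (ε : p) (i : m)
    (j : n) :
    ((((1 : Matrix m m k) ⊗ₖ P) * perm k (Equiv.prodAssoc m p p)) *
      (J ⊗ₖ (1 : Matrix p p k))) (i, j) (a, ε) = ∑ b, P j (b, ε) * J (i, b) a := by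
  rw [mul_perm]
  simp [Matrix.mul_apply, Fintype.sum_prod_type, Matrix.one_apply]

/-- The coefficients of the composite in the definition of `IsTrivalent`. -/
theorem tetrahedron_apply (F : Matrix m (m × m) k) (G : Matrix (m × m) m k) (x y : m) :
    ((F * ((1 : Matrix m m k) ⊗ₖ F)) * perm k (Equiv.prodAssoc m m m) *
      (G ⊗ₖ (1 : Matrix m m k)) * G) x y =
        ∑ i, ∑ j, G (i, j) y * ∑ a, ∑ b, G (a, b) i * ∑ c, F c (b, j) * F x (a, c) := by
  rw [mul_perm]
  simp only [Matrix.mul_apply, Fintype.sum_prod_type, Matrix.one_apply, Matrix.submatrix_apply,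
    Matrix.kroneckerMap_apply, Equiv.prodAssoc_apply, id_eq, ite_mul, mul_ite, one_mul, mul_one,
    zero_mul, mul_zero, Finset.sum_ite_eq', Finset.mem_univ, if_true,
    Finset.sum_ite_irrel, Finset.sum_const_zero]
  refine Finset.sum_congr rfl fun i _ => Finset.sum_congr rfl fun j _ => ?_
  rw [mul_comm]
  refine congrArg _ (Finset.sum_congr rfl fun a _ => Finset.sum_congr rfl fun b _ => ?_)
  rw [mul_comm]
  exact congrArg _ (Finset.sum_congr rfl fun c _ => mul_comm _ _)

end Matrices

variable {q : kˣ}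

/-- The coefficients of the trivalent vertex `V₂ ⊗ V₂ ⟶ V₂`. -/
def vertexMat (q : kˣ) : Matrix (Fin 3) (Fin 3 × Fin 3) k := Matrix.of fun l x =>
  if (x.1 : ℕ) + x.2 = l + 1 then
    !![0, 1, (qn q 2)⁻¹; -(q : k) ^ 2, 1 - (q : k) ^ 2, 1; -(qn q 2)⁻¹, -(q : k) ^ 2, 0] x.1 x.2
    else 0

/-- The coefficients of the trivalent vertex `V₂ ⟶ V₂ ⊗ V₂`. -/
def vertexMat' (q : kˣ) : Matrix (Fin 3 × Fin 3) (Fin 3) k := Matrix.of fun x l =>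
  if (x.1 : ℕ) + x.2 = l + 1 then
    !![0, 1, (q : k) ^ 2 * qn q 2; -(q : k) ^ 2, 1 - (q : k) ^ 2, 1;
      -(q : k) ^ 2 * qn q 2, -(q : k) ^ 2, 0] x.1 x.2 else 0

theorem weylF_two (h1 : qn q 1 = 1) : weylF q 2 = !![0, 0, 0; 1, 0, 0; 0, qn q 2, 0] := by
  ext i j
  fin_cases i <;> fin_cases j <;> simp [weylF, h1]

theorem weylK_two : weylK q 2 = Matrix.diagonal ![(q : k) ^ 2, 1, ((q⁻¹ : kˣ) : k) ^ 2] := by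
  rw [weylK]
  congr 1
  ext i
  fin_cases i <;> simp

theorem pow_mul_weylK_two (i : Fin 3) :
    (q : k) ^ (2 * i : ℕ) * (![(q : k) ^ 2, 1, ((q⁻¹ : kˣ) : k) ^ 2] : Fin 3 → k) i =
      (q : k) ^ 2 := by
  fin_cases i <;> simp
  field_simp

/-- A coefficient of a map that preserves weights vanishes unless `i + j = l + 1`, as the weights of
`V₂` are `q²`, `1`, `q⁻²`. -/
theorem vertex_weight (hq : IsPrimitiveRoot (q : k) 16) {i j l : Fin 3} {c : k} (hc : c ≠ 0)
    (h : (![(q : k) ^ 2, 1, ((q⁻¹ : kˣ) : k) ^ 2] : Fin 3 → k) l * c =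
      c * ((![(q : k) ^ 2, 1, ((q⁻¹ : kˣ) : k) ^ 2] : Fin 3 → k) i *
        (![(q : k) ^ 2, 1, ((q⁻¹ : kˣ) : k) ^ 2] : Fin 3 → k) j)) : (i : ℕ) + j = l + 1 := by
  have hi := pow_mul_weylK_two (q := q) i
  have hj := pow_mul_weylK_two (q := q) j
  have hl := pow_mul_weylK_two (q := q) l
  rw [mul_comm] at h
  have h := mul_left_cancel₀ hc h
  set A := (![(q : k) ^ 2, 1, ((q⁻¹ : kˣ) : k) ^ 2] : Fin 3 → k)
  have h2 : (q : k) ^ (2 + 2 * i + 2 * j : ℕ) = (q : k) ^ (2 + 2 + 2 * l : ℕ) := by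
    simp only [pow_add]
    calc _ = (q : k) ^ (2 * l : ℕ) * A l * q ^ (2 * i : ℕ) * q ^ (2 * j : ℕ) := by rw [hl]
      _ = ((q : k) ^ (2 * i : ℕ) * A i) * (q ^ (2 * j : ℕ) * A j) * q ^ (2 * l : ℕ) := by
        rw [h]; ring
      _ = _ := by rw [hi, hj]
  have := hq.pow_inj (by omega) (by omega) h2
  omega

theorem one_add_sq_add_pow_four_ne_zero (hq : IsPrimitiveRoot (q : k) 16) :
    1 + (q : k) ^ 2 + (q : k) ^ 4 ≠ 0 := by
  intro h
  have h1 : (q : k) ^ 6 = 1 := by linear_combination ((q : k) ^ 2 - 1) * h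
  exact absurd ((hq.pow_eq_one_iff_dvd 6).1 h1) (by norm_num)

theorem qn_one (hq : IsPrimitiveRoot (q : k) 16) : qn q 1 = 1 := by
  rw [qn, pow_one, pow_one, div_self (sub_inv_ne_zero hq)]

theorem qn_two (hq : IsPrimitiveRoot (q : k) 16) : qn q 2 = q + ((q⁻¹ : kˣ) : k) := by
  rw [qn_succ q (sub_inv_ne_zero hq), qn_one hq, mul_one, pow_one]

/-- A matrix that commutes with `K` and `F` is a multiple of the trivalent vertex. -/
theorem eq_smul_vertexMat (hq : IsPrimitiveRoot (q : k) 16) {T : Matrix (Fin 3) (Fin 3 × Fin 3) k}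
    (hK : weylK q 2 * T = T * (weylK q 2 ⊗ₖ weylK q 2))
    (hF : weylF q 2 * T = T * (weylF q 2 ⊗ₖ 1 + weylK q 2 ⊗ₖ weylF q 2)) :
    T = T 0 (0, 1) • vertexMat q := by
  have h0 : ∀ l i j : Fin 3, (i : ℕ) + j ≠ (l : ℕ) + 1 → T l (i, j) = 0 := by
    intro l i j h
    by_contra hT
    have h1 := congrFun (congrFun hK l) (i, j)
    rw [weylK_two, Matrix.diagonal_kronecker_diagonal, Matrix.diagonal_mul,
      Matrix.mul_diagonal] at h1
    exact h (vertex_weight hq hT h1)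
  have hQ : qn q 2 ≠ 0 := qn_ne_zero hq 2 (by norm_num) (by norm_num)
  have h3 := one_add_sq_add_pow_four_ne_zero hq
  have hp : (q : k) * ((q⁻¹ : kˣ) : k) = 1 := by simp
  have key := fun l i j => congrFun (congrFun hF l) (i, j)
  rw [weylF_two (qn_one hq), weylK_two] at key
  -- The six weight-compatible entries of `F T = T F` determine the six other coefficients of `T`
  -- by the first one.
  have e1 := key 0 0 0
  have e2 := key 1 0 1
  have e3 := key 1 1 0
  have e4 := key 2 1 1
  have e5 := key 2 0 2
  have e6 := key 2 2 0
  clear key hK hF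
  simp [Matrix.mul_apply, Fintype.sum_prod_type, Fin.sum_univ_three, Matrix.one_apply]
    at e1 e2 e3 e4 e5 e6
  have hz : (q : k) ≠ 0 := q.ne_zero
  have e4' : T 1 (1, 1) = T 2 (1, 2) + T 2 (2, 1) := mul_left_cancel₀ hQ (by linear_combination e4)
  have e6' : T 2 (2, 1) = (q : k) ^ 2 * qn q 2 * T 1 (2, 0) := by
    field_simp at e6
    linear_combination -e6
  have f11 : T 1 (1, 1) = (1 - (q : k) ^ 2) * T 0 (0, 1) := mul_left_cancel₀ h3 (by
    linear_combination (q : k) ^ 2 * e4' - (q : k) ^ 2 * e5 - e2 + (q : k) ^ 2 * e6' -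
      (q : k) ^ 4 * e3 - (q : k) ^ 4 * e1)
  have f10 : T 0 (1, 0) = -(q : k) ^ 2 * T 0 (0, 1) := by linear_combination -e1
  have f12 : T 2 (1, 2) = T 0 (0, 1) := mul_left_cancel₀ (pow_ne_zero 2 hz) (by
    linear_combination -(q : k) ^ 2 * e5 - e2 - f11)
  have f02 : T 1 (0, 2) = (qn q 2)⁻¹ * T 0 (0, 1) := by
    rw [eq_inv_mul_iff_mul_eq₀ hQ, e5, f12]
  have f20 : T 1 (2, 0) = -(qn q 2)⁻¹ * T 0 (0, 1) := by
    rw [neg_mul, ← mul_neg, eq_inv_mul_iff_mul_eq₀ hQ]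
    linear_combination -e3 + f10 - f11
  have f21 : T 2 (2, 1) = -(q : k) ^ 2 * T 0 (0, 1) := by
    rw [e6', f20]
    field_simp
  ext l ⟨i, j⟩
  rw [Matrix.smul_apply, vertexMat, Matrix.of_apply, smul_eq_mul]
  split_ifs with h
  · fin_cases l <;> fin_cases i <;> fin_cases j <;> first
      | exact absurd h (by decide)
      | exact (mul_one _).symm
      | exact f12.trans (mul_one _).symm
      | exact f11.trans (mul_comm _ _)
      | exact f10.trans (mul_comm _ _)
      | exact f02.trans (mul_comm _ _)
      | exact f20.trans (mul_comm _ _)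
      | exact f21.trans (mul_comm _ _)
  · rw [h0 l i j h, mul_zero]

/-- A matrix that commutes with `K` and `F` is a multiple of the dual trivalent vertex. -/
theorem eq_smul_vertexMat' (hq : IsPrimitiveRoot (q : k) 16) {T : Matrix (Fin 3 × Fin 3) (Fin 3) k}
    (hK : (weylK q 2 ⊗ₖ weylK q 2) * T = T * weylK q 2)
    (hF : (weylF q 2 ⊗ₖ 1 + weylK q 2 ⊗ₖ weylF q 2) * T = T * weylF q 2) :
    T = T (0, 1) 0 • vertexMat' q := by
  have h0 : ∀ i j l : Fin 3, (i : ℕ) + j ≠ (l : ℕ) + 1 → T (i, j) l = 0 := by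
    intro i j l h
    by_contra hT
    have h1 := congrFun (congrFun hK (i, j)) l
    rw [weylK_two, Matrix.diagonal_kronecker_diagonal, Matrix.diagonal_mul,
      Matrix.mul_diagonal, mul_comm] at h1
    exact h (vertex_weight hq hT ((mul_comm _ _).trans h1.symm))
  have hQ : qn q 2 ≠ 0 := qn_ne_zero hq 2 (by norm_num) (by norm_num)
  have h3 := one_add_sq_add_pow_four_ne_zero hq
  have key := fun i j l => congrFun (congrFun hF (i, j)) l
  rw [weylF_two (qn_one hq), weylK_two] at key
  have e1 := key 0 2 0
  have e2 := key 1 1 0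
  have e3 := key 2 0 0
  have e4 := key 1 2 1
  have e5 := key 2 1 1
  have e6 := key 2 2 2
  clear key hK hF
  simp [Matrix.mul_apply, Fintype.sum_prod_type, Fin.sum_univ_three, Matrix.one_apply]
    at e1 e2 e3 e4 e5 e6
  have hz : (q : k) ^ 2 * ((q : k) ^ 2)⁻¹ = 1 := mul_inv_cancel₀ (pow_ne_zero 2 q.ne_zero)
  have e4' : T (1, 2) 2 = (q : k) ^ 2 * T (0, 1) 0 + T (0, 1) 0 + T (1, 0) 0 :=
    mul_left_cancel₀ hQ (by linear_combination -e4 - e1 - qn q 2 * e2)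
  have e5' : (q : k) ^ 2 * T (2, 1) 2 = (q : k) ^ 2 * (T (0, 1) 0 + T (1, 0) 0) + T (1, 0) 0 :=
    mul_left_cancel₀ hQ (by
      linear_combination -(q : k) ^ 2 * e5 - (q : k) ^ 2 * qn q 2 * e2 - e3 + T (2, 0) 1 * hz)
  have e6' : (q : k) ^ 2 * T (1, 2) 2 + T (2, 1) 2 = 0 := mul_left_cancel₀ hQ (by
    linear_combination (q : k) ^ 2 * e6 - qn q 2 * T (2, 1) 2 * hz)
  have f10 : T (1, 0) 0 = -(q : k) ^ 2 * T (0, 1) 0 := mul_left_cancel₀ h3 (by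
    linear_combination (q : k) ^ 2 * e6' - (q : k) ^ 4 * e4' - e5')
  have f11 : T (1, 1) 1 = (1 - (q : k) ^ 2) * T (0, 1) 0 := by linear_combination -e2 + f10
  have f02 : T (0, 2) 1 = (q : k) ^ 2 * qn q 2 * T (0, 1) 0 := e1.symm
  have f20 : T (2, 0) 1 = -(q : k) ^ 2 * qn q 2 * T (0, 1) 0 := by
    linear_combination -e3 + qn q 2 * f10
  have f12 : T (1, 2) 2 = T (0, 1) 0 := by linear_combination e4' + f10
  have f21 : T (2, 1) 2 = -(q : k) ^ 2 * T (0, 1) 0 := by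
    linear_combination e6' - (q : k) ^ 2 * f12
  ext ⟨i, j⟩ l
  rw [Matrix.smul_apply, vertexMat', Matrix.of_apply, smul_eq_mul]
  split_ifs with h
  · fin_cases l <;> fin_cases i <;> fin_cases j <;> first
      | exact absurd h (by decide)
      | exact (mul_one _).symm
      | exact f12.trans (mul_one _).symm
      | exact f11.trans (mul_comm _ _)
      | exact f10.trans (mul_comm _ _)
      | exact f02.trans (mul_comm _ _)
      | exact f20.trans (mul_comm _ _)
      | exact f21.trans (mul_comm _ _)
  · rw [h0 i j l h, mul_zero]

/-- The invariant form on `V₂ ⊗ V₂`. -/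
def formMat (q : kˣ) : Matrix (Fin 3) (Fin 3) k :=
  !![0, 0, 1; 0, -(q : k) ^ 2 * qn q 2, 0; (q : k) ^ 2, 0, 0]

/-- The invariant vector in `V₂ ⊗ V₂`. -/
def vecMat (q : kˣ) : Matrix (Fin 3) (Fin 3) k :=
  !![0, 0, 1; 0, -(qn q 2)⁻¹, 0; (q : k) ^ 2, 0, 0]

/-- An invariant form on `V₂ ⊗ V₂` is a multiple of `formMat`. -/
theorem eq_smul_formMat (hq : IsPrimitiveRoot (q : k) 16) {T : Matrix Unit (Fin 3 × Fin 3) k}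
    (hK : T = T * (weylK q 2 ⊗ₖ weylK q 2))
    (hF : 0 = T * (weylF q 2 ⊗ₖ 1 + weylK q 2 ⊗ₖ weylF q 2)) (i j : Fin 3) :
    T () (i, j) = T () (0, 2) * formMat q i j := by
  have h0 : ∀ i j : Fin 3, (i : ℕ) + j ≠ 2 → T () (i, j) = 0 := by
    intro i j h
    by_contra hT
    have h1 := congrFun (congrFun hK ()) (i, j)
    rw [weylK_two, Matrix.diagonal_kronecker_diagonal, Matrix.mul_diagonal] at h1
    exact h (vertex_weight (l := 1) hq hT (by simpa using h1))
  have hQ : qn q 2 ≠ 0 := qn_ne_zero hq 2 (by norm_num) (by norm_num)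
  have key := fun i j => congrFun (congrFun hF ()) (i, j)
  rw [weylF_two (qn_one hq), weylK_two] at key
  have e1 := key 0 1
  have e2 := key 1 0
  clear key hK hF
  simp [Matrix.mul_apply, Fintype.sum_prod_type, Fin.sum_univ_three, Matrix.one_apply] at e1 e2
  have f11 : T () (1, 1) = -(q : k) ^ 2 * qn q 2 * T () (0, 2) := by linear_combination -e1
  have f20 : T () (2, 0) = (q : k) ^ 2 * T () (0, 2) := mul_left_cancel₀ hQ (by
    linear_combination -e2 - f11)
  fin_cases i <;> fin_cases j <;> first
    | exact (mul_one _).symm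
    | exact f11.trans (mul_comm _ _)
    | exact f20.trans (mul_comm _ _)
    | exact (h0 _ _ (by decide)).trans (mul_zero _).symm

/-- An invariant vector in `V₂ ⊗ V₂` is a multiple of `vecMat`. -/
theorem eq_smul_vecMat (hq : IsPrimitiveRoot (q : k) 16) {T : Matrix (Fin 3 × Fin 3) Unit k}
    (hK : (weylK q 2 ⊗ₖ weylK q 2) * T = T)
    (hF : (weylF q 2 ⊗ₖ 1 + weylK q 2 ⊗ₖ weylF q 2) * T = 0) (i j : Fin 3) :
    T (i, j) () = T (0, 2) () * vecMat q i j := by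
  have h0 : ∀ i j : Fin 3, (i : ℕ) + j ≠ 2 → T (i, j) () = 0 := by
    intro i j h
    by_contra hT
    have h1 := congrFun (congrFun hK (i, j)) ()
    rw [weylK_two, Matrix.diagonal_kronecker_diagonal, Matrix.diagonal_mul] at h1
    exact h (vertex_weight (l := 1) hq hT (by simpa [mul_comm] using h1.symm))
  have hQ : qn q 2 ≠ 0 := qn_ne_zero hq 2 (by norm_num) (by norm_num)
  have key := fun i j => congrFun (congrFun hF (i, j)) ()
  rw [weylF_two (qn_one hq), weylK_two] at key
  have e1 := key 1 2
  have e2 := key 2 1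
  clear key hK hF
  simp [Matrix.mul_apply, Fintype.sum_prod_type, Fin.sum_univ_three, Matrix.one_apply] at e1 e2
  have f11 : T (1, 1) () = -(qn q 2)⁻¹ * T (0, 2) () := by
    rw [neg_mul, ← mul_neg, eq_inv_mul_iff_mul_eq₀ hQ]
    linear_combination e1
  have f20 : T (2, 0) () = (q : k) ^ 2 * T (0, 2) () := by
    have hz : (q : k) ^ 2 * ((q : k) ^ 2)⁻¹ = 1 := mul_inv_cancel₀ (pow_ne_zero 2 q.ne_zero)
    linear_combination (q : k) ^ 2 * (e2 - e1) - T (2, 0) () * hz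
  fin_cases i <;> fin_cases j <;> first
    | exact (mul_one _).symm
    | exact f11.trans (mul_comm _ _)
    | exact f20.trans (mul_comm _ _)
    | exact (h0 _ _ (by decide)).trans (mul_zero _).symm

/-! ### Homomorphisms between `V₂ ⊗ V₂` and `V₁ ⊗ V₁` -/

section Fuse

variable {X Y Z : Corep q}

/-- The homomorphism `X ⊗ Y ⟶ Z ⊗ V₁` which is composed of `Y ⟶ V₁ ⊗ V₁` and `X ⊗ V₁ ⟶ Z`. -/
def fuse (p : X ⊗ fund q ⟶ Z) (i : Y ⟶ fund q ⊗ fund q) : X ⊗ Y ⟶ Z ⊗ fund q :=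
  (X ◁ i ≫ (α_ _ _ _).inv) ≫ p ▷ fund q

/-- The homomorphism `Z ⊗ V₁ ⟶ X ⊗ Y` which is composed of `Z ⟶ X ⊗ V₁` and `V₁ ⊗ V₁ ⟶ Y`. -/
def unfuse (i : Z ⟶ X ⊗ fund q) (p : fund q ⊗ fund q ⟶ Y) : Z ⊗ fund q ⟶ X ⊗ Y :=
  i ▷ fund q ≫ (α_ _ _ _).hom ≫ X ◁ p

theorem mat_fuse (p : X ⊗ fund q ⟶ Z) (i : Y ⟶ fund q ⊗ fund q) (z : Z.ι) (ε : Fin 2) (x : X.ι)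
    (y : Y.ι) : mat (fuse p i) (z, ε) (x, y) = ∑ δ : Fin 2, mat p z (x, δ) * mat i (δ, ε) y :=
  fuse_apply (mat p) (mat i) z ε x y

theorem mat_unfuse (i : Z ⟶ X ⊗ fund q) (p : fund q ⊗ fund q ⟶ Y) (z : Z.ι) (ε : Fin 2) (x : X.ι)
    (y : Y.ι) : mat (unfuse i p) (x, y) (z, ε) = ∑ δ : Fin 2, mat p y (δ, ε) * mat i (x, δ) z :=
  unfuse_apply (mat i) (mat p) z ε x y

end Fuse

variable (hq : IsPrimitiveRoot (q : k) 16)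

/-- The representation `V₂`. -/
abbrev weylTwo : Corep q := weyl hq (show 2 ≤ 7 by norm_num)

/-- The inclusion of `V₂` in `V₁ ⊗ V₁`. -/
def inclTwo : weylTwo hq ⟶ fund q ⊗ fund q :=
  (isWeyl hq (show 1 + 1 ≤ 7 by norm_num)).inclHom ≫ (weylOneIso hq).hom ▷ fund q

/-- The projection of `V₁ ⊗ V₁` onto `V₂`. -/
def projTwo : fund q ⊗ fund q ⟶ weylTwo hq :=
  (weylOneIso hq).inv ▷ fund q ≫ (isWeyl hq (show 1 + 1 ≤ 7 by norm_num)).projHom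

theorem mat_inclTwo : mat (inclTwo hq) = weylIncl q 1 := by
  have h : ((1 : Matrix (Fin 2) (Fin 2) k) ⊗ₖ (1 : Matrix (Fin 2) (Fin 2) k)) * weylIncl q 1 =
      weylIncl q 1 := by
    rw [Matrix.one_kronecker_one, Matrix.one_mul]
  exact h

theorem mat_projTwo : mat (projTwo hq) = weylProj q 1 := by
  have h : weylProj q 1 * ((1 : Matrix (Fin 2) (Fin 2) k) ⊗ₖ (1 : Matrix (Fin 2) (Fin 2) k)) =
      weylProj q 1 := by
    rw [Matrix.one_kronecker_one, Matrix.mul_one]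
  exact h

/-- The homomorphism `V₂ ⊗ V₂ ⟶ V₁ ⊗ V₁` which contracts the inner tensor factors of
`(V₁ ⊗ V₁) ⊗ (V₁ ⊗ V₁)`. -/
def fuseTwo : weylTwo hq ⊗ weylTwo hq ⟶ fund q ⊗ fund q :=
  fuse (bendLeft (inclTwo hq)) (inclTwo hq)

/-- The homomorphism `V₁ ⊗ V₁ ⟶ V₂ ⊗ V₂` which inserts an invariant vector in the middle. -/
def unfuseTwo : fund q ⊗ fund q ⟶ weylTwo hq ⊗ weylTwo hq :=
  unfuse (bendRight (projTwo hq)) (projTwo hq)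

theorem mat_fuseTwo (a ε : Fin 2) (i j : Fin 3) : mat (fuseTwo hq) (a, ε) (i, j) =
    ∑ δ : Fin 2, weylProj' q 1 a (i, δ) * weylIncl q 1 (δ, ε) j := by
  have h : ∀ δ : Fin 2, mat (bendLeft (inclTwo hq)) a (i, δ) = weylProj' q 1 a (i, δ) := fun δ => by
    refine (Verlinde.mat_bendLeft (inclTwo hq) a i δ).trans ?_
    rw [mat_inclTwo]
    fin_cases δ <;> simp [weylProj'] <;> rfl
  refine (mat_fuse (bendLeft (inclTwo hq)) (inclTwo hq) a ε i j).trans ?_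
  rw [mat_inclTwo]
  exact Finset.sum_congr rfl fun δ _ => congrArg (· * _) (h δ)

theorem mat_unfuseTwo (a ε : Fin 2) (i j : Fin 3) : mat (unfuseTwo hq) (i, j) (a, ε) =
    ∑ δ : Fin 2, weylProj q 1 j (δ, ε) * weylIncl' q 1 (i, δ) a := by
  have h : ∀ δ : Fin 2, mat (bendRight (projTwo hq)) (i, δ) a = weylIncl' q 1 (i, δ) a := by
    intro δ
    refine (Verlinde.mat_bendRight (projTwo hq) a i δ).trans ?_
    rw [mat_projTwo]
    fin_cases δ <;> simp [weylIncl', mul_comm] <;> rfl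
  refine (mat_unfuse (bendRight (projTwo hq)) (projTwo hq) a ε i j).trans ?_
  rw [mat_projTwo]
  exact Finset.sum_congr rfl fun δ _ => congrArg (_ * ·) (h δ)

section Nonzero

variable {A : Matrix (Fin 2 × Fin 2) (Fin 3 × Fin 3) k}
  {B : Matrix (Fin 3 × Fin 3) (Fin 2 × Fin 2) k}

/-- The composites of the contraction `V₂ ⊗ V₂ ⟶ V₁ ⊗ V₁` with the projection to `V₂` and with the
invariant form do not vanish. -/
theorem fuse_ne_zero (hQ : qn q 2 ≠ 0) (hA : ∀ a ε i j, A (a, ε) (i, j) =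
    ∑ δ : Fin 2, weylProj' q 1 a (i, δ) * weylIncl q 1 (δ, ε) j) :
    (weylProj q 1 * A) 0 (0, 1) ≠ 0 ∧
      ∑ x : Fin 2 × Fin 2, !![0, -((q⁻¹ : kˣ) : k); 1, 0] x.1 x.2 * A x (0, 2) ≠ 0 := by
  rw [Matrix.mul_apply, Fintype.sum_prod_type, Fintype.sum_prod_type]
  simp only [hA]
  constructor
  · simp [Fin.sum_univ_two, weylProj, weylProj', weylIncl, hQ]
  · simp [Fin.sum_univ_two, weylProj', weylIncl]

/-- The composites of the inclusion of `V₂` and of the invariant vector with the insertion `V₁ ⊗ V₁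
⟶ V₂ ⊗ V₂` do not vanish. -/
theorem unfuse_ne_zero (hQ : qn q 2 ≠ 0) (h1 : qn q 1 = 1) (hB : ∀ a ε i j, B (i, j) (a, ε) =
    ∑ δ : Fin 2, weylProj q 1 j (δ, ε) * weylIncl' q 1 (i, δ) a) :
    (B * weylIncl q 1) (0, 1) 0 ≠ 0 ∧
      ∑ x : Fin 2 × Fin 2, B (0, 2) x * !![0, 1; -(q : k), 0] x.1 x.2 ≠ 0 := by
  rw [Matrix.mul_apply, Fintype.sum_prod_type, Fintype.sum_prod_type]
  simp only [hB]
  constructor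
  · simp [Fin.sum_univ_two, weylProj, weylIncl', weylIncl, hQ, h1]
  · simp [Fin.sum_univ_two, weylProj, weylIncl', hQ]

end Nonzero

end Adjoint

section TrivalentTwo

open Corep
open scoped Kronecker

variable {k : Type} [Field k] {q : kˣ} (hq : IsPrimitiveRoot (q : k) 16)

/-- An endomorphism of `V₂` is the scalar given by its first matrix entry. -/
theorem weylTwo_end (f : weylTwo hq ⟶ weylTwo hq) :
    f = mat f (0 : Fin 3) (0 : Fin 3) • 𝟙 (weylTwo hq) := by
  obtain ⟨c, rfl⟩ := weyl_end_eq_smul hq (show 2 ≤ 7 by norm_num) f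
  congr 1
  exact (mul_one c).symm

theorem weylTwo_K : (weylTwo hq ⊗ weylTwo hq).Kmat = weylK q 2 ⊗ₖ weylK q 2 := by
  rw [Kmat_tensor, (weyl_actions hq _).1]

theorem weylTwo_F : (weylTwo hq ⊗ weylTwo hq).Fmat = weylF q 2 ⊗ₖ 1 + weylK q 2 ⊗ₖ weylF q 2 := by
  rw [Fmat_tensor, (weyl_actions hq _).1, (weyl_actions hq _).2.2]
  rfl

/-- The space of homomorphisms `V₂ ⊗ V₂ ⟶ V₂` is at most one-dimensional. -/
theorem mat_eq_smul_vertexMat (f : weylTwo hq ⊗ weylTwo hq ⟶ weylTwo hq) :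
    mat f = mat f (0 : Fin 3) ((0, 1) : Fin 3 × Fin 3) • vertexMat q := by
  have hK := Kmat_mul_mat f
  have hF := Fmat_mul_mat f
  rw [weylTwo_K, (weyl_actions hq _).1] at hK
  rw [weylTwo_F, (weyl_actions hq _).2.2] at hF
  exact eq_smul_vertexMat hq hK hF

/-- The space of homomorphisms `V₂ ⟶ V₂ ⊗ V₂` is at most one-dimensional. -/
theorem mat_eq_smul_vertexMat' (f : weylTwo hq ⟶ weylTwo hq ⊗ weylTwo hq) :
    mat f = mat f ((0, 1) : Fin 3 × Fin 3) (0 : Fin 3) • vertexMat' q := by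
  have hK := Kmat_mul_mat f
  have hF := Fmat_mul_mat f
  rw [weylTwo_K, (weyl_actions hq _).1] at hK
  rw [weylTwo_F, (weyl_actions hq _).2.2] at hF
  exact eq_smul_vertexMat' hq hK hF

theorem mat_eq_mul_formMat (f : weylTwo hq ⊗ weylTwo hq ⟶ 𝟙_ (Corep q)) (i j : Fin 3) :
    mat f () ((i, j) : Fin 3 × Fin 3) = mat f () ((0, 2) : Fin 3 × Fin 3) * formMat q i j := by
  have hK := Kmat_mul_mat f
  have hF := Fmat_mul_mat f
  rw [weylTwo_K, Kmat_unit] at hK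
  rw [weylTwo_F, Fmat_unit] at hF
  exact eq_smul_formMat hq ((Matrix.one_mul (m := Unit) (mat f)).symm.trans hK)
    ((Matrix.zero_mul (mat f)).symm.trans hF) i j

theorem mat_eq_mul_vecMat (f : 𝟙_ (Corep q) ⟶ weylTwo hq ⊗ weylTwo hq) (i j : Fin 3) :
    mat f ((i, j) : Fin 3 × Fin 3) () = mat f ((0, 2) : Fin 3 × Fin 3) () * vecMat q i j := by
  have hK := Kmat_mul_mat f
  have hF := Fmat_mul_mat f
  rw [weylTwo_K, Kmat_unit] at hK
  rw [weylTwo_F, Fmat_unit] at hF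
  exact eq_smul_vecMat hq (hK.trans (Matrix.mul_one (n := Unit) (mat f)))
    (hF.trans (Matrix.mul_zero (mat f))) i j

include hq in
theorem one_add_pow_four_ne_zero : 1 + (q : k) ^ 4 ≠ 0 := by
  intro h
  have h1 : (q : k) ^ 8 = 1 := by linear_combination ((q : k) ^ 4 - 1) * h
  exact absurd ((hq.pow_eq_one_iff_dvd 8).1 h1) (by norm_num)

/-- The bubble: the factor in the composite of the two vertices. -/
theorem vertexMat_mul_vertexMat' : (vertexMat q * vertexMat' q) 0 0 = 1 + (q : k) ^ 4 := by
  rw [Matrix.mul_apply, Fintype.sum_prod_type]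
  simp [Fin.sum_univ_three, vertexMat, vertexMat']
  ring

/-- The scalar by which the composite of four vertices acts on `V₂`. -/
theorem vertexMat_tetrahedron (hQ : qn q 2 ≠ 0) :
    ((vertexMat q * ((1 : Matrix (Fin 3) (Fin 3) k) ⊗ₖ vertexMat q)) *
      perm k (Equiv.prodAssoc (Fin 3) (Fin 3) (Fin 3)) *
      (vertexMat' q ⊗ₖ (1 : Matrix (Fin 3) (Fin 3) k)) * vertexMat' q) 0 0 =
        (1 + (q : k) ^ 4) * (1 - (q : k) ^ 2 + (q : k) ^ 4) := by
  rw [tetrahedron_apply]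
  simp [Fin.sum_univ_three, vertexMat, vertexMat']
  field_simp
  ring

/-- The representation `V₂` occurs once in its tensor square, with invariant
`(1 - q² + q⁴) / (1 + q⁴) = ([3] - 2) / ([3] - 1)`. -/
theorem isTrivalent_weylTwo :
    IsTrivalent (weylTwo hq) ((1 - (q : k) ^ 2 + (q : k) ^ 4) / (1 + (q : k) ^ 4)) := by
  have hQ : qn q 2 ≠ 0 := qn_ne_zero hq 2 (by norm_num) (by norm_num)
  have hκ := one_add_pow_four_ne_zero hq
  -- By uniqueness, any non-zero homomorphism can be rescaled to have coefficients `vertexMat`.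
  obtain ⟨m, hm⟩ : ∃ m : weylTwo hq ⊗ weylTwo hq ⟶ weylTwo hq, mat m = vertexMat q := by
    have h0 := (fuse_ne_zero hQ (mat_fuseTwo hq)).1
    rw [← mat_projTwo hq] at h0
    have h1 := mat_eq_smul_vertexMat hq (fuseTwo hq ≫ projTwo hq)
    refine ⟨(mat (fuseTwo hq ≫ projTwo hq) (0 : Fin 3) ((0, 1) : Fin 3 × Fin 3))⁻¹ •
      (fuseTwo hq ≫ projTwo hq), ?_⟩
    exact (congrArg (fun T : Matrix (Fin 3) (Fin 3 × Fin 3) k => _ • T) h1).trans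
      (inv_smul_smul₀ h0 (vertexMat q))
  obtain ⟨m', hm'⟩ : ∃ m' : weylTwo hq ⟶ weylTwo hq ⊗ weylTwo hq, mat m' = vertexMat' q := by
    have h0 := (unfuse_ne_zero hQ (qn_one hq) (mat_unfuseTwo hq)).1
    rw [← mat_inclTwo hq] at h0
    have h1 := mat_eq_smul_vertexMat' hq (inclTwo hq ≫ unfuseTwo hq)
    refine ⟨(mat (inclTwo hq ≫ unfuseTwo hq) ((0, 1) : Fin 3 × Fin 3) (0 : Fin 3))⁻¹ •
      (inclTwo hq ≫ unfuseTwo hq), ?_⟩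
    exact (congrArg (fun T : Matrix (Fin 3 × Fin 3) (Fin 3) k => _ • T) h1).trans
      (inv_smul_smul₀ h0 (vertexMat' q))
  have h1 : m' ≫ m = (1 + (q : k) ^ 4) • 𝟙 _ := by
    rw [weylTwo_end hq (m' ≫ m), mat_comp, hm, hm']
    congr 1
    exact vertexMat_mul_vertexMat'
  have h2 : m' ≫ m' ▷ _ ≫ (α_ _ _ _).hom ≫ _ ◁ m ≫ m =
      ((1 + (q : k) ^ 4) * (1 - (q : k) ^ 2 + (q : k) ^ 4)) • 𝟙 _ := by
    rw [weylTwo_end hq (m' ≫ m' ▷ _ ≫ (α_ _ _ _).hom ≫ _ ◁ m ≫ m)]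
    simp only [mat_comp, mat_whiskerLeft, mat_whiskerRight, hm, hm']
    congr 1
    exact vertexMat_tetrahedron hQ
  refine ⟨m, (1 + (q : k) ^ 4)⁻¹ • m', ?_,
    fun f => ⟨mat f (0 : Fin 3) ((0, 1) : Fin 3 × Fin 3), hom_ext ?_⟩, fun f => ?_, ?_⟩
  · rw [Linear.smul_comp, h1, smul_smul, inv_mul_cancel₀ hκ, one_smul]
  · rw [mat_smul, hm]
    exact mat_eq_smul_vertexMat hq f
  · refine ⟨mat f ((0, 1) : Fin 3 × Fin 3) (0 : Fin 3) * (1 + (q : k) ^ 4), hom_ext ?_⟩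
    rw [smul_smul, mul_assoc, mul_inv_cancel₀ hκ, mul_one, mat_smul, hm']
    exact mat_eq_smul_vertexMat' hq f
  · rw [MonoidalLinear.smul_whiskerRight, Linear.smul_comp, Linear.smul_comp, Linear.comp_smul, h2,
      smul_smul, smul_smul]
    congr 1
    field_simp

theorem formMat_mul_vecMat (hQ : qn q 2 ≠ 0) :
    formMat q * vecMat q = (q : k) ^ 2 • 1 ∧ vecMat q * formMat q = (q : k) ^ 2 • 1 := by
  constructor <;> ext i j <;> fin_cases i <;> fin_cases j <;>
    simp [Matrix.mul_apply, Fin.sum_univ_three, formMat, vecMat, hQ]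
  field_simp

include hq in
theorem qn_three : qn q 3 = ((q : k) ^ 2)⁻¹ * (1 + (q : k) ^ 2 + (q : k) ^ 4) := by
  have h := sub_inv_ne_zero hq
  rw [qn_succ q h, qn_two hq]
  have hz := q.ne_zero
  rw [Units.val_inv_eq_inv_val]
  field_simp
  ring

/-- The representation `V₂` is self-dual, and its loop is its quantum dimension. -/
theorem exists_pairing_weylTwo : ∃ e : ExactPairing (weylTwo hq) (weylTwo hq),
    e.coevaluation' ≫ e.evaluation' = qn q 3 • 𝟙 (𝟙_ (Corep q)) := by
  have hQ : qn q 2 ≠ 0 := qn_ne_zero hq 2 (by norm_num) (by norm_num)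
  have hz : (q : k) ^ 2 ≠ 0 := pow_ne_zero 2 q.ne_zero
  obtain ⟨b, hb⟩ : ∃ b : weylTwo hq ⊗ weylTwo hq ⟶ 𝟙_ (Corep q),
      ∀ i j : Fin 3, mat b () ((i, j) : Fin 3 × Fin 3) = formMat q i j := by
    have h0 : mat (fuseTwo hq ≫ cap q) () ((0, 2) : Fin 3 × Fin 3) ≠ 0 :=
      (fuse_ne_zero hQ (mat_fuseTwo hq)).2
    refine ⟨(mat (fuseTwo hq ≫ cap q) () ((0, 2) : Fin 3 × Fin 3))⁻¹ • (fuseTwo hq ≫ cap q),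
      fun i j => ?_⟩
    refine (congrArg (_ * ·) (mat_eq_mul_formMat hq (fuseTwo hq ≫ cap q) i j)).trans ?_
    exact inv_mul_cancel_left₀ h0 _
  obtain ⟨a, ha⟩ : ∃ a : 𝟙_ (Corep q) ⟶ weylTwo hq ⊗ weylTwo hq,
      ∀ i j : Fin 3, mat a ((i, j) : Fin 3 × Fin 3) () = ((q : k) ^ 2)⁻¹ * vecMat q i j := by
    have h0 : mat (cup q ≫ unfuseTwo hq) ((0, 2) : Fin 3 × Fin 3) () ≠ 0 :=
      (unfuse_ne_zero hQ (qn_one hq) (mat_unfuseTwo hq)).2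
    refine ⟨((q : k) ^ 2)⁻¹ • (mat (cup q ≫ unfuseTwo hq) ((0, 2) : Fin 3 × Fin 3) ())⁻¹ •
      (cup q ≫ unfuseTwo hq), fun i j => ?_⟩
    refine (congrArg (fun x => _ * (_ * x))
      (mat_eq_mul_vecMat hq (cup q ≫ unfuseTwo hq) i j)).trans ?_
    exact congrArg (_ * ·) (inv_mul_cancel_left₀ h0 _)
  have h1 : (Matrix.of fun i j => mat a ((i, j) : Fin 3 × Fin 3) ()) =
      ((q : k) ^ 2)⁻¹ • vecMat q := by
    ext i j
    exact ha i j
  have h2 : (Matrix.of fun i j => mat b () ((i, j) : Fin 3 × Fin 3)) = formMat q := by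
    ext i j
    exact hb i j
  have h3 : (Matrix.of fun i j => mat a ((i, j) : Fin 3 × Fin 3) ()) *
      (Matrix.of fun i j => mat b () ((i, j) : Fin 3 × Fin 3)) = 1 := by
    rw [h1, h2, Matrix.smul_mul, (formMat_mul_vecMat hQ).2, inv_smul_smul₀ hz]
  have h4 : (Matrix.of fun i j => mat b () ((i, j) : Fin 3 × Fin 3)) *
      (Matrix.of fun i j => mat a ((i, j) : Fin 3 × Fin 3) ()) = 1 := by
    rw [h1, h2, Matrix.mul_smul, (formMat_mul_vecMat hQ).1, inv_smul_smul₀ hz]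
  refine ⟨pairingOf a b h3 h4, ?_⟩
  change a ≫ b = _
  rw [unit_hom_eq (a ≫ b)]
  congr 1
  have h5 : ∑ x : Fin 3 × Fin 3, mat b () x * mat a x () = qn q 3 := by
    simp only [Fintype.sum_prod_type, ha, hb]
    rw [qn_three hq]
    simp [Fin.sum_univ_three, formMat, vecMat]
    field_simp
  exact h5

end TrivalentTwo

section Transfer

variable {k : Type} [Field k] {C : Type u} [Category.{v} C] [Preadditive C] [Linear k C]
  [MonoidalCategory C]

theorem IsTrivalent.fullSubcategory {P : ObjectProperty C} [P.IsMonoidal] {X : P.FullSubcategory}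
    {t : k} (h : IsTrivalent X.obj t) : IsTrivalent X t := by
  obtain ⟨m, m', h1, h2, h3, h4⟩ := h
  let n : X ⊗ X ⟶ X := ObjectProperty.homMk m
  let n' : X ⟶ X ⊗ X := ObjectProperty.homMk m'
  refine ⟨n, n', ObjectProperty.hom_ext _ h1, fun f => ?_, fun f => ?_, ObjectProperty.hom_ext _ h4⟩
  · obtain ⟨c, hc⟩ := h2 f.hom
    exact ⟨c, ObjectProperty.hom_ext _ hc⟩
  · obtain ⟨c, hc⟩ := h3 f.hom
    exact ⟨c, ObjectProperty.hom_ext _ hc⟩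

omit [Preadditive C] in
/-- The loop of a self-dual object is invariant under isomorphisms. -/
theorem exists_pairing_of_iso {X Y : C} (φ : X ≅ Y) (e : ExactPairing Y Y) :
    ∃ e' : ExactPairing X X,
      e'.coevaluation' ≫ e'.evaluation' = e.coevaluation' ≫ e.evaluation' := by
  refine ⟨@exactPairingCongr _ _ _ _ _ _ _ e φ φ, ?_⟩
  change ((e.coevaluation' ≫ Y ◁ φ.inv) ≫ φ.inv ▷ X) ≫ X ◁ φ.hom ≫ φ.hom ▷ Y ≫ e.evaluation' = _
  simp [← whisker_exchange_assoc]

variable [MonoidalPreadditive C] [MonoidalLinear k C]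

theorem IsTrivalent.proj {X : C} {t : k} (h : IsTrivalent X t) :
    IsTrivalent (⟨X⟩ : NegligibleQuotient k C) t := by
  obtain ⟨m, m', h1, h2, h3, h4⟩ := h
  let n : (⟨X⟩ : NegligibleQuotient k C) ⊗ ⟨X⟩ ⟶ ⟨X⟩ := NegligibleQuotient.proj m
  let n' : (⟨X⟩ : NegligibleQuotient k C) ⟶ ⟨X⟩ ⊗ ⟨X⟩ := NegligibleQuotient.proj m'
  refine ⟨n, n', congrArg (NegligibleQuotient.proj (k := k)) h1, fun f => ?_, fun f => ?_,
    congrArg (NegligibleQuotient.proj (k := k)) h4⟩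
  · obtain ⟨g, rfl⟩ := NegligibleQuotient.proj_surjective f
    obtain ⟨c, hc⟩ := h2 g
    exact ⟨c, congrArg (NegligibleQuotient.proj (k := k)) hc⟩
  · obtain ⟨g, rfl⟩ := NegligibleQuotient.proj_surjective f
    obtain ⟨c, hc⟩ := h3 g
    exact ⟨c, congrArg (NegligibleQuotient.proj (k := k)) hc⟩

end Transfer

section EvenTwo

variable {k : Type} [Field k] {q : kˣ} (hq : IsPrimitiveRoot (q : k) 16)

/-- The object `V_n` of the even part, for even `n`. -/
def evenObj {n : ℕ} (hn : n ≤ 7) (h : n % 2 = 0) : EvenVerlinde q :=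
  ⟨vObj hq hn, isEven_vObj hq hn h⟩

/-- The object `V₂` of the even part. -/
abbrev evenTwo : EvenVerlinde q := evenObj hq (show 2 ≤ 7 by norm_num) rfl

theorem isTrivalent_evenTwo :
    IsTrivalent (evenTwo hq) ((1 - (q : k) ^ 2 + (q : k) ^ 4) / (1 + (q : k) ^ 4)) :=
  ((isTrivalent_weylTwo hq).fullSubcategory (X := weylT hq _)).proj.fullSubcategory
    (X := evenTwo hq)

theorem exists_pairing_evenTwo : ∃ e : ExactPairing (evenTwo hq) (evenTwo hq),
    e.coevaluation' ≫ e.evaluation' = qn q 3 • 𝟙 (𝟙_ (EvenVerlinde q)) := by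
  obtain ⟨e, he⟩ := exists_pairing_weylTwo hq
  let e₁ : ExactPairing (weylT hq (show 2 ≤ 7 by norm_num)) (weylT hq (show 2 ≤ 7 by norm_num)) :=
    fullSubcategoryPairing _ _ _ e
  let e₂ : ExactPairing (vObj hq (show 2 ≤ 7 by norm_num)) (vObj hq (show 2 ≤ 7 by norm_num)) :=
    NegligibleQuotient.projPairing e₁
  have h1 : e₁.coevaluation' ≫ e₁.evaluation' = qn q 3 • 𝟙 (𝟙_ (Tilting q)) :=
    ObjectProperty.hom_ext _ he
  exact ⟨fullSubcategoryPairing _ _ _ e₂,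
    ObjectProperty.hom_ext _ (congrArg (NegligibleQuotient.proj (k := k)) h1)⟩

theorem evenObj_end {n : ℕ} (hn : n ≤ 7) (h : n % 2 = 0) (f : evenObj hq hn h ⟶ evenObj hq hn h) :
    ∃ c : k, f = c • 𝟙 _ := by
  obtain ⟨c, hc⟩ := vObj_end hq _ f.hom
  exact ⟨c, ObjectProperty.hom_ext _ hc⟩

theorem evenObj_id_ne_zero {n : ℕ} (hn : n ≤ 7) (h : n % 2 = 0) : 𝟙 (evenObj hq hn h) ≠ 0 :=
  fun h0 => vObj_id_ne_zero hq hn (by omega) (congrArg (fun f => f.hom) h0)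

include hq in
theorem even_unit_id_ne_zero : 𝟙 (𝟙_ (EvenVerlinde q)) ≠ 0 := fun h =>
  unit_id_ne_zero hq (congrArg (fun f => f.hom) h)

/-- The amplitudes of the self-dual object `V₂`. If the composite of `m` and its dual is
the scalar `a`, they are `a [3]` and `a² t [3]`. -/
theorem amplitudes [IsAlgClosed k] {t c : k}
    (ht : t = (1 - (q : k) ^ 2 + (q : k) ^ 4) / (1 + (q : k) ^ 4)) (hc : c = t * qn q 3)
    {X : EvenVerlinde q} (φ : X ≅ evenTwo hq) :
    (∃ (_ : ExactPairing X X) (m : X ⊗ X ⟶ X), dualVertex m ≫ m = 𝟙 X) ∧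
      ∀ (_ : ExactPairing X X) (m : X ⊗ X ⟶ X),
        (m ≠ 0 → ampT2 m ≠ 0) ∧
        (dualVertex m ≫ m = 𝟙 X → ampT4 m = c • 𝟙 (𝟙_ (EvenVerlinde q))) ∧
        (ampT2 m = 𝟙 _ → ampT4 m = (c / qn q 3 ^ 2) • 𝟙 (𝟙_ (EvenVerlinde q))) := by
  have hD := qn_ne_zero hq 3 (by norm_num) (by norm_num)
  have h1 := even_unit_id_ne_zero hq
  have hX0 : 𝟙 X ≠ 0 := id_ne_zero_of_iso φ.symm (evenObj_id_ne_zero hq _ _)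
  have hX := exists_smul_id_of_iso φ.symm (evenObj_end hq (show 2 ≤ 7 by norm_num) rfl)
  have htri : IsTrivalent X t := ht ▸ (isTrivalent_evenTwo hq).of_iso φ.symm
  obtain ⟨e, he⟩ : ∃ e : ExactPairing X X,
      e.coevaluation' ≫ e.evaluation' = qn q 3 • 𝟙 (𝟙_ (EvenVerlinde q)) := by
    obtain ⟨e₀, he₀⟩ := exists_pairing_evenTwo hq
    obtain ⟨e, he⟩ := exists_pairing_of_iso φ e₀
    exact ⟨e, he.trans he₀⟩
  refine ⟨⟨e, ?_⟩, fun e' m => ?_⟩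
  · obtain ⟨⟨m, ν, hν, h⟩, -⟩ := htri.exists_factor hX0 e he
    obtain ⟨z, hz⟩ := IsAlgClosed.exists_pow_nat_eq ν⁻¹ (n := 2) (by norm_num)
    refine ⟨z • m, ?_⟩
    rw [h, hz, inv_mul_cancel₀ hν, one_smul]
  · obtain ⟨a, h2, h3, h4, h5⟩ := (htri.exists_factor hX0 e'
      ((loop_unique hX hX0 e e').trans he)).2 m
    have cancel : ∀ {Y : EvenVerlinde q} {b : k}, 𝟙 Y ≠ 0 → b • 𝟙 Y = 𝟙 Y → b = 1 := by
      intro Y b hY hb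
      have : (b - 1) • 𝟙 Y = 0 := by rw [sub_smul, hb, one_smul, sub_self]
      exact sub_eq_zero.1 ((smul_eq_zero.1 this).resolve_right hY)
    refine ⟨fun hm => ?_, fun hm => ?_, fun hm => ?_⟩
    · rw [h4]
      exact smul_ne_zero (mul_ne_zero (h2 hm) hD) h1
    · rw [h5, cancel hX0 (h3.symm.trans hm), one_pow, one_mul, hc]
    · have h6 := cancel h1 (h4.symm.trans hm)
      rw [h5, hc]
      congr 1
      field_simp
      linear_combination t * (a * qn q 3 + 1) * h6

end EvenTwo

/-! ### Extension of scalars -/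

section ScalarExtension

universe v' u'

variable {R S : Type} [CommRing R] [CommRing S] {φ : R →+* S}
  {C : Type u} [Category.{v} C] [Preadditive C] [Linear R C]
  {D : Type u'} [Category.{v'} D] [Preadditive D] [Linear S D] {F : C ⥤ D}

namespace IsScalarExtension

section

variable (h : IsScalarExtension φ F)
include h

theorem map_add {X Y : C} (f g : X ⟶ Y) : F.map (f + g) = F.map f + F.map g := by
  let : Algebra R S := φ.toAlgebra
  let : Module R (F.obj X ⟶ F.obj Y) := Module.compHom _ φ
  obtain ⟨l, hl, -⟩ := h.2 X Y
  rw [← hl, ← hl, ← hl]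
  exact l.map_add f g

theorem map_smul {X Y : C} (r : R) (f : X ⟶ Y) : F.map (r • f) = φ r • F.map f := by
  let : Algebra R S := φ.toAlgebra
  let : Module R (F.obj X ⟶ F.obj Y) := Module.compHom _ φ
  obtain ⟨l, hl, -⟩ := h.2 X Y
  rw [← hl, ← hl]
  exact l.map_smul r f

theorem map_zero {X Y : C} : F.map (0 : X ⟶ Y) = 0 := by
  rw [← zero_smul R (0 : X ⟶ Y), h.map_smul, _root_.map_zero, zero_smul]

/-- All morphisms between objects in the image are linear combinations of images of morphisms. -/
theorem induction {X Y : C} {motive : (F.obj X ⟶ F.obj Y) → Prop} (f : F.obj X ⟶ F.obj Y)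
    (zero : motive 0) (map : ∀ g : X ⟶ Y, motive (F.map g))
    (smul : ∀ (s : S) f, motive f → motive (s • f))
    (add : ∀ f g, motive f → motive g → motive (f + g)) : motive f := by
  let : Algebra R S := φ.toAlgebra
  let : Module R (F.obj X ⟶ F.obj Y) := Module.compHom _ φ
  have : IsScalarTower R S (F.obj X ⟶ F.obj Y) := ⟨fun r s f => mul_smul (φ r) s f⟩
  obtain ⟨l, hl, hb⟩ := h.2 X Y
  exact hb.inductionOn f motive zero (fun g => hl g ▸ map g) smul add

/-- If all morphisms `X ⟶ Y` are multiples of `g₀`, then the same holds after extension of scalars.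
-/
theorem exists_smul {X Y : C} {g₀ : X ⟶ Y} (hg : ∀ g : X ⟶ Y, ∃ r : R, g = r • g₀)
    (f : F.obj X ⟶ F.obj Y) : ∃ s : S, f = s • F.map g₀ := by
  refine h.induction (motive := fun f => ∃ s : S, f = s • F.map g₀) f ⟨0, (zero_smul S _).symm⟩
    (fun g => ?_) (fun s f hf => ?_) fun f g hf hg => ?_
  · obtain ⟨r, rfl⟩ := hg g
    exact ⟨φ r, h.map_smul r g₀⟩
  · obtain ⟨s', rfl⟩ := hf
    exact ⟨s * s', smul_smul _ _ _⟩
  · obtain ⟨s, rfl⟩ := hf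
    obtain ⟨s', rfl⟩ := hg
    exact ⟨s + s', (add_smul _ _ _).symm⟩

theorem eq_zero {X Y : C} (hg : ∀ g : X ⟶ Y, g = 0) (f : F.obj X ⟶ F.obj Y) : f = 0 := by
  obtain ⟨s, hs⟩ := h.exists_smul (g₀ := 0) (fun g => ⟨0, by rw [hg g, smul_zero]⟩) f
  rw [hs, h.map_zero, smul_zero]

/-- Objects with endomorphism ring `R` do not become zero. -/
theorem id_ne_zero [Nontrivial S] {X : C} (hX : Function.Bijective fun r : R => r • 𝟙 X) :
    𝟙 (F.obj X) ≠ 0 := by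
  let : Algebra R S := φ.toAlgebra
  let : Module R (F.obj X ⟶ F.obj X) := Module.compHom _ φ
  have : IsScalarTower R S (F.obj X ⟶ F.obj X) := ⟨fun r s f => mul_smul (φ r) s f⟩
  obtain ⟨l, hl, hb⟩ := h.2 X X
  let e : R ≃ₗ[R] (X ⟶ X) := LinearEquiv.ofBijective (LinearMap.toSpanSingleton R _ (𝟙 X)) hX
  have h1 : e.symm (𝟙 X) = 1 := by
    rw [LinearEquiv.symm_apply_eq]
    exact (one_smul R (𝟙 X)).symm
  have h2 := hb.lift_eq ((Algebra.linearMap R S).comp e.symm.toLinearMap) (𝟙 X)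
  rw [hl, F.map_id] at h2
  intro h0
  rw [h0, _root_.map_zero] at h2
  refine zero_ne_one (α := S) (h2.trans ?_)
  change algebraMap R S (e.symm (𝟙 X)) = 1
  rw [h1, map_one]

end

variable [MonoidalCategory C] [MonoidalCategory D]

open Functor.LaxMonoidal Functor.OplaxMonoidal

omit [Preadditive C] [Preadditive D] in
/-- Monoidal functors are compatible with the composite in the definition of `IsTrivalent`. -/
theorem map_tetrahedron [F.Monoidal] {X : C} (i : X ⟶ X ⊗ X) (p : X ⊗ X ⟶ X) :
    (F.map i ≫ δ F X X) ≫ (F.map i ≫ δ F X X) ▷ F.obj X ≫ (α_ _ _ _).hom ≫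
        F.obj X ◁ (μ F X X ≫ F.map p) ≫ μ F X X ≫ F.map p =
      F.map (i ≫ i ▷ X ≫ (α_ X X X).hom ≫ X ◁ p ≫ p) := by
  simp only [comp_whiskerRight, Category.assoc, MonoidalCategory.whiskerLeft_comp, Functor.map_comp]
  rw [δ_natural_left_assoc, Functor.OplaxMonoidal.associativity_assoc]
  simp

/-- Extension of scalars preserves trivalent objects and their invariants. -/
theorem isTrivalent_map [F.Monoidal] (h : IsScalarExtension φ F) [MonoidalPreadditive D]
    [MonoidalLinear S D] {X : C} {t : R} (ht : IsTrivalent X t) : IsTrivalent (F.obj X) (φ t) := by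
  obtain ⟨m, m', h1, h2, h3, h4⟩ := ht
  refine ⟨μ F X X ≫ F.map m, F.map m' ≫ δ F X X, ?_, fun f => ?_, fun f => ?_, ?_⟩
  · simp [← F.map_comp, h1]
  · obtain ⟨c, hc⟩ := h.exists_smul h2 (δ F X X ≫ f)
    exact ⟨c, by rw [← Linear.comp_smul, ← hc, Functor.Monoidal.μ_δ_assoc]⟩
  · obtain ⟨c, hc⟩ := h.exists_smul h3 (f ≫ μ F X X)
    exact ⟨c, by rw [← Linear.smul_comp, ← hc, Category.assoc, Functor.Monoidal.μ_δ,
      Category.comp_id]⟩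
  · rw [map_tetrahedron, h4, h.map_smul, F.map_id]

end IsScalarExtension

end ScalarExtension

section Integrality

universe v' u'

variable {O K : Type} [CommRing O] [Field K] {ψ : O →+* K}
  {C : Type u} [Category.{v} C] [Preadditive C] [Linear O C] [MonoidalCategory C]
  {E : Type u'} [Category.{v'} E] [Preadditive E] [Linear K E] [MonoidalCategory E]
  {G : C ⥤ E}

omit [MonoidalCategory C] [MonoidalCategory E] in
/-- Objects with scalar endomorphisms come from members of a simple family. -/
theorem IsScalarExtension.exists_iso (h : IsScalarExtension ψ G) {S : Set C}
    (hS : IsSimpleFamily O S) {Y : E} (hY : ∀ f : Y ⟶ Y, ∃ c : K, f = c • 𝟙 Y) (hY0 : 𝟙 Y ≠ 0) :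
    ∃ X ∈ S, Nonempty (G.obj X ≅ Y) := by
  have := h.1
  let e : G.obj (G.objPreimage Y) ≅ Y := G.objObjPreimageIso Y
  obtain ⟨n, X, hX, i, p, h1, -, h3⟩ := hS.exists_sum (G.objPreimage Y)
  let A : (G.objPreimage Y ⟶ G.objPreimage Y) →+ (Y ⟶ Y) :=
    { toFun f := e.inv ≫ G.map f ≫ e.hom
      map_zero' := by rw [h.map_zero]; simp
      map_add' f g := by rw [h.map_add]; simp }
  have h4 : ∑ a, A (p a ≫ i a) ≠ 0 := by
    rw [← _root_.map_sum, h3]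
    change e.inv ≫ G.map (𝟙 _) ≫ e.hom ≠ 0
    simpa using hY0
  -- Some summand is non-zero, hence all of `Y`, as the endomorphisms of `Y` are scalars.
  obtain ⟨a, -, ha⟩ := Finset.exists_ne_zero_of_sum_ne_zero h4
  obtain ⟨c, hc⟩ := hY (A (p a ≫ i a))
  have hc0 : c ≠ 0 := by
    rintro rfl
    exact ha (hc.trans (zero_smul _ _))
  have h5 : (G.map (i a) ≫ e.hom) ≫ e.inv ≫ G.map (p a) = 𝟙 _ := by
    simp [← G.map_comp, h1]
  have h6 : (e.inv ≫ G.map (p a)) ≫ G.map (i a) ≫ e.hom = c • 𝟙 Y := by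
    rw [← hc]
    change _ = e.inv ≫ G.map (p a ≫ i a) ≫ e.hom
    simp
  have h7 : c • 𝟙 Y = 𝟙 Y := by
    have h8 : (c • 𝟙 Y) ≫ (c • 𝟙 Y) = c • 𝟙 Y := by
      have h10 : G.map (i a) ≫ G.map (p a) = 𝟙 _ := by rw [← G.map_comp, h1, G.map_id]
      rw [← h6]
      simp [reassoc_of% h10]
    have h9 := congrArg (fun f => c⁻¹ • f) h8
    simpa [smul_smul, hc0] using h9
  exact ⟨X a, hX a, ⟨⟨_, _, h5, h6.trans h7⟩⟩⟩

open Functor.LaxMonoidal Functor.OplaxMonoidal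

/-- If a tensor category over a field is defined over a ring `O`, then the invariants of its
trivalent objects with scalar endomorphisms belong to `O`. -/
theorem IsScalarExtension.exists_of_isTrivalent [MonoidalPreadditive E] [MonoidalLinear K E]
    [G.Monoidal] (h : IsScalarExtension ψ G) {S : Set C}
    (hS : IsSimpleFamily O S) {Y : E} (hY : ∀ f : Y ⟶ Y, ∃ c : K, f = c • 𝟙 Y) (hY0 : 𝟙 Y ≠ 0)
    {t : K} (ht : IsTrivalent Y t) : ∃ τ : O, ψ τ = t := by
  obtain ⟨X, hX, ⟨e⟩⟩ := h.exists_iso hS hY hY0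
  have hW0 : 𝟙 (G.obj X) ≠ 0 := id_ne_zero_of_iso e.symm hY0
  obtain ⟨m, m', h1, h2, h3, h4⟩ := ht.of_iso e.symm
  obtain ⟨n, Z, hZ, i, p, h5, -, h6⟩ := hS.exists_sum (X ⊗ X)
  -- Some simple summand of `X ⊗ X` supports the embedding `m'`, and it must be `X`.
  obtain ⟨b, hb⟩ : ∃ b, m' ≫ μ G X X ≫ G.map (p b) ≠ 0 := by
    by_contra! h0
    let A : (X ⊗ X ⟶ X ⊗ X) →+ (G.obj X ⟶ G.obj X) :=
      { toFun f := m' ≫ μ G X X ≫ G.map f ≫ δ G X X ≫ m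
        map_zero' := by rw [h.map_zero]; simp
        map_add' f g := by rw [h.map_add]; simp }
    have h7 : A (𝟙 _) = 𝟙 _ := by
      change m' ≫ μ G X X ≫ G.map (𝟙 _) ≫ δ G X X ≫ m = _
      simp [h1]
    rw [← h6, _root_.map_sum] at h7
    refine hW0 (h7.symm.trans (Finset.sum_eq_zero fun a _ => ?_))
    change m' ≫ μ G X X ≫ G.map (p a ≫ i a) ≫ δ G X X ≫ m = _
    rw [G.map_comp, Category.assoc, reassoc_of% h0 a, zero_comp]
  have hZX : Z b = X := by
    by_contra hne
    exact hb (h.eq_zero (hS.hom_eq_zero X hX _ (hZ b) (Ne.symm hne)) _)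
  obtain ⟨i, p, hip⟩ : ∃ (i : X ⟶ X ⊗ X) (p : X ⊗ X ⟶ X), i ≫ p = 𝟙 X := by
    have key : ∀ {Z' : C} (i : Z' ⟶ X ⊗ X) (p : X ⊗ X ⟶ Z'), i ≫ p = 𝟙 Z' → Z' = X →
        ∃ (i : X ⟶ X ⊗ X) (p : X ⊗ X ⟶ X), i ≫ p = 𝟙 X := by
      rintro _ i p hip rfl
      exact ⟨i, p, hip⟩
    exact key _ _ (h5 b) hZX
  -- Over the field, `i` and `p` are multiples of `m'` and `m` by inverse scalars, so that they
  -- have the same invariant; over `O`, this invariant is a scalar endomorphism of `X`.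
  obtain ⟨c, hc⟩ := h3 (G.map i ≫ δ G X X)
  obtain ⟨d, hd⟩ := h2 (μ G X X ≫ G.map p)
  obtain ⟨τ, hτ⟩ := (hS.end_bijective X hX).2 (i ≫ i ▷ X ≫ (α_ X X X).hom ≫ X ◁ p ≫ p)
  have cancel : ∀ {x y : K}, x • 𝟙 (G.obj X) = y • 𝟙 (G.obj X) → x = y := fun hxy =>
    smul_left_injective K hW0 hxy
  have hcd : c * d = 1 := by
    refine cancel ?_
    have h8 : (G.map i ≫ δ G X X) ≫ μ G X X ≫ G.map p = 𝟙 _ := by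
      simp [← G.map_comp, hip]
    rw [hc, hd, Linear.smul_comp, Linear.comp_smul, h1, smul_smul] at h8
    rw [h8, one_smul]
  refine ⟨τ, cancel ?_⟩
  have h9 := IsScalarExtension.map_tetrahedron (F := G) i p
  rw [← hτ, h.map_smul, G.map_id, hc, hd] at h9
  rw [← h9]
  simp only [MonoidalLinear.smul_whiskerRight, MonoidalLinear.whiskerLeft_smul, Linear.smul_comp,
    Linear.comp_smul, smul_smul, h4]
  congr 1
  linear_combination (c * d + 1) * t * hcd

end Integrality

/-! ### The prime two is bad -/

section BadPrime

theorem pow_eight_eq {k : Type} [Field k] {q : kˣ} (hq : IsPrimitiveRoot (q : k) 16) :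
    (q : k) ^ 8 = -1 := by
  have h1 : ((q : k) ^ 8 - 1) * ((q : k) ^ 8 + 1) = 0 := by linear_combination hq.pow_eq_one
  have h2 : (q : k) ^ 8 - 1 ≠ 0 :=
    sub_ne_zero.2 (hq.pow_ne_one_of_pos_of_lt (by norm_num) (by norm_num))
  linear_combination (mul_eq_zero.1 h1).resolve_left h2

/-- The invariant of `V₂` is not integral at `2`: with `w = q² + q⁻²` it satisfies `t (2 + w) = 1`,
and `w² = 2`. -/
theorem invariant_not_mem {q : Qbarˣ} (hq : IsPrimitiveRoot (q : Qbar) 16)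
    (φ : Qbar →+* PadicAlgCl 2) :
    φ ((1 - (q : Qbar) ^ 2 + (q : Qbar) ^ 4) / (1 + (q : Qbar) ^ 4)) ∉ ZpBar 2 := by
  intro h
  set x : Qbar := (q : Qbar) with hx
  have hx0 : x ≠ 0 := q.ne_zero
  have h8 : x ^ 8 = -1 := pow_eight_eq hq
  have h4 : 1 + x ^ 4 ≠ 0 := one_add_pow_four_ne_zero hq
  set w : Qbar := x ^ 2 + x⁻¹ ^ 2 with hw
  have hw2 : w ^ 2 = 2 := by
    rw [hw]
    field_simp
    linear_combination h8
  have ht : (1 - x ^ 2 + x ^ 4) / (1 + x ^ 4) * (2 + w) = 1 := by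
    rw [hw]
    field_simp
    linear_combination h8
  have hv2 : Valued.v (2 : PadicAlgCl 2) < 1 := by
    have := PadicAlgCl.valuation_p 2
    push_cast at this
    rw [this]
    exact NNReal.coe_lt_coe.1 (by norm_num)
  have hvw : Valued.v (φ w) < 1 := by
    by_contra! h1
    refine absurd (one_le_pow_of_one_le' h1 2) (not_le.2 ?_)
    rw [← map_pow, ← map_pow, hw2, map_ofNat]
    exact hv2
  have h1 : Valued.v (2 + φ w) < 1 := Valuation.map_add_lt _ hv2 hvw
  have h2 := congrArg (fun y => Valued.v (φ y)) ht
  simp only [map_mul, map_add, map_ofNat, map_one] at h2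
  exact absurd h2 (ne_of_lt (((mul_le_mul' h le_rfl).trans_eq (one_mul _)).trans_lt h1))

/-- A good reduction at `2` would make the invariant of `V₂` integral at `2`. -/
theorem isBadPrime_two {q : Qbarˣ} (hq : IsPrimitiveRoot (q : Qbar) 16) :
    IsBadPrime.{v, u} 2 (EvenVerlinde q) := by
  rintro ⟨φ, Cp, _, _, _, _, Ct, _, _, _, _, E, _, _, _, _, -, hCt, hE, -, ⟨G, ⟨_⟩, hG⟩,
    H, ⟨_⟩, hH⟩
  have := hE.preadditive
  have := hE.linear
  obtain ⟨S, hS⟩ := hCt.semisimple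
  have hend := evenObj_end hq (show 2 ≤ 7 by norm_num) rfl
  have h0 := evenObj_id_ne_zero hq (show 2 ≤ 7 by norm_num) rfl
  obtain ⟨τ, hτ⟩ := hG.exists_of_isTrivalent hS (Y := H.obj (evenTwo hq))
    (fun f => by
      obtain ⟨c, hc⟩ := hH.exists_smul hend f
      exact ⟨c, by rw [hc, H.map_id]⟩)
    (hH.id_ne_zero (smul_id_bijective hend h0)) (hH.isTrivalent_map (isTrivalent_evenTwo hq))
  exact invariant_not_mem hq φ (hτ ▸ τ.2)

end BadPrime

/-! ### The root of unity `exp (π i / 8)` -/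

section Numerics

theorem isPrimitiveRoot_q8 : IsPrimitiveRoot (q8 : Qbar) 16 := by
  have h := Complex.isPrimitiveRoot_exp 16 (by norm_num)
  have h1 : (algebraMap Qbar ℂ) (q8 : Qbar) = Complex.exp (2 * Real.pi * Complex.I / (16 : ℕ)) := by
    change Complex.exp (Real.pi * Complex.I / 8) = _
    congr 1
    push_cast
    ring
  rw [← h1] at h
  exact h.of_map_of_injective (algebraMap Qbar ℂ).injective

/-- The field of algebraic numbers is algebraically closed. -/
instance : IsAlgClosed Qbar :=
  (algebraicClosure.isAlgClosure ℚ ℂ).isAlgClosed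

theorem exists_sqrt_q8 : ∃ s : Qbarˣ, (q8 : Qbar) = (s : Qbar) ^ 2 := by
  obtain ⟨z, hz⟩ := IsAlgClosed.exists_pow_nat_eq (q8 : Qbar) (n := 2) (by norm_num)
  have hz0 : z ≠ 0 := by
    rintro rfl
    exact q8.ne_zero (by rw [← hz]; norm_num)
  exact ⟨Units.mk0 z hz0, hz.symm⟩

theorem qInt_eq_qn (n : ℕ) : qInt n = qn q8 n := rfl

theorem qn_q8_three : ((qn q8 3 : Qbar) : ℂ) = 1 + √2 := by
  have h1 : (((q8 : Qbar) ^ 2 : Qbar) : ℂ) = (√2 : ℂ) / 2 * (1 + Complex.I) := by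
    change Complex.exp (Real.pi * Complex.I / 8) ^ 2 = _
    rw [← Complex.exp_nat_mul, show ((2 : ℕ) : ℂ) * (Real.pi * Complex.I / 8) =
      ((Real.pi / 4 : ℝ) : ℂ) * Complex.I by push_cast; ring, Complex.exp_mul_I,
      ← Complex.ofReal_cos, ← Complex.ofReal_sin, Real.cos_pi_div_four, Real.sin_pi_div_four]
    push_cast
    ring
  have h2 : (√2 : ℂ) ^ 2 = 2 := by
    rw [← Complex.ofReal_pow, Real.sq_sqrt (by norm_num)]
    norm_num
  have h3 : (√2 : ℂ) / 2 * (1 + Complex.I) ≠ 0 := by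
    rw [← h1]
    exact fun h => pow_ne_zero 2 q8.ne_zero (Subtype.ext h)
  have h4 : (q8 : Qbar) ^ 4 = ((q8 : Qbar) ^ 2) ^ 2 := by ring
  rw [qn_three isPrimitiveRoot_q8, h4]
  push_cast at h1 ⊢
  rw [h1, inv_mul_eq_iff_eq_mul₀ h3]
  linear_combination (1 / 4 * (1 + Complex.I) ^ 2 - (1 + Complex.I) / 2) * h2 + 1 / 2 * Complex.I_sq

variable {k : Type} [Field k] {q : kˣ} (hq : IsPrimitiveRoot (q : k) 16)
include hq

/-- The symmetry `[m] = [8 - m]`, which comes from `q⁸ = -1`. -/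
theorem qn_symm {m n : ℕ} (h : m + n = 8) : qn q m = qn q n := by
  rw [qn, qn]
  congr 1
  have h0 : (q : k) * ((q⁻¹ : kˣ) : k) = 1 := by simp
  have h1 := pow_eight_eq hq
  have h2 : ((q⁻¹ : kˣ) : k) ^ 8 = -1 := by
    have h3 : ((q : k) * ((q⁻¹ : kˣ) : k)) ^ 8 = 1 := by rw [h0, one_pow]
    rw [mul_pow, h1] at h3
    linear_combination -h3
  have h3 : (q : k) ^ m = - ((q⁻¹ : kˣ) : k) ^ n := by
    have h4 : ((q : k) * ((q⁻¹ : kˣ) : k)) ^ n = 1 := by rw [h0, one_pow]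
    rw [← h, pow_add] at h1
    rw [mul_pow] at h4
    linear_combination - (q : k) ^ m * h4 + ((q⁻¹ : kˣ) : k) ^ n * h1
  have h4 : ((q⁻¹ : kˣ) : k) ^ m = - (q : k) ^ n := by
    have h4 : ((q : k) * ((q⁻¹ : kˣ) : k)) ^ n = 1 := by rw [h0, one_pow]
    rw [← h, pow_add] at h2
    rw [mul_pow] at h4
    linear_combination - ((q⁻¹ : kˣ) : k) ^ m * h4 + (q : k) ^ n * h2
  rw [h3, h4]
  ring

/-- The number `[3]` is a root of `X² - 2 X - 1`, and hence a unit. -/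
theorem qn_three_sq : qn q 3 ^ 2 = 2 * qn q 3 + 1 := by
  rw [qn_three hq]
  have := q.ne_zero
  field_simp
  linear_combination pow_eight_eq hq

theorem invariant_mul_qn_three : (1 - (q : k) ^ 2 + (q : k) ^ 4) / (1 + (q : k) ^ 4) * qn q 3 =
    qn q 3 * (qn q 3 - 2) / (qn q 3 - 1) := by
  have h1 := q.ne_zero
  have h2 := one_add_pow_four_ne_zero hq
  have h3 : qn q 3 - 1 = ((q : k) ^ 2)⁻¹ * (1 + (q : k) ^ 4) := by
    rw [qn_three hq]
    field_simp
    ring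
  rw [h3, qn_three hq]
  field_simp
  ring

end Numerics

section Norms

open Polynomial

/-- A root of a monic integral polynomial with constant term `±1` is relatively prime to all `p`:
the constant term of its minimal polynomial divides `±1`. -/
theorem isRelPrimeTo_of_aeval {x : Qbar} {P : ℤ[X]} (hP : P.Monic) (hx : aeval x P = 0)
    (h0 : IsUnit (P.coeff 0)) (p : ℕ) : IsRelPrimeTo p x := by
  have hi : IsIntegral ℤ x := ⟨P, hP, hx⟩
  obtain ⟨Q, hQ⟩ := minpoly.isIntegrallyClosed_dvd hi hx
  rw [hQ, mul_coeff_zero] at h0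
  exact ⟨hi, isCoprime_one_right.of_isCoprime_of_dvd_right (isUnit_of_mul_isUnit_left h0).dvd⟩

theorem isRelPrimeTo_one (p : ℕ) : IsRelPrimeTo p 1 :=
  isRelPrimeTo_of_aeval (P := X - C 1) (monic_X_sub_C 1) (by simp) (by simp) p

theorem isRelPrimeTo_of_sq {x : Qbar} (hx : x ^ 2 = 2 * x + 1) (p : ℕ) : IsRelPrimeTo p x := by
  refine isRelPrimeTo_of_aeval (P := X ^ 2 - C 2 * X - C 1) (by monicity!) ?_ (by simp) p
  simp only [map_sub, map_mul, map_pow, aeval_X, aeval_C]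
  simp only [eq_intCast, Int.cast_ofNat, Int.cast_one]
  linear_combination hx

theorem isRelPrimeTo_sq_of_sq {x : Qbar} (hx : x ^ 2 = 2 * x + 1) (p : ℕ) :
    IsRelPrimeTo p (x ^ 2) := by
  refine isRelPrimeTo_of_aeval (P := X ^ 2 - C 6 * X + C 1) (by monicity!) ?_ (by simp) p
  simp only [map_add, map_sub, map_mul, map_pow, aeval_X, aeval_C]
  simp only [eq_intCast, Int.cast_ofNat, Int.cast_one]
  linear_combination (x ^ 2 + 2 * x - 1) * hx

end Norms

/-! ### The standard objects -/

section SquaredNorm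

variable {C : Type u} [Category.{v} C] [Preadditive C] [Linear Qbar C] [MonoidalCategory C]

theorem IsSquaredNorm.of_iso {V V' : C} {n : Qbar} (φ : V ≅ V') (h : IsSquaredNorm V' n) :
    IsSquaredNorm V n := by
  obtain ⟨W, e, e', h⟩ := h
  refine ⟨W, @exactPairingCongrLeft C _ _ V V' W e φ, @exactPairingCongrRight C _ _ W V V' e' φ, ?_⟩
  rw [← h]
  change ((e.coevaluation' ≫ φ.inv ▷ W) ≫ φ.hom ▷ W ≫ e'.evaluation') ≫
    ((e'.coevaluation' ≫ W ◁ φ.inv) ≫ W ◁ φ.hom ≫ e.evaluation') = _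
  simp

/-- Müger's squared norm of an object with scalar endomorphisms is well-defined. -/
theorem IsSquaredNorm.unique [MonoidalPreadditive C] [MonoidalLinear Qbar C] {V : C} {n n' : Qbar}
    (hV : ∀ f : V ⟶ V, ∃ c : Qbar, f = c • 𝟙 V) (hV0 : 𝟙 V ≠ 0) (h1 : 𝟙 (𝟙_ C) ≠ 0)
    (h : IsSquaredNorm V n) (h' : IsSquaredNorm V n') : n = n' := by
  obtain ⟨W, e, e', h⟩ := h
  obtain ⟨W', d, d', h'⟩ := h'
  have h2 := loop_comp_loop_unique hV hV0 e e' d d'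
  rw [h, h'] at h2
  exact (smul_left_injective Qbar h1 h2).symm

/-- The squared norm of `V_n` is the square of its quantum dimension: both circles are equal to
the quantum dimension. -/
theorem isSquaredNorm_evenObj {q : Qbarˣ} (hq : IsPrimitiveRoot (q : Qbar) 16) {n : ℕ} (hn : n ≤ 7)
    (h : n % 2 = 0) : IsSquaredNorm (evenObj hq hn h) (qn q (n + 1) ^ 2) := by
  have hQ := sub_inv_ne_zero hq
  have h1 : (weylT hq hn).pairing.coevaluation' ≫ (weylT hq hn).pairing'.evaluation' =
      qn q (n + 1) • 𝟙 _ := by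
    have h1 := (weylT hq hn).loop (𝟙 _)
    rw [MonoidalCategory.id_whiskerRight, Category.id_comp] at h1
    refine h1.trans (congrArg (fun c : Qbar => c • 𝟙 (𝟙_ (Tilting q))) ?_)
    refine Eq.trans ?_ (trace_weylKinv q hQ n)
    rw [← (weyl_actions hq hn).2.1]
    exact congrArg _ (Matrix.one_mul _)
  have h2 : (weylT hq hn).pairing'.coevaluation' ≫ (weylT hq hn).pairing.evaluation' =
      qn q (n + 1) • 𝟙 _ := by
    have h1 := (weylT hq hn).loop' (𝟙 _)
    rw [MonoidalCategory.whiskerLeft_id, Category.id_comp] at h1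
    refine h1.trans (congrArg (fun c : Qbar => c • 𝟙 (𝟙_ (Tilting q))) ?_)
    refine Eq.trans ?_ (trace_weylK q hQ n)
    rw [← (weyl_actions hq hn).1]
    exact congrArg _ (Matrix.one_mul _)
  have h3 : (evenObj hq hn h).pairing.coevaluation' ≫ (evenObj hq hn h).pairing'.evaluation' =
      qn q (n + 1) • 𝟙 _ :=
    ObjectProperty.hom_ext _ (congrArg (NegligibleQuotient.proj (k := Qbar)) h1)
  have h4 : (evenObj hq hn h).pairing'.coevaluation' ≫ (evenObj hq hn h).pairing.evaluation' =
      qn q (n + 1) • 𝟙 _ :=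
    ObjectProperty.hom_ext _ (congrArg (NegligibleQuotient.proj (k := Qbar)) h2)
  refine ⟨_, (evenObj hq hn h).pairing, (evenObj hq hn h).pairing', ?_⟩
  rw [h3, h4, Linear.smul_comp, Linear.comp_smul, Category.comp_id, smul_smul, sq]

end SquaredNorm

section Standard

variable {k : Type} [Field k] {q : kˣ} (hq : IsPrimitiveRoot (q : k) 16)

/-- The sequence of objects `V_0, V_1, …, V_7`, continued by unit objects. -/
def vStd (n : ℕ) : VerlindeCat q := if h : n ≤ 7 then vObj hq h else 𝟙_ _

theorem vStd_eq {n : ℕ} (hn : n ≤ 7) : vStd hq n = vObj hq hn := dif_pos hn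

theorem vStd_tensor {n : ℕ} (hn : n + 2 ≤ 7) :
    IsDirectSum ![vStd hq n, vStd hq (n + 2)] (vStd hq (n + 1) ⊗ vStd hq 1) := by
  rw [vStd_eq hq hn, vStd_eq hq (show n ≤ 7 by omega), vStd_eq hq (show n + 1 ≤ 7 by omega),
    vStd_eq hq (show 1 ≤ 7 by norm_num)]
  exact (vObj_tensor_fund hq hn).of_iso (whiskerLeftIso _ (vObjOneIso hq).symm)

theorem simpleObj_iff (X : VerlindeCat q) : simpleObj hq X ↔ ∃ i ≤ 6, X = vStd hq i := by
  refine exists_congr fun n => ⟨?_, ?_⟩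
  · rintro ⟨hn, rfl⟩
    exact ⟨hn, (vStd_eq hq _).symm⟩
  · rintro ⟨hn, rfl⟩
    exact ⟨hn, vStd_eq hq _⟩

theorem mem_even_iff (n : ℕ) : n ∈ ({0, 2, 4, 6} : Set ℕ) ↔ n ≤ 6 ∧ n % 2 = 0 := by
  simp only [Set.mem_insert_iff, Set.mem_singleton_iff]
  omega

theorem parityObj_zero_iff (X : VerlindeCat q) :
    parityObj hq 0 X ↔ ∃ i ∈ ({0, 2, 4, 6} : Set ℕ), X = vStd hq i := by
  refine exists_congr fun n => ?_
  rw [mem_even_iff]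
  constructor
  · rintro ⟨hn, h0, rfl⟩
    exact ⟨⟨hn, h0⟩, (vStd_eq hq _).symm⟩
  · rintro ⟨⟨hn, h0⟩, rfl⟩
    exact ⟨hn, h0, vStd_eq hq _⟩

variable {s : kˣ} (hs : (q : k) = s ^ 2)

include hs in
theorem isEven_iff_isDirectSum (Y : VerlindeCat q) :
    VerlindeCat.IsEven q Y ↔ ∃ (n : ℕ) (f : Fin n → ℕ),
      (∀ a, f a ∈ ({0, 2, 4, 6} : Set ℕ)) ∧ IsDirectSum (fun a => vStd hq (f a)) Y := by
  constructor
  · intro h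
    obtain ⟨n, X, hX, h⟩ := exists_sum_of_isEven hq hs h
    choose f hf hXf using fun a => (parityObj_zero_iff hq _).1 (hX a)
    obtain rfl : X = fun a => vStd hq (f a) := funext hXf
    exact ⟨n, f, hf, h⟩
  · rintro ⟨n, f, hf, h⟩
    exact (isEven_iff hq hs Y).2
      (h.id_mem_factorThrough fun a => (parityObj_zero_iff hq _).2 ⟨f a, hf a, rfl⟩)

include hs in
theorem isEven_iff_tensorClosure (Y : VerlindeCat q) :
    VerlindeCat.IsEven q Y ↔
      tensorClosure (fun X => ∃ i ∈ ({0, 2, 4, 6} : Set ℕ), X = vStd hq i) Y := by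
  constructor
  · intro h
    refine tensorClosure.of_id_mem (VerlindeCat.hasSums q)
      (factorThrough_le (fun W hW => ?_) _ _ ((isEven_iff hq hs Y).1 h))
    exact id_mem_factorThrough (tensorClosure.of _ ((parityObj_zero_iff hq W).1 hW))
  · intro h
    induction h with
    | of X hX =>
      obtain ⟨i, hi, rfl⟩ := hX
      rw [mem_even_iff] at hi
      rw [vStd_eq hq (by omega)]
      exact isEven_vObj hq _ hi.2
    | unit => exact tensorClosure.unit
    | tensor X Y _ _ hX hY => exact tensorClosure.tensor _ _ hX hY
    | summand X Y Z i p j r h _ _ hX hY => exact tensorClosure.summand _ _ _ i p j r h hX hY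

/-- Isomorphisms of objects of a full subcategory. -/
def isoOfObj {X Y : EvenVerlinde q} (e : X.obj ≅ Y.obj) : X ≅ Y := ObjectProperty.isoMk _ e

include hs in
theorem simple_iff_evenObj (W : EvenVerlinde q) : Simple W ↔
    ∃ (n : ℕ) (_ : n ≤ 6) (h : n % 2 = 0), Nonempty (W ≅ evenObj hq (show n ≤ 7 by omega) h) := by
  rw [(isSimpleFamily_evenSimples hq hs).simple_iff]
  constructor
  · rintro ⟨X, ⟨n, hn, h, hX⟩, ⟨e⟩⟩
    exact ⟨n, hn, h, ⟨e ≪≫ isoOfObj (eqToIso hX)⟩⟩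
  · rintro ⟨n, hn, h, e⟩
    exact ⟨_, ⟨n, hn, h, rfl⟩, e⟩

include hs in
theorem simple_iff_vStd (W : EvenVerlinde q) : Simple W ↔
    ∃ i ∈ ({0, 2, 4, 6} : Set ℕ), Nonempty (W.obj ≅ vStd hq i) := by
  rw [simple_iff_evenObj hq hs]
  refine exists_congr fun n => ?_
  rw [mem_even_iff]
  constructor
  · rintro ⟨hn, h, ⟨e⟩⟩
    rw [vStd_eq hq (by omega)]
    exact ⟨⟨hn, h⟩, ⟨(ObjectProperty.ι _).mapIso e⟩⟩
  · rintro ⟨⟨hn, h⟩, ⟨e⟩⟩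
    rw [vStd_eq hq (by omega)] at e
    exact ⟨hn, h, ⟨isoOfObj (Y := evenObj hq _ h) e⟩⟩

include hs in
/-- The braiding of tilting modules induces one on the even part. -/
theorem nonempty_braided : Nonempty (BraidedCategory (EvenVerlinde q)) := by
  let := tiltingBraided hs
  exact ⟨inferInstance⟩

include hq in
theorem qn_eq_of_even {n : ℕ} (hn : n ≤ 6) (h : n % 2 = 0) :
    qn q (n + 1) = 1 ∨ qn q (n + 1) = qn q 3 := by
  have : n = 0 ∨ n = 2 ∨ n = 4 ∨ n = 6 := by omega
  obtain rfl | rfl | rfl | rfl := this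
  · exact .inl (qn_one hq)
  · exact .inr rfl
  · exact .inr (qn_symm hq rfl)
  · exact .inl ((qn_symm hq rfl).trans (qn_one hq))

end Standard

section Norms

variable {q : Qbarˣ} (hq : IsPrimitiveRoot (q : Qbar) 16) {s : Qbarˣ} (hs : (q : Qbar) = s ^ 2)
include hq hs

theorem isSquaredNorm_iff {W : EvenVerlinde q} (hW : Simple W) (n : Qbar) :
    IsSquaredNorm W n ↔ n = W.obj.qdim ^ 2 := by
  obtain ⟨m, hm, h, ⟨e⟩⟩ := (simple_iff_evenObj hq hs W).1 hW
  have h1 : W.obj.qdim = qn q (m + 1) :=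
    (VerlindeCat.qdim_eq_of_iso ((ObjectProperty.ι _).mapIso e)).trans (vObj_qdim hq _)
  have h2 : IsSquaredNorm W (W.obj.qdim ^ 2) :=
    h1 ▸ (isSquaredNorm_evenObj hq (show m ≤ 7 by omega) h).of_iso e
  refine ⟨fun h3 => ?_, fun h3 => h3 ▸ h2⟩
  exact h3.unique (exists_smul_id_of_iso e.symm (evenObj_end hq _ h))
    (id_ne_zero_of_iso e.symm (evenObj_id_ne_zero hq _ h)) (even_unit_id_ne_zero hq) h2

/-- The dimensions of the simple objects are `1` and the roots of `X² - 2 X - 1`. -/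
theorem qdim_eq {W : EvenVerlinde q} (hW : Simple W) :
    W.obj.qdim = 1 ∨ W.obj.qdim ^ 2 = 2 * W.obj.qdim + 1 := by
  obtain ⟨m, hm, h, ⟨e⟩⟩ := (simple_iff_evenObj hq hs W).1 hW
  have h1 : W.obj.qdim = qn q (m + 1) :=
    (VerlindeCat.qdim_eq_of_iso ((ObjectProperty.ι _).mapIso e)).trans (vObj_qdim hq _)
  rw [h1]
  obtain h2 | h2 := qn_eq_of_even hq hm h
  · exact .inl h2
  · rw [h2]
    exact .inr (qn_three_sq hq)

theorem qdim_unit {W : EvenVerlinde q} (hW : Simple W) :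
    W.obj.qdim ≠ 0 ∧ IsIntegral ℤ W.obj.qdim ∧ IsIntegral ℤ (W.obj.qdim)⁻¹ ∧
      ∀ p : ℕ, p.Prime → IsRelPrimeTo p W.obj.qdim ∧ IsRelPrimeTo p (W.obj.qdim ^ 2) := by
  obtain h | h := qdim_eq hq hs hW
  · rw [h, inv_one, one_pow]
    exact ⟨one_ne_zero, isIntegral_one, isIntegral_one, fun p _ =>
      ⟨isRelPrimeTo_one p, isRelPrimeTo_one p⟩⟩
  · have h0 : W.obj.qdim ≠ 0 := by
      intro h0
      rw [h0] at h
      norm_num at h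
    have h1 : (W.obj.qdim)⁻¹ = W.obj.qdim - 2 := by
      refine inv_eq_of_mul_eq_one_right ?_
      linear_combination h
    have hi := (isRelPrimeTo_of_sq h 2).1
    refine ⟨h0, hi, ?_, fun p _ => ⟨isRelPrimeTo_of_sq h p, isRelPrimeTo_sq_of_sq h p⟩⟩
    rw [h1]
    exact hi.sub (isIntegral_algebraMap (R := ℤ) (x := 2))

end Norms

theorem isStandard_vStd : IsStandard (vStd isPrimitiveRoot_q8) where
  zero := ⟨eqToIso (vStd_eq _ _) ≪≫ vObjZeroIso isPrimitiveRoot_q8⟩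
  one := ⟨eqToIso (vStd_eq _ _) ≪≫ vObjOneIso isPrimitiveRoot_q8⟩
  step i hi := vStd_tensor isPrimitiveRoot_q8 (by omega)

end Verlinde

end

theorem mainTheorem8 :
    ∃ V : ℕ → VerlindeCat q8,
      -- the Verlinde category and its simple objects `V_0, …, V_6`
      IsStandard V ∧
      IsSimpleFamily Qbar {X | ∃ i ≤ 6, X = V i} ∧
      (∀ i ≤ 6, ∀ j ≤ 6, Nonempty (V i ≅ V j) → i = j) ∧
      -- its even part is the tensor subcategory generated by `V_0, V_2, V_4, V_6`, and a braided
      -- fusion category with these simple objects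
      (∀ Y, VerlindeCat.IsEven q8 Y ↔ ∃ (n : ℕ) (f : Fin n → ℕ),
        (∀ a, f a ∈ ({0, 2, 4, 6} : Set ℕ)) ∧ IsDirectSum (fun a => V (f a)) Y) ∧
      (∀ Y, VerlindeCat.IsEven q8 Y ↔
        tensorClosure (fun X => ∃ i ∈ ({0, 2, 4, 6} : Set ℕ), X = V i) Y) ∧
      IsFusion Qbar (EvenVerlinde q8) ∧
      Nonempty (BraidedCategory (EvenVerlinde q8)) ∧
      (∀ W : EvenVerlinde q8, Simple W ↔
        ∃ i ∈ ({0, 2, 4, 6} : Set ℕ), Nonempty (W.obj ≅ V i)) ∧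
      -- the dimensions of the simple objects are units
      (((V 0).qdim : ℂ) = 1 ∧ ((V 6).qdim : ℂ) = 1 ∧
        ((V 2).qdim : ℂ) = 1 + √2 ∧ ((V 4).qdim : ℂ) = 1 + √2) ∧
      (∀ W : EvenVerlinde q8, Simple W →
        (∀ n : Qbar, IsSquaredNorm W n ↔ n = W.obj.qdim ^ 2) ∧
        W.obj.qdim ≠ 0 ∧ IsIntegral ℤ W.obj.qdim ∧ IsIntegral ℤ (W.obj.qdim)⁻¹ ∧
        ∀ p : ℕ, p.Prime → IsRelPrimeTo p W.obj.qdim ∧ IsRelPrimeTo p (W.obj.qdim ^ 2)) ∧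
      -- the amplitude of `T_4`
      (∃ c : Qbar, c = qInt 3 * (qInt 3 - 2) / (qInt 3 - 1) ∧ (c : ℂ) = 1 / √2 ∧
        ∀ X : EvenVerlinde q8, Nonempty (X.obj ≅ V 2) →
          (∃ (_ : ExactPairing X X) (m : X ⊗ X ⟶ X), dualVertex m ≫ m = 𝟙 X) ∧
          ∀ (_ : ExactPairing X X) (m : X ⊗ X ⟶ X),
            (m ≠ 0 → ampT2 m ≠ 0) ∧
            (dualVertex m ≫ m = 𝟙 X → ampT4 m = c • 𝟙 (𝟙_ (EvenVerlinde q8))) ∧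
            (ampT2 m = 𝟙 _ → ampT4 m = (c / qInt 3 ^ 2) • 𝟙 (𝟙_ (EvenVerlinde q8)))) ∧
      -- `2` is a bad prime
      IsBadPrime.{v, u} 2 (EvenVerlinde q8) ∧
      -- the necessary condition for good primes is not sufficient for braided fusion categories
      ¬ ∀ (C : Type 1) [Category.{0} C] [Preadditive C] [Linear Qbar C] [MonoidalCategory C]
          [BraidedCategory C], IsFusion Qbar C → ∀ (p : ℕ) [Fact p.Prime],
          (∀ W : C, Simple W → ∀ n, IsSquaredNorm W n → IsRelPrimeTo p n) →
            IsGoodPrime.{v, u} p C := by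
  have hq := isPrimitiveRoot_q8
  obtain ⟨s, hs⟩ := exists_sqrt_q8
  have h3 : ((qn q8 3 : Qbar) : ℂ) = 1 + √2 := qn_q8_three
  have hdim : ∀ {n : ℕ} (hn : n ≤ 7), (vStd hq n).qdim = qn q8 (n + 1) := fun hn => by
    rw [vStd_eq hq hn, vObj_qdim]
  refine ⟨vStd hq, isStandard_vStd, ?_, ?_, isEven_iff_isDirectSum hq hs,
    isEven_iff_tensorClosure hq hs, isFusion_even hq hs, nonempty_braided hs,
    simple_iff_vStd hq hs, ⟨?_, ?_, ?_, ?_⟩,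
    fun W hW => ⟨isSquaredNorm_iff hq hs hW, qdim_unit hq hs hW⟩,
    ⟨qInt 3 * (qInt 3 - 2) / (qInt 3 - 1), rfl, ?_, fun X hX => ?_⟩, isBadPrime_two hq, fun H => ?_⟩
  · have h : {X | simpleObj hq X} = {X | ∃ i ≤ 6, X = vStd hq i} :=
      Set.ext fun X => simpleObj_iff hq X
    exact h ▸ isSimpleFamily_simpleObj hq hs
  · rintro i hi j hj ⟨e⟩
    rw [vStd_eq hq (show i ≤ 7 by omega), vStd_eq hq (show j ≤ 7 by omega)] at e
    exact vObj_index_unique hq _ _ hi e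
  · rw [hdim (by norm_num), qn_one hq]
    rfl
  · rw [hdim (by norm_num), qn_symm hq (show 6 + 1 + 1 = 8 from rfl), qn_one hq]
    rfl
  · rw [hdim (by norm_num), h3]
  · rw [hdim (by norm_num), qn_symm hq (show 4 + 1 + 3 = 8 from rfl), h3]
  · have h2 : (√2 : ℂ) ^ 2 = 2 := by
      rw [← Complex.ofReal_pow, Real.sq_sqrt (by norm_num)]
      norm_num
    have h0 : (√2 : ℂ) ≠ 0 := fun h => by norm_num [h] at h2
    rw [qInt_eq_qn]
    push_cast
    rw [h3, show ((2 : Qbar) : ℂ) = 2 from rfl]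
    field_simp
    linear_combination (√2 : ℂ) * h2
  · obtain ⟨φ⟩ := hX
    rw [vStd_eq hq (show 2 ≤ 7 by norm_num)] at φ
    exact amplitudes hq rfl (invariant_mul_qn_three hq).symm (isoOfObj (Y := evenTwo hq) φ)
  · obtain ⟨hb⟩ := nonempty_braided hs
    refine isBadPrime_two.{v, u} hq (H (EvenVerlinde q8) (isFusion_even hq hs) 2 fun W hW n hn => ?_)
    rw [(isSquaredNorm_iff hq hs hW n).1 hn]
    exact ((qdim_unit hq hs hW).2.2.2 2 Nat.prime_two).2
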